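/- **Setting.** Let $n,m\ge 1$ be integers, $\tau>0$, and let $\mu$ be the sum of the Lebesgue measure on $[-\tau,0]$ and the unit mass at $0$. Put $\mathbb H=L_2([-\tau,0];\mu;\mathbb R^n)$ and identify $\mathbb H^{\otimes m}$ with $\mathcal L^{\otimes}_m=L_2([-\tau,0]^m;\mu^{\otimes m};(\mathbb R^n)^{\otimes m})$ via $(\phi_1\otimes\cdots\otimes\phi_m)(\theta_1,\dots,\theta_m)=\phi_1(\theta_1)\otimes\cdots\otimes\phi_m(\theta_m)$. Let $\widetilde A\colon C([-\tau,0];\mathbb R^n)\to\mathbb R^n$ be a bounded linear operator. Let $A$ be the operator in $\mathbb H$ whose domain consists of the $\phi$ given $\mu$-a.e. by the continuous representative $\psi$ of an element of $W^{1,2}(-\tau,0;\mathbb R^n)$ (so $\phi(0)=\psi(0)$), with $(A\phi)(0)=\widetilde A\psi$ and $A\phi=\psi'$ on $(-\tau,0)$. Let $G$ be the $C_0$-semigroup in $\mathbb H$ generated by $A$, and let $A^{[\otimes m]}$, with domain $\mathcal D(A^{[\otimes m]})\subset\mathcal L^{\otimes}_m$, be the generator of $t\mapsto G(t)^{\otimes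 m}$. For $0\le k\le m$ and $1\le j_1<\dots<j_k\le m$ let $R_{j_1\ldots j_k}\Phi\in L_2((-\tau,0)^k;(\mathbb R^n)^{\otimes m})$ be the restriction of $\Phi\in\mathcal L^{\otimes}_m$ to the face where $\theta_j=0$ for all $j\notin\{j_1,\dots,j_k\}$, considered as a function of the remaining $k$ arguments (for $k=0$ it is the value of $\Phi$ at the origin). **Diagonal Sobolev spaces.** Put $F=(\mathbb R^n)^{\otimes m}$. For an open set $\Omega\subset\mathbb R^k$, $k\geq 1$, a function $f\in L_2(\Omega;F)$ has the diagonal derivative $Df=\left(\sum_{i=1}^k\partial/\partial\theta_i\right)f=g\in L_2(\Omega;F)$ if on the intersection of $\Omega$ with almost every line parallel to $(1,\dots,1)$ the function $f$, parametrized by $t\mapsto x+(t,\dots,t)$, is in $W^{1,2}$ with weak derivative $g$. Let $\mathcal W^2_D(\mathbb R^k;F)$ be the space of all $f\in L_2(\mathbb R^k;F)$ having a diagonal derivative, and let $\mathcal W^2_D(\Omega;F)$ be the space of restrictions to $\Omega$ of elements of $\mathcal W^2_D(\mathbb R^k;F)$. For $f\in\mathcal W^2_D((-\tau,0)^k;F)$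 and $1\le l\le k$, the trace $\operatorname{Tr}_l f$ on the face $\mathcal B_{\widehat l}=\{\theta\in[-\tau,0]^k:\theta_l=0\}$ assigns to almost every $\theta\in\mathcal B_{\widehat l}$ the value at $\theta$ of the continuous representative of $f$ along the diagonal line through $\theta$. The norm on $\mathcal W^2_D((-\tau,0)^k;F)$ is $$\|f\|^2_{\mathcal W^2_D}=\|f\|^2_{L_2((-\tau,0)^k)}+\|Df\|^2_{L_2((-\tau,0)^k)}+\sum_{l=1}^k\|\operatorname{Tr}_l f\|^2_{L_2(\mathcal B_{\widehat l})}.$$ **Theorem.** For every $\Phi\in\mathcal D(A^{[\otimes m]})$, $k\in\{1,\dots,m\}$ and $1\le j_1<\dots<j_k\le m$ we have $R_{j_1\ldots j_k}\Phi\in\mathcal W^2_D((-\tau,0)^k;(\mathbb R^n)^{\otimes m})$, and for every $l\in\{1,\dots,k\}$ $$(\operatorname{Tr}_l R_{j_1\ldots j_k}\Phi)(\theta)=(R_{j_1\ldots\widehat{j_l}\ldots j_k}\Phi)(\theta_{\widehat l})\quad\text{for almost all }\theta\in\mathcal B_{\widehat l}$$ with respect to the $(k-1)$-dimensional Lebesgue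 measure, where the hat means that the $l$-th index is omitted and $\theta_{\widehat l}$ is $\theta$ without its $l$-th component. Moreover, the norm on $\mathcal D(A^{[\otimes m]})$ given by $$\|\Phi\|^2_{\mathcal W^2_D}=\sum_{k=1}^m\ \sum_{1\le j_1<\dots<j_k\le m}\|R_{j_1\ldots j_k}\Phi\|^2_{\mathcal W^2_D((-\tau,0)^k;(\mathbb R^n)^{\otimes m})}$$ is equivalent to the graph norm $\left(\|\Phi\|^2+\|A^{[\otimes m]}\Phi\|^2\right)^{1/2}$. -/

import Mathlib

open MeasureTheory Set Filter Topology
open scoped NNReal ENNReal ContDiff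

namespace DelayCompound

/-! ### C₀-semigroups, generators and tensor powers -/

section Semigroups

variable {E : Type*} [NormedAddCommGroup E] [NormedSpace ℝ E]

/-- `G` is a strongly continuous one-parameter semigroup of bounded operators in `E`. -/
structure IsC0Semigroup (G : ℝ≥0 → E →L[ℝ] E) : Prop where
  map_zero : G 0 = ContinuousLinearMap.id ℝ E
  map_add : ∀ s t : ℝ≥0, G (s + t) = (G s).comp (G t)
  continuous_orbit : ∀ x : E, Continuous fun t => G t x

/-- The graph of the generator of `G`: the pairs `(x, y)` such that
`(G h x - x) / h → y` as `h → 0+`. In particular, the domain of the generator is the set of all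
`x` for which the limit exists. -/
def generatorGraph (G : ℝ≥0 → E →L[ℝ] E) : Set (E × E) :=
  {q | Tendsto (fun h : ℝ≥0 => (h : ℝ)⁻¹ • (G h q.1 - q.1)) (𝓝[>] 0) (𝓝 q.2)}

open Classical in
/-- The C₀-semigroup whose generator is the (unbounded) operator with the graph `A`. A generator
determines its semigroup. (By convention `0` if `A` does not generate a C₀-semigroup.) -/
noncomputable def generatedSemigroup (A : Set (E × E)) : ℝ≥0 → E →L[ℝ] E :=
  if h : ∃ G : ℝ≥0 → E →L[ℝ] E, IsC0Semigroup G ∧ generatorGraph G = A then h.choose else 0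

end Semigroups

/-! ### The spaces -/

/-- The Euclidean space `ℝⁿ`. -/
abbrev Vec (n : ℕ) : Type := EuclideanSpace ℝ (Fin n)

/-- The `m`-fold tensor power of the Euclidean space `ℝⁿ`, written in coordinates with respect to
the orthonormal basis `e_{i₁} ⊗ ⋯ ⊗ e_{i_m}`. -/
abbrev TensorVec (m n : ℕ) : Type := EuclideanSpace ℝ (Fin m → Fin n)

/-- The decomposable tensor `v₁ ⊗ ⋯ ⊗ v_m`. -/
noncomputable def tensorVec {m n : ℕ} (v : Fin m → Vec n) : TensorVec m n :=
  WithLp.toLp 2 fun i => ∏ a, v a (i a)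

/-- The measure on `[-τ, 0]` that is the sum of the Lebesgue measure and the unit mass at `0`. -/
noncomputable def delayMeasure (τ : ℝ) : Measure ℝ :=
  volume.restrict (Icc (-τ) 0) + Measure.dirac 0

instance (τ : ℝ) : IsFiniteMeasure (delayMeasure τ) := by
  unfold delayMeasure; infer_instance

/-- The Hilbert space `ℍ = L₂([-τ, 0]; μ; ℝⁿ)`. -/
abbrev HSpace (n : ℕ) (τ : ℝ) : Type := Lp (Vec n) 2 (delayMeasure τ)

/-- The Hilbert space `L₂([-τ, 0]ᵐ; μ^{⊗ m}; (ℝⁿ)^{⊗ m})`, the concrete form of `ℍ^{⊗ m}`. -/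
abbrev TensorSpace (m n : ℕ) (τ : ℝ) : Type :=
  Lp (TensorVec m n) 2 (Measure.pi fun _ : Fin m => delayMeasure τ)

theorem memLp_tensor {m n : ℕ} {τ : ℝ} (φ : Fin m → HSpace n τ) :
    MemLp (fun θ : Fin m → ℝ => tensorVec fun a => φ a (θ a)) 2
      (Measure.pi fun _ : Fin m => delayMeasure τ) := by
  refine MemLp.of_eval_piLp fun i => ?_
  have hφ : ∀ a, MemLp (fun s : ℝ => φ a s (i a)) 2 (delayMeasure τ) := fun a =>
    (Lp.memLp (φ a)).eval_piLp (i a)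
  have hm : AEStronglyMeasurable (fun θ : Fin m → ℝ => ∏ a, φ a (θ a) (i a))
      (Measure.pi fun _ : Fin m => delayMeasure τ) :=
    (Integrable.fintype_prod (𝕜 := ℝ) (f := fun a s => φ a s (i a))
      (fun a => (hφ a).integrable (by norm_num))).aestronglyMeasurable
  refine (memLp_two_iff_integrable_sq hm).2 ?_
  have := Integrable.fintype_prod (𝕜 := ℝ) (f := fun a s => (φ a s (i a)) ^ 2)
    (μ := fun _ : Fin m => delayMeasure τ) (fun a => (hφ a).integrable_sq)
  simpa only [Finset.prod_pow] using this

/-- The decomposable tensor `φ₁ ⊗ ⋯ ⊗ φ_m`, that is, the function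
`(θ₁, …, θ_m) ↦ φ₁(θ₁) ⊗ ⋯ ⊗ φ_m(θ_m)`. -/
noncomputable def tensor {m n : ℕ} {τ : ℝ} (φ : Fin m → HSpace n τ) : TensorSpace m n τ :=
  (memLp_tensor φ).toLp _

open Classical in
/-- The `m`-fold multiplicative compound `T^{⊗ m}`: the bounded operator determined by
`T^{⊗ m}(φ₁ ⊗ ⋯ ⊗ φ_m) = Tφ₁ ⊗ ⋯ ⊗ Tφ_m` (decomposable tensors span a dense subspace). -/
noncomputable def tensorPower (m : ℕ) {n : ℕ} {τ : ℝ} (T : HSpace n τ →L[ℝ] HSpace n τ) :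
    TensorSpace m n τ →L[ℝ] TensorSpace m n τ :=
  if h : ∃ S : TensorSpace m n τ →L[ℝ] TensorSpace m n τ,
      ∀ φ : Fin m → HSpace n τ, S (tensor φ) = tensor fun a => T (φ a)
  then h.choose else 0

/-! ### The delay operator and its additive compound -/

/-- On the open set `I ⊆ ℝ` the function `f` belongs to `W^{1,2}(I; F)` and its weak derivative
is `g`. -/
def HasSobolevDeriv {F : Type*} [NormedAddCommGroup F] [NormedSpace ℝ F] (I : Set ℝ)
    (f g : ℝ → F) : Prop :=
  MemLp f 2 (volume.restrict I) ∧ MemLp g 2 (volume.restrict I) ∧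
    ∀ ζ : ℝ → ℝ, ContDiff ℝ ∞ ζ → HasCompactSupport ζ → tsupport ζ ⊆ I →
      ∫ t in I, deriv ζ t • f t = -∫ t in I, ζ t • g t

/-- The graph of the operator `A` in `ℍ` associated with `Atilde : C([-τ, 0]; ℝⁿ) → ℝⁿ`.
Its domain consists of those `φ` that are given `μ`-a.e. on `[-τ, 0]` by the continuous
representative `ψ` of an element of `W^{1,2}(-τ, 0; ℝⁿ)` (thus `φ(0) = ψ(0)`), and `Aφ` has the
value `Atilde ψ` at `0` and equals the weak derivative of `ψ` on `(-τ, 0)`. The function `ψ` is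
continuous on `ℝ`, but only its restriction to `[-τ, 0]` matters. -/
def delayOperator {n : ℕ} {τ : ℝ} (Atilde : C(Icc (-τ) (0 : ℝ), Vec n) →L[ℝ] Vec n) :
    Set (HSpace n τ × HSpace n τ) :=
  {q | ∃ (ψ : C(ℝ, Vec n)) (g : ℝ → Vec n), HasSobolevDeriv (Ioo (-τ) 0) ψ g ∧
    (∀ᵐ s ∂delayMeasure τ, q.1 s = ψ s) ∧
    (∀ᵐ s ∂delayMeasure τ,
      q.2 s = if s = 0 then Atilde (ψ.restrict (Icc (-τ) (0 : ℝ))) else g s)}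

/-- The graph of the additive compound `A^{[⊗ m]}`: the generator of the semigroup
`t ↦ G(t)^{⊗ m}`, where `G` is the C₀-semigroup generated by `A`. -/
def additiveCompound (m : ℕ) {n : ℕ} {τ : ℝ}
    (Atilde : C(Icc (-τ) (0 : ℝ), Vec n) →L[ℝ] Vec n) :
    Set (TensorSpace m n τ × TensorSpace m n τ) :=
  generatorGraph fun t => tensorPower m (generatedSemigroup (delayOperator Atilde) t)

/-- The domain of `A^{[⊗ m]}`. -/
def additiveCompoundDomain (m : ℕ) {n : ℕ} {τ : ℝ}
    (Atilde : C(Icc (-τ) (0 : ℝ), Vec n) →L[ℝ] Vec n) : Set (TensorSpace m n τ) :=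
  {Φ | ∃ Ψ, (Φ, Ψ) ∈ additiveCompound m Atilde}

/-- The restriction `R_{j₁…j_k} Φ` of `Φ` to the `k`-face where `θ_i = 0` for
`i ∉ {j₁, …, j_k}`, as a function of `(θ₁, …, θ_k)`; the increasing tuple `j₁ < ⋯ < j_k` is an order
embedding `j`. Up to null sets on `(-τ, 0)ᵏ` it does not depend on the representative of `Φ`. -/
noncomputable def faceRestriction {m n k : ℕ} {τ : ℝ} (j : Fin k ↪o Fin m)
    (Φ : TensorSpace m n τ) : (Fin k → ℝ) → TensorVec m n :=
  fun θ => Φ (Function.extend j θ 0)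

/-! ### Diagonal Sobolev spaces -/

section DiagonalSobolev

variable {F : Type*} [NormedAddCommGroup F] [NormedSpace ℝ F]

/-- The open cube `(-τ, 0)ᵏ`. -/
def cube (τ : ℝ) (k : ℕ) : Set (Fin k → ℝ) := Set.pi univ fun _ => Ioo (-τ) 0

/-- The point `x + (t, …, t)`. -/
def diagShift {k : ℕ} (x : Fin k → ℝ) (t : ℝ) : Fin k → ℝ := fun i => x i + t

/-- `Φ` belongs to the preparatory diagonal Sobolev space on the open set `Ω ⊆ ℝᵏ` and `Ψ` is its
diagonal derivative `(∑ ∂/∂θ_i) Φ`: both are in `L₂(Ω; F)` and on the intersection of `Ω` with almost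
every line parallel to the diagonal, `Φ` is in `W^{1,2}` with derivative `Ψ`. Almost every line is
expressed as the line through almost every point `x` of `ℝᵏ`: the condition depends only on the line
through `x`, so that exceptional sets are unions of lines, and these are null exactly if
their sections by the orthogonal complement of the diagonal are null. -/
def HasDiagDeriv {k : ℕ} (Ω : Set (Fin k → ℝ)) (Φ Ψ : (Fin k → ℝ) → F) : Prop :=
  MemLp Φ 2 (volume.restrict Ω) ∧ MemLp Ψ 2 (volume.restrict Ω) ∧
    ∀ᵐ x : Fin k → ℝ, HasSobolevDeriv {t | diagShift x t ∈ Ω}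
      (fun t => Φ (diagShift x t)) (fun t => Ψ (diagShift x t))

/-- The diagonal Sobolev space on `Ω`: the restrictions to `Ω` of the elements of the diagonal
Sobolev space on `ℝᵏ`. -/
def MemDiagSobolev {k : ℕ} (Ω : Set (Fin k → ℝ)) (Φ : (Fin k → ℝ) → F) : Prop :=
  ∃ Φ' Ψ' : (Fin k → ℝ) → F, HasDiagDeriv univ Φ' Ψ' ∧ Φ =ᵐ[volume.restrict Ω] Φ'

/-- The trace of `Φ` on the face `θ_l = 0` of the cube `(-τ, 0)^{k+1}` is `u`, the face being identified
with the cube `(-τ, 0)ᵏ` by omitting the `l`-th coordinate: along the diagonal line through almost every point of the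
face, `Φ` agrees a.e. in the cube with a continuous function, whose value at the point of
the face is given by `u`. -/
def HasFaceTrace (τ : ℝ) {k : ℕ} (l : Fin (k + 1)) (Φ : (Fin (k + 1) → ℝ) → F)
    (u : (Fin k → ℝ) → F) : Prop :=
  ∀ᵐ θ ∂volume.restrict (cube τ k), ∃ f : C(ℝ, F), f 0 = u θ ∧
    ∀ᵐ t : ℝ, diagShift (l.insertNth (α := fun _ => ℝ) 0 θ) t ∈ cube τ (k + 1) →
      Φ (diagShift (l.insertNth (α := fun _ => ℝ) 0 θ) t) = f t

open Classical in
/-- The diagonal derivative of `Φ` on `Ω` (`0` if there is none). -/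
noncomputable def diagDeriv {k : ℕ} (Ω : Set (Fin k → ℝ)) (Φ : (Fin k → ℝ) → F) :
    (Fin k → ℝ) → F :=
  if h : ∃ Ψ, HasDiagDeriv Ω Φ Ψ then h.choose else 0

open Classical in
/-- The trace of `Φ` on the face `θ_l = 0` (`0` if there is none). -/
noncomputable def faceTrace (τ : ℝ) {k : ℕ} (l : Fin (k + 1)) (Φ : (Fin (k + 1) → ℝ) → F) :
    (Fin k → ℝ) → F :=
  if h : ∃ u, HasFaceTrace τ l Φ u then h.choose else 0

/-- The square of the norm in the diagonal Sobolev space on the cube `(-τ, 0)^{k+1}`: the sum of the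
squares of the `L₂`-norms of the function, its diagonal derivative and its traces. -/
noncomputable def diagNormSq (τ : ℝ) {k : ℕ} (Φ : (Fin (k + 1) → ℝ) → F) : ℝ≥0∞ :=
  eLpNorm Φ 2 (volume.restrict (cube τ (k + 1))) ^ 2 +
    eLpNorm (diagDeriv (cube τ (k + 1)) Φ) 2 (volume.restrict (cube τ (k + 1))) ^ 2 +
    ∑ l : Fin (k + 1), eLpNorm (faceTrace τ l Φ) 2 (volume.restrict (cube τ k)) ^ 2

end DiagonalSobolev

/-- The norm `(∑_{1 ≤ k ≤ m} ∑_{j₁ < ⋯ < j_k} ‖R_{j₁…j_k} Φ‖²)^{1/2}` with the diagonal Sobolev norms of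
all restrictions of positive order. It takes values in `[0, ∞]`, so that its finiteness is not
presupposed. -/
noncomputable def domainNorm {m n : ℕ} {τ : ℝ} (Φ : TensorSpace m n τ) : ℝ≥0∞ :=
  (∑ k ∈ Finset.range m, ∑ j : Fin (k + 1) ↪o Fin m,
    diagNormSq τ (faceRestriction j Φ)) ^ (1 / 2 : ℝ)

end DelayCompound

/-! Tensors of vectors from the domain of the square of `A` span a dense subspace that is invariant
under the tensor power semigroup. By `IsC0Semigroup.generatorGraph_subset_closure` this subspace is
a core of the additive compound, so it suffices to prove two-sided estimates and a representation
along diagonals on the core, and to see that both survive limits.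

On the core everything is explicit. The factors are continuously differentiable
(`exists_smoothPair`). On the face with the set `J` of free directions the compound splits into the
diagonal derivative `∑ a ∈ J, ∂ₐΦ` and, for each `i ∉ J`, a term in which `Atilde` acts in the
direction `i` and sees `Φ` on the larger face `insert i J`. Being a functional on continuous
functions, `Atilde` is not controlled by mean squares alone. It is controlled because the slices `θᵢ
= s` of the larger face have square integrals bounded uniformly in `s`: in `slice_le`, the
divergence theorem for `f²` on `s ≤ θᵢ ≤ 0` has contributions from the faces `θₐ = 0`, which are
restrictions of `Φ`, and from the faces `θₐ = -τ`, which have a favourable sign. A duality argument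
in `integral_functional_le` turns the uniform slice bound into a bound of the `Atilde` term. On the
top face there is no such term, and induction on the codimension bounds all diagonal derivatives by
the graph norm. The same identity, read in the other direction, bounds the compound (`core_bounds`).

These bounds make the diagonal derivatives on all faces a bounded function of the pair `(Φ, A^{[⊗
m]}Φ)` on the core, so they extend to the whole graph; hence one works with the closure of the
triples `coreTriples`. Along each diagonal line through a face `θ_l = 0` a smooth restriction is its
value on that face plus the integral of its diagonal derivative. This relation, `DiagRep`, passes to
limits in mean square (`DiagRep.of_tendsto`), and it contains both the trace formula and, through
the extension in `exists_extension_of_diagRep`, membership in the diagonal Sobolev space. By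
uniqueness of derivatives and traces the Sobolev norm is then a sum of quantities already compared
with the graph norm. -/

namespace DelayCompound

/-! ### Strongly continuous semigroups and cores of generators -/

section AbstractSemigroup

variable {E : Type*} [NormedAddCommGroup E] [NormedSpace ℝ E] {G : ℝ≥0 → E →L[ℝ] E}

/-- The graph of the generator as a submodule. -/
def generatorSubmodule (G : ℝ≥0 → E →L[ℝ] E) : Submodule ℝ (E × E) where
  carrier := generatorGraph G
  add_mem' := by
    intro p q hp hq
    refine (hp.add hq).congr fun h => ?_
    simp only [Prod.fst_add, map_add, ← smul_add]
    congr 1; abel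
  zero_mem' := by simp [generatorGraph]
  smul_mem' := by
    intro c p hp
    refine (hp.const_smul c).congr fun h => ?_
    simp only [Prod.smul_fst, map_smul, ← smul_sub]
    rw [smul_comm]

theorem smul_mem_generatorGraph (c : ℝ) {x y : E} (h : (x, y) ∈ generatorGraph G) :
    (c • x, c • y) ∈ generatorGraph G :=
  (generatorSubmodule G).smul_mem c h

theorem sub_mem_generatorGraph {x y x' y' : E} (h : (x, y) ∈ generatorGraph G)
    (h' : (x', y') ∈ generatorGraph G) : (x - x', y - y') ∈ generatorGraph G :=
  (generatorSubmodule G).sub_mem h h'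

namespace IsC0Semigroup

theorem continuous_real_orbit (hG : IsC0Semigroup G) (x : E) :
    Continuous fun s : ℝ => G s.toNNReal x :=
  (hG.continuous_orbit x).comp continuous_real_toNNReal

/-- Orbits are bounded on compact time intervals, so the uniform boundedness principle applies. -/
theorem exists_norm_le [CompleteSpace E] (hG : IsC0Semigroup G) (a : ℝ≥0) :
    ∃ C : ℝ, ∀ t ≤ a, ‖G t‖ ≤ C := by
  obtain ⟨C, hC⟩ := banach_steinhaus (g := fun t : Iic a => G t) fun x => by
    have hc : IsCompact (Icc 0 a) := isCompact_Icc
    obtain ⟨C, hC⟩ := hc.exists_bound_of_continuousOn (hG.continuous_orbit x).continuousOn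
    exact ⟨C, fun t => hC t ⟨zero_le, t.2⟩⟩
  exact ⟨C, fun t ht => hC ⟨t, ht⟩⟩

theorem map_mem_generatorGraph (hG : IsC0Semigroup G) (t : ℝ≥0) {x y : E}
    (h : (x, y) ∈ generatorGraph G) : (G t x, G t y) ∈ generatorGraph G := by
  refine (((G t).continuous.tendsto _).comp h).congr fun s => ?_
  have : G t (G s x) = G s (G t x) := by
    rw [← ContinuousLinearMap.comp_apply, ← ContinuousLinearMap.comp_apply, ← hG.map_add,
      ← hG.map_add, add_comm]
  simp [this]

theorem tendsto_coe_nhdsGT_zero :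
    Tendsto (fun h : ℝ≥0 => (h : ℝ)) (𝓝[>] 0) (𝓝[>] 0) := by
  refine tendsto_nhdsWithin_iff.2 ⟨?_, ?_⟩
  · exact (NNReal.continuous_coe.tendsto 0).mono_left nhdsWithin_le_nhds
  · filter_upwards [self_mem_nhdsWithin] with h hh using hh

theorem tendsto_toNNReal_nhdsGT_zero :
    Tendsto Real.toNNReal (𝓝[>] 0) (𝓝[>] 0) := by
  refine tendsto_nhdsWithin_iff.2 ⟨?_, ?_⟩
  · simpa using (continuous_real_toNNReal.tendsto 0).mono_left nhdsWithin_le_nhds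
  · filter_upwards [self_mem_nhdsWithin] with h hh using by simpa using hh

/-- Difference quotients of primitives of continuous functions. -/
theorem tendsto_slope_integral [CompleteSpace E] {f : ℝ → E} (hf : Continuous f) (a : ℝ) :
    Tendsto (fun h : ℝ => h⁻¹ • ∫ s in a..(a + h), f s) (𝓝[>] 0) (𝓝 (f a)) := by
  have h1 : HasDerivAt (fun u => ∫ s in a..u, f s) (f a) a :=
    intervalIntegral.integral_hasDerivAt_right (hf.intervalIntegrable _ _)
      (hf.stronglyMeasurableAtFilter _ _) hf.continuousAt
  have := h1.tendsto_slope_zero_right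
  simpa using this

/-- Applying `G h` shifts the window of integration; the overlap cancels and the difference quotient
becomes a difference of averages over `[t, t + h]` and `[0, h]`. -/
theorem integral_mem_generatorGraph [CompleteSpace E] (hG : IsC0Semigroup G) (x : E) {t : ℝ}
    (ht : 0 ≤ t) :
    (∫ s in (0 : ℝ)..t, G s.toNNReal x, G t.toNNReal x - x) ∈ generatorGraph G := by
  have hc := hG.continuous_real_orbit x
  have h1 := (tendsto_slope_integral hc t).sub (tendsto_slope_integral hc 0)
  have h0 : G (0 : ℝ).toNNReal x = x := by simp [hG.map_zero]
  rw [h0] at h1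
  refine ((h1.comp tendsto_coe_nhdsGT_zero)).congr fun h => ?_
  simp only [Function.comp_apply, zero_add, ← smul_sub]
  congr 1
  rw [← ContinuousLinearMap.intervalIntegral_comp_comm _ (hc.intervalIntegrable _ _)]
  have h2 : ∫ s in (0 : ℝ)..t, G h (G s.toNNReal x)
      = ∫ s in (0 : ℝ)..t, G (s + h).toNNReal x := by
    refine intervalIntegral.integral_congr fun s hs => ?_
    rw [uIcc_of_le ht] at hs
    rw [Real.toNNReal_add hs.1 h.coe_nonneg, Real.toNNReal_coe, add_comm, hG.map_add]
    rfl
  rw [h2, intervalIntegral.integral_comp_add_right (fun s => G s.toNNReal x)]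
  have e1 := intervalIntegral.integral_add_adjacent_intervals
    (hc.intervalIntegrable 0 t) (hc.intervalIntegrable (μ := volume) t (t + h))
  have e2 := intervalIntegral.integral_add_adjacent_intervals
    (hc.intervalIntegrable 0 (h : ℝ)) (hc.intervalIntegrable (μ := volume) h (t + h))
  rw [zero_add, sub_eq_sub_iff_add_eq_add,
    add_comm (∫ s in t..(t + h), _), e1, add_comm (∫ s in (h : ℝ)..(t + h), _), e2]

theorem sub_eq_integral [CompleteSpace E] (hG : IsC0Semigroup G) {x y : E}
    (h : (x, y) ∈ generatorGraph G) {t : ℝ} (ht : 0 ≤ t) :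
    G t.toNNReal x - x = ∫ s in (0 : ℝ)..t, G s.toNNReal y := by
  -- The generator only gives right derivatives of the orbit, and for a continuous orbit these
  -- suffice.
  have key := intervalIntegral.integral_eq_sub_of_hasDeriv_right_of_le (a := 0) (b := t)
    (f := fun s => G s.toNNReal x) (f' := fun s => G s.toNNReal y) ht
    (hG.continuous_real_orbit x).continuousOn (fun s hs => ?_)
    ((hG.continuous_real_orbit y).intervalIntegrable _ _)
  · simpa [hG.map_zero] using key.symm
  · have h1 := (hG.map_mem_generatorGraph s.toNNReal h).comp tendsto_toNNReal_nhdsGT_zero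
    have h2 : Tendsto (fun u => u - s) (𝓝[>] s) (𝓝[>] 0) := by
      refine tendsto_nhdsWithin_iff.2 ⟨?_, ?_⟩
      · have : Tendsto (fun u => u - s) (𝓝 s) (𝓝 (s - s)) :=
          (continuous_id.sub continuous_const).tendsto s
        simpa using this.mono_left nhdsWithin_le_nhds
      · filter_upwards [self_mem_nhdsWithin] with u hu using by simpa using hu
    rw [hasDerivWithinAt_iff_tendsto_slope' (by simp)]
    refine (h1.comp h2).congr' ?_
    filter_upwards [self_mem_nhdsWithin] with u hu
    have hus : 0 ≤ u - s := by simpa using (le_of_lt hu : s ≤ u)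
    have : u.toNNReal = (u - s).toNNReal + s.toNNReal := by
      rw [← Real.toNNReal_add hus hs.1.le]; simp
    simp only [Function.comp_apply, slope, vsub_eq_sub, Real.coe_toNNReal _ hus]
    rw [this, hG.map_add]
    rfl

theorem tendsto_average [CompleteSpace E] (hG : IsC0Semigroup G) (x : E) :
    Tendsto (fun t : ℝ => t⁻¹ • ∫ s in (0 : ℝ)..t, G s.toNNReal x) (𝓝[>] 0) (𝓝 x) := by
  have := tendsto_slope_integral (hG.continuous_real_orbit x) 0
  simpa [hG.map_zero] using this

/-- The domain of the square of the generator. -/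
def domainSq (G : ℝ≥0 → E →L[ℝ] E) : Set E :=
  {x | ∃ y z, (x, y) ∈ generatorGraph G ∧ (y, z) ∈ generatorGraph G}

/-- Averages of an orbit over short times lie in the domain and approximate the starting point.
Starting in the domain, they even lie in the domain of the square, so two approximations reach every
vector. -/
theorem dense_domainSq [CompleteSpace E] (hG : IsC0Semigroup G) : Dense (domainSq G) := by
  have key : ∀ x y : E, (x, y) ∈ generatorGraph G → x ∈ closure (domainSq G) := by
    intro x y hxy
    refine mem_closure_of_tendsto (hG.tendsto_average x) ?_
    filter_upwards [self_mem_nhdsWithin] with t ht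
    exact ⟨t⁻¹ • (G t.toNNReal x - x), t⁻¹ • (G t.toNNReal y - y),
      smul_mem_generatorGraph t⁻¹ (hG.integral_mem_generatorGraph x (le_of_lt ht)),
      smul_mem_generatorGraph t⁻¹
        (sub_mem_generatorGraph (hG.map_mem_generatorGraph t.toNNReal hxy) hxy)⟩
  intro x
  refine (isClosed_closure).closure_subset
    (mem_closure_of_tendsto (hG.tendsto_average x) ?_ : x ∈ closure (closure (domainSq G)))
  filter_upwards [self_mem_nhdsWithin] with t ht
  exact key _ _ (smul_mem_generatorGraph t⁻¹
    (hG.integral_mem_generatorGraph x (le_of_lt ht)))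

/-- A dense subspace of the domain of the generator that is invariant under the semigroup is a
core. -/
theorem generatorGraph_subset_closure [CompleteSpace E] (hG : IsC0Semigroup G)
    (N : Submodule ℝ (E × E)) (hN : (N : Set (E × E)) ⊆ generatorGraph G)
    (hinv : ∀ (t : ℝ≥0) (q : E × E), q ∈ N → (G t q.1, G t q.2) ∈ N)
    (hdense : Dense (Prod.fst '' (N : Set (E × E)))) :
    generatorGraph G ⊆ closure (N : Set (E × E)) := by
  -- The orbit of an element of `N` stays in `N`, hence its average lies in the closed convex set
  -- `N.topologicalClosure`.
  have hA : ∀ q ∈ N, ∀ t : ℝ, 0 ≤ t →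
      (∫ s in (0 : ℝ)..t, G s.toNNReal q.1, G t.toNNReal q.1 - q.1) ∈ N.topologicalClosure := by
    intro q hq t ht
    rw [hG.sub_eq_integral (hN hq : (q.1, q.2) ∈ _) ht]
    have hc : Continuous fun s : ℝ => (G s.toNNReal q.1, G s.toNNReal q.2) :=
      (hG.continuous_real_orbit q.1).prodMk (hG.continuous_real_orbit q.2)
    have e : (∫ s in (0 : ℝ)..t, G s.toNNReal q.1, ∫ s in (0 : ℝ)..t, G s.toNNReal q.2)
        = ∫ s in (0 : ℝ)..t, (G s.toNNReal q.1, G s.toNNReal q.2) := by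
      have hi := hc.intervalIntegrable (μ := volume) 0 t
      have h1 := (ContinuousLinearMap.fst ℝ E E).intervalIntegral_comp_comm hi
      have h2 := (ContinuousLinearMap.snd ℝ E E).intervalIntegral_comp_comm hi
      exact Prod.ext h1 h2
    rw [e]
    rcases ht.eq_or_lt with rfl | ht'
    · simp
    have hav : (⨍ s in Ioc (0 : ℝ) t, (G s.toNNReal q.1, G s.toNNReal q.2))
        ∈ (N.topologicalClosure : Set (E × E)) := by
      refine Convex.set_average_mem N.topologicalClosure.convex
        N.isClosed_topologicalClosure (by simp [ht']) (measure_Ioc_lt_top.ne) ?_ ?_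
      · exact Eventually.of_forall fun s => N.le_topologicalClosure (hinv _ q hq)
      · exact (hc.integrableOn_Icc (a := 0) (b := t)).mono_set Ioc_subset_Icc_self
    rw [setAverage_eq] at hav
    have := N.topologicalClosure.smul_mem t hav
    rw [smul_smul] at this
    rw [intervalIntegral.integral_of_le ht]
    convert this
    simp [measureReal_def, ht, ht'.ne']
  -- Both components are continuous in `x`, so density of the first projection of `N` extends the
  -- inclusion to every starting vector, whether or not it is in the domain.
  have hB : ∀ x : E, ∀ t : ℝ, 0 ≤ t →
      (∫ s in (0 : ℝ)..t, G s.toNNReal x, G t.toNNReal x - x) ∈ N.topologicalClosure := by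
    intro x t ht
    obtain ⟨C, hC⟩ := hG.exists_norm_le t.toNNReal
    have hcont : Continuous fun x : E =>
        (∫ s in (0 : ℝ)..t, G s.toNNReal x, G t.toNNReal x - x) := by
      refine Continuous.prodMk ?_ (by fun_prop)
      let L : E →ₗ[ℝ] E :=
        { toFun := fun x => ∫ s in (0 : ℝ)..t, G s.toNNReal x
          map_add' := fun x y => by
            simp_rw [_root_.map_add]
            exact intervalIntegral.integral_add
              ((hG.continuous_real_orbit x).intervalIntegrable _ _)
              ((hG.continuous_real_orbit y).intervalIntegrable _ _)
          map_smul' := fun c x => by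
            simp_rw [map_smul]
            exact intervalIntegral.integral_smul c _ }
      refine (L.mkContinuous (C * |t - 0|) fun x => ?_).continuous
      have := intervalIntegral.norm_integral_le_of_norm_le_const (a := (0 : ℝ)) (b := t)
        (f := fun s => G s.toNNReal x) (C := C * ‖x‖) fun s hs => by
          rw [uIoc_of_le ht] at hs
          exact (G s.toNNReal).le_of_opNorm_le (hC _ (Real.toNNReal_le_toNNReal hs.2)) x
      calc _ ≤ _ := this
        _ = _ := by ring
    have : x ∈ closure (Prod.fst '' (N : Set (E × E))) := hdense x
    have h2 := map_mem_closure hcont this (t := (N.topologicalClosure : Set (E × E))) (by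
      rintro _ ⟨q, hq, rfl⟩
      exact hA q hq t ht)
    rwa [N.isClosed_topologicalClosure.closure_eq] at h2
  rintro ⟨x, y⟩ hxy
  rw [← Submodule.topologicalClosure_coe]
  -- For a pair in the graph, the averages converge together with their images under the generator.
  have hlim : Tendsto (fun t : ℝ => t⁻¹ • (∫ s in (0 : ℝ)..t, G s.toNNReal x, G t.toNNReal x - x))
      (𝓝[>] 0) (𝓝 (x, y)) := by
    refine Tendsto.prodMk_nhds (hG.tendsto_average x) ?_
    refine (Tendsto.comp hxy tendsto_toNNReal_nhdsGT_zero).congr' ?_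
    filter_upwards [self_mem_nhdsWithin] with t ht
    simp [Real.coe_toNNReal t (le_of_lt ht)]
  refine N.isClosed_topologicalClosure.mem_of_tendsto hlim ?_
  filter_upwards [self_mem_nhdsWithin] with t ht
  exact N.topologicalClosure.smul_mem _ (hB x t (le_of_lt ht))

end IsC0Semigroup

end AbstractSemigroup

/-! ### Decomposable tensors and tensor powers of operators and semigroups -/

section TensorProducts

variable {m n : ℕ} {τ : ℝ}

theorem prod_update_apply {M : Fin m → Type*} {R : Type*} [CommMonoid R] (F : ∀ a, M a → R)
    (v : ∀ a, M a) (a : Fin m) (x : M a) :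
    ∏ b, F b (Function.update v a x b) = F a x * ∏ b ∈ Finset.univ.erase a, F b (v b) := by
  rw [← Finset.mul_prod_erase _ _ (Finset.mem_univ a), Function.update_self]
  congr 1
  refine Finset.prod_congr rfl fun b hb => ?_
  rw [Function.update_of_ne (Finset.ne_of_mem_erase hb)]

theorem tensorVec_apply (v : Fin m → Vec n) (i : Fin m → Fin n) :
    tensorVec v i = ∏ a, v a (i a) := rfl

theorem inner_tensorVec (v w : Fin m → Vec n) :
    inner ℝ (tensorVec v) (tensorVec w) = ∏ a, inner ℝ (v a) (w a) := by
  simp only [PiLp.inner_apply, tensorVec_apply]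
  rw [Finset.prod_univ_sum]
  simp [Fintype.piFinset_univ, Finset.prod_mul_distrib]

theorem tensorVec_update_add (v : Fin m → Vec n) (a : Fin m) (x y : Vec n) :
    tensorVec (Function.update v a (x + y))
      = tensorVec (Function.update v a x) + tensorVec (Function.update v a y) := by
  ext i
  simp only [PiLp.add_apply, tensorVec_apply]
  rw [prod_update_apply (fun b (u : Vec n) => u (i b)), prod_update_apply (fun b (u : Vec n) => u (i b)),
    prod_update_apply (fun b (u : Vec n) => u (i b)), PiLp.add_apply, add_mul]

theorem tensorVec_update_smul (v : Fin m → Vec n) (a : Fin m) (c : ℝ) (x : Vec n) :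
    tensorVec (Function.update v a (c • x)) = c • tensorVec (Function.update v a x) := by
  ext i
  simp only [PiLp.smul_apply, tensorVec_apply]
  rw [prod_update_apply (fun b (u : Vec n) => u (i b)), prod_update_apply (fun b (u : Vec n) => u (i b)),
    PiLp.smul_apply, smul_eq_mul, smul_eq_mul, mul_assoc]

theorem tensor_coeFn (φ : Fin m → HSpace n τ) :
    tensor φ =ᵐ[Measure.pi fun _ : Fin m => delayMeasure τ]
      fun θ => tensorVec fun a => φ a (θ a) :=
  (memLp_tensor φ).coeFn_toLp

/-- The tensor product of functions may be computed with arbitrary representatives. -/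
theorem tensor_ae_eq {φ : Fin m → HSpace n τ} {f : Fin m → ℝ → Vec n}
    (h : ∀ a, φ a =ᵐ[delayMeasure τ] f a) :
    tensor φ =ᵐ[Measure.pi fun _ : Fin m => delayMeasure τ]
      fun θ => tensorVec fun a => f a (θ a) := by
  have h' : ∀ᵐ θ ∂(Measure.pi fun _ : Fin m => delayMeasure τ), ∀ a, φ a (θ a) = f a (θ a) :=
    ae_all_iff.2 fun a => (Measure.quasiMeasurePreserving_eval _ a).ae_eq_comp (h a)
  filter_upwards [tensor_coeFn φ, h'] with θ h1 h2
  simp only [h1, h2]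

theorem inner_tensor (φ ψ : Fin m → HSpace n τ) :
    inner ℝ (tensor φ) (tensor ψ) = ∏ a, inner ℝ (φ a) (ψ a) := by
  rw [L2.inner_def]
  have : (fun θ => inner ℝ (tensor φ θ) (tensor ψ θ))
      =ᵐ[Measure.pi fun _ : Fin m => delayMeasure τ]
      fun θ => ∏ a, inner ℝ (φ a (θ a)) (ψ a (θ a)) := by
    filter_upwards [tensor_coeFn φ, tensor_coeFn ψ] with θ h1 h2
    rw [h1, h2, inner_tensorVec]
  rw [integral_congr_ae this, integral_fintype_prod_eq_prod (𝕜 := ℝ)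
    (fun a s => inner ℝ (φ a s) (ψ a s))]
  simp only [L2.inner_def]

theorem norm_tensor (φ : Fin m → HSpace n τ) : ‖tensor φ‖ = ∏ a, ‖φ a‖ := by
  have h : ‖tensor φ‖ ^ 2 = (∏ a, ‖φ a‖) ^ 2 := by
    rw [← real_inner_self_eq_norm_sq, inner_tensor, ← Finset.prod_pow]
    simp only [real_inner_self_eq_norm_sq]
  exact (pow_left_inj₀ (norm_nonneg _) (Finset.prod_nonneg fun _ _ => norm_nonneg _)
    two_ne_zero).1 h

theorem update_coeFn {φ : Fin m → HSpace n τ} {a : Fin m} {x : HSpace n τ} {f : ℝ → Vec n}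
    (h : x =ᵐ[delayMeasure τ] f) (b : Fin m) :
    (Function.update φ a x b : ℝ → Vec n) =ᵐ[delayMeasure τ]
      Function.update (fun b => (φ b : ℝ → Vec n)) a f b := by
  by_cases hb : b = a
  · subst hb; simpa using h
  · simp [Function.update_of_ne hb]

theorem update_eval (f : Fin m → ℝ → Vec n) (a : Fin m) (g : ℝ → Vec n) (θ : Fin m → ℝ) :
    (fun b => Function.update f a g b (θ b)) = Function.update (fun b => f b (θ b)) a (g (θ a)) := by
  funext b
  by_cases hb : b = a
  · subst hb; simp
  · simp [Function.update_of_ne hb]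

/-- The tensor product as a continuous multilinear map. -/
noncomputable def tensorMultilinear (m n : ℕ) (τ : ℝ) :
    ContinuousMultilinearMap ℝ (fun _ : Fin m => HSpace n τ) (TensorSpace m n τ) :=
  MultilinearMap.mkContinuous
    { toFun := tensor
      map_update_add' := by
        intro inst φ a x y
        obtain rfl : inst = instDecidableEqFin m := Subsingleton.elim _ _
        refine Lp.ext ?_
        filter_upwards [tensor_ae_eq (update_coeFn (φ := φ) (a := a) (Lp.coeFn_add x y)),
          tensor_ae_eq (update_coeFn (φ := φ) (a := a) (x := x) (ae_eq_refl _)),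
          tensor_ae_eq (update_coeFn (φ := φ) (a := a) (x := y) (ae_eq_refl _)),
          Lp.coeFn_add (tensor (Function.update φ a x)) (tensor (Function.update φ a y))]
          with θ h1 h2 h3 h4
        rw [h4, h1, Pi.add_apply, h2, h3]
        simp only [update_eval, Pi.add_apply, tensorVec_update_add]
      map_update_smul' := by
        intro inst φ a c x
        obtain rfl : inst = instDecidableEqFin m := Subsingleton.elim _ _
        refine Lp.ext ?_
        filter_upwards [tensor_ae_eq (update_coeFn (φ := φ) (a := a) (Lp.coeFn_smul c x)),
          tensor_ae_eq (update_coeFn (φ := φ) (a := a) (x := x) (ae_eq_refl _)),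
          Lp.coeFn_smul c (tensor (Function.update φ a x))]
          with θ h1 h2 h4
        rw [h4, h1, Pi.smul_apply, h2]
        simp only [update_eval, Pi.smul_apply, tensorVec_update_smul] }
    1 fun φ => by rw [one_mul]; exact (norm_tensor φ).le

@[simp] theorem tensorMultilinear_apply (φ : Fin m → HSpace n τ) :
    tensorMultilinear m n τ φ = tensor φ := rfl

/-! ### Decomposable tensors span a dense subspace -/

/-- Boxes form a π-system that generates the product σ-algebra, and the sets over which the integral
vanishes are stable under complements and disjoint unions. -/
theorem ae_eq_zero_of_integral_box_eq_zero {f : (Fin m → ℝ) → ℝ} {μ : Measure (Fin m → ℝ)}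
    (hf : Integrable f μ)
    (h : ∀ s : Fin m → Set ℝ, (∀ a, MeasurableSet (s a)) → ∫ θ in Set.pi univ s, f θ ∂μ = 0) :
    f =ᵐ[μ] 0 := by
  refine hf.ae_eq_zero_of_forall_setIntegral_eq_zero fun S hS hfin => ?_
  clear hfin
  induction S, hS using MeasurableSpace.induction_on_inter
    (generateFrom_pi (α := fun _ : Fin m => ℝ)).symm isPiSystem_pi with
  | empty => simp
  | basic t ht =>
    obtain ⟨s, hs, rfl⟩ := ht
    exact h s fun a => hs a (mem_univ a)
  | compl t ht ih =>
    -- The whole space is a box, so the total integral vanishes too.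
    have h1 := integral_add_compl ht hf
    have h2 := h (fun _ => univ) fun _ => MeasurableSet.univ
    rw [Set.pi_univ univ, setIntegral_univ] at h2
    linarith
  | iUnion g hd hm ih =>
    have := hasSum_integral_iUnion hm hd (hf.integrableOn (s := ⋃ i, g i))
    simp only [ih] at this
    exact this.unique hasSum_zero

/-- The tensor of indicators of intervals' measurable analogues, each multiplied by a basis vector,
tests a single coordinate of `Φ` on a single measurable box. -/
theorem span_tensor_orthogonal :
    (Submodule.span ℝ (range (tensor : (Fin m → HSpace n τ) → TensorSpace m n τ)))ᗮ = ⊥ := by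
  rw [eq_bot_iff]
  intro Φ hΦ
  rw [Submodule.mem_bot]
  have hint : ∀ i, Integrable (fun θ => Φ θ i) (Measure.pi fun _ : Fin m => delayMeasure τ) :=
    fun i => ((Lp.memLp Φ).eval_piLp i).integrable (by norm_num)
  have hi : ∀ i, (fun θ => Φ θ i) =ᵐ[Measure.pi fun _ : Fin m => delayMeasure τ] 0 := by
    intro i
    refine ae_eq_zero_of_integral_box_eq_zero (hint i) fun s hs => ?_
    let φ : Fin m → HSpace n τ := fun a =>
      indicatorConstLp 2 (hs a) (measure_ne_top _ _) (EuclideanSpace.single (i a) (1 : ℝ))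
    have h0 := (Submodule.mem_orthogonal _ _).1 hΦ (tensor φ) (Submodule.subset_span ⟨φ, rfl⟩)
    rw [L2.inner_def] at h0
    rw [← integral_indicator (MeasurableSet.univ_pi hs), ← h0]
    refine integral_congr_ae ?_
    filter_upwards [tensor_ae_eq (φ := φ) (fun a => indicatorConstLp_coeFn)] with θ hθ
    rw [hθ, PiLp.inner_apply, Finset.sum_eq_single i]
    · simp only [tensorVec_apply]
      by_cases hθs : θ ∈ Set.pi univ s
      · have : ∀ a, θ a ∈ s a := fun a => hθs a (mem_univ a)
        simp [hθs, this]
      · have : ∃ a, θ a ∉ s a := by simpa [Set.mem_pi] using hθs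
        obtain ⟨a, ha⟩ := this
        rw [indicator_of_notMem hθs, Finset.prod_eq_zero (Finset.mem_univ a)] <;> simp [ha]
    · intro b _ hb
      obtain ⟨a, ha⟩ := Function.ne_iff.1 hb
      rw [tensorVec_apply, Finset.prod_eq_zero (Finset.mem_univ a)]
      · simp
      · by_cases h : θ a ∈ s a <;> simp [h, ha]
    · simp
  refine (Lp.eq_zero_iff_ae_eq_zero).2 ?_
  filter_upwards [ae_all_iff.2 hi] with θ hθ
  ext i
  exact hθ i

theorem dense_span_tensor :
    Dense (Submodule.span ℝ (range (tensor : (Fin m → HSpace n τ) → TensorSpace m n τ)) :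
      Set (TensorSpace m n τ)) :=
  (Submodule.dense_iff_topologicalClosure_eq_top).2
    (Submodule.topologicalClosure_eq_top_iff.2 span_tensor_orthogonal)

theorem dense_span_tensor_of_dense {D : Set (HSpace n τ)} (hD : Dense D) :
    Dense (Submodule.span ℝ (tensor '' (Set.pi univ fun _ : Fin m => D)) :
      Set (TensorSpace m n τ)) := by
  rw [Submodule.dense_iff_topologicalClosure_eq_top, eq_top_iff,
    ← (Submodule.dense_iff_topologicalClosure_eq_top.1
      (dense_span_tensor (m := m) (n := n) (τ := τ)))]
  refine Submodule.topologicalClosure_minimal _ (Submodule.span_le.2 ?_)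
    (Submodule.isClosed_topologicalClosure _)
  rintro _ ⟨φ, rfl⟩
  have hφ : φ ∈ closure (Set.pi univ fun _ : Fin m => D) := by
    rw [closure_pi_set]
    exact fun a _ => hD (φ a)
  have := map_mem_closure (tensorMultilinear m n τ).cont hφ
    (t := tensor '' (Set.pi univ fun _ : Fin m => D)) fun ψ hψ => ⟨ψ, hψ, rfl⟩
  exact closure_mono Submodule.subset_span this

/-! ### Multiplicative compounds -/

/-- The Schur product theorem. With the other slots kept, the Gram matrix of the tensors is the
Hadamard product of the Gram matrix in slot `a` with a positive semidefinite one. Since `‖T‖²` times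
the Gram matrix of the `φ r a` dominates that of their images, this persists after the product. -/
theorem norm_sum_tensor_update_le {ι : Type*} [Fintype ι] (c : ι → ℝ)
    (φ : ι → Fin m → HSpace n τ) (a : Fin m) (T : HSpace n τ →L[ℝ] HSpace n τ) :
    ‖∑ r, c r • tensor (Function.update (φ r) a (T (φ r a)))‖ ≤ ‖T‖ * ‖∑ r, c r • tensor (φ r)‖ := by
  rcases subsingleton_or_nontrivial (HSpace n τ) with hs | hs
  · have h0 : ∀ ψ : Fin m → HSpace n τ, tensor ψ = 0 := fun ψ => by
      rw [← norm_eq_zero, norm_tensor]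
      exact Finset.prod_eq_zero (Finset.mem_univ a) (by simp [Subsingleton.elim (ψ a) 0])
    simp [h0]
  -- A unit vector in slot `a` makes the product over the remaining slots a Gram matrix of tensors;
  -- its existence is why the trivial space was treated separately.
  obtain ⟨e, he⟩ := exists_norm_eq (HSpace n τ) (zero_le_one)
  have hee : inner ℝ e e = (1 : ℝ) := by rw [real_inner_self_eq_norm_sq, he]; norm_num
  have hupd : ∀ r s x y, inner ℝ (tensor (Function.update (φ r) a x))
      (tensor (Function.update (φ s) a y))
      = inner ℝ x y * ∏ b ∈ Finset.univ.erase a, inner ℝ (φ r b) (φ s b) := by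
    intro r s x y
    rw [inner_tensor, ← Finset.mul_prod_erase _ _ (Finset.mem_univ a)]
    simp only [Function.update_self]
    congr 1
    refine Finset.prod_congr rfl fun b hb => ?_
    rw [Function.update_of_ne (Finset.ne_of_mem_erase hb),
      Function.update_of_ne (Finset.ne_of_mem_erase hb)]
  have hK := (Matrix.posSemidef_opNorm_smul_gram_sub_gram (𝕜 := ℝ) (fun r => φ r a) T).hadamard
    (Matrix.posSemidef_gram ℝ fun r => tensor (Function.update (φ r) a e))
  have h1 := hK.dotProduct_mulVec_nonneg c
  have hexp : ∀ v : ι → TensorSpace m n τ, ‖∑ r, c r • v r‖ ^ 2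
      = ∑ r, ∑ s, c r * (c s * inner ℝ (v r) (v s)) := by
    intro v
    rw [← real_inner_self_eq_norm_sq, sum_inner]
    simp only [inner_sum, real_inner_smul_left, real_inner_smul_right]
    exact Finset.sum_congr rfl fun r _ => Finset.sum_congr rfl fun s _ => by ring
  have h2 : (‖∑ r, c r • tensor (Function.update (φ r) a (T (φ r a)))‖) ^ 2
      ≤ (‖T‖ * ‖∑ r, c r • tensor (φ r)‖) ^ 2 := by
    rw [mul_pow, hexp, hexp, ← sub_nonneg, Finset.mul_sum, ← Finset.sum_sub_distrib]
    refine h1.trans_eq ?_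
    simp only [dotProduct, Matrix.mulVec, Finset.mul_sum, ← Finset.sum_sub_distrib]
    refine Finset.sum_congr rfl fun r _ => Finset.sum_congr rfl fun s _ => ?_
    have e1 : inner ℝ (tensor (φ r)) (tensor (φ s))
        = inner ℝ (φ r a) (φ s a) * ∏ b ∈ Finset.univ.erase a, inner ℝ (φ r b) (φ s b) := by
      simpa using hupd r s (φ r a) (φ s a)
    rw [hupd, e1]
    simp only [Matrix.hadamard_apply, Matrix.sub_apply, Matrix.smul_apply, Matrix.gram_apply,
      hupd, hee, Function.comp_apply, smul_eq_mul, Pi.star_apply, star_trivial]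
    ring
  exact abs_le_of_sq_le_sq' h2 (by positivity) |>.2

/-- The slots are replaced one at a time, each at the cost of a factor `‖T‖`. -/
theorem norm_sum_tensor_map_le {ι : Type*} [Fintype ι] (c : ι → ℝ)
    (φ : ι → Fin m → HSpace n τ) (T : HSpace n τ →L[ℝ] HSpace n τ) :
    ‖∑ r, c r • tensor (fun a => T (φ r a))‖ ≤ ‖T‖ ^ m * ‖∑ r, c r • tensor (φ r)‖ := by
  have key : ∀ s : Finset (Fin m), ‖∑ r, c r • tensor (fun a => if a ∈ s then T (φ r a) else φ r a)‖
      ≤ ‖T‖ ^ s.card * ‖∑ r, c r • tensor (φ r)‖ := by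
    intro s
    induction s using Finset.induction_on with
    | empty => simp
    | insert a s ha ih =>
      have h1 := norm_sum_tensor_update_le c (fun r b => if b ∈ s then T (φ r b) else φ r b) a T
      have e : ∀ r, Function.update (fun b => if b ∈ s then T (φ r b) else φ r b) a
          (T (if a ∈ s then T (φ r a) else φ r a))
          = fun b => if b ∈ insert a s then T (φ r b) else φ r b := by
        intro r
        funext b
        by_cases hb : b = a
        · subst hb; simp [ha]
        · simp [Finset.mem_insert, hb]
      simp only [e] at h1
      rw [Finset.card_insert_of_notMem ha, pow_succ', mul_assoc]
      exact h1.trans (by gcongr)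
  simpa using key Finset.univ

/-- The operator is prescribed on formal linear combinations of tuples. The norm estimate shows that
it depends only on the vector they represent, and extends it to the closure of the span. -/
theorem exists_tensorPower (T : HSpace n τ →L[ℝ] HSpace n τ) :
    ∃ S : TensorSpace m n τ →L[ℝ] TensorSpace m n τ,
      (∀ φ : Fin m → HSpace n τ, S (tensor φ) = tensor fun a => T (φ a)) ∧ ‖S‖ ≤ ‖T‖ ^ m := by
  classical
  let e := Finsupp.linearCombination ℝ (tensor : (Fin m → HSpace n τ) → TensorSpace m n τ)
  let f := Finsupp.linearCombination ℝ
    (fun φ : Fin m → HSpace n τ => tensor fun a => T (φ a))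
  have hd : DenseRange e := by
    have := dense_span_tensor (m := m) (n := n) (τ := τ)
    rwa [← Finsupp.range_linearCombination, LinearMap.coe_range] at this
  have hb : ∀ x, ‖f x‖ ≤ ‖T‖ ^ m * ‖e x‖ := by
    intro x
    have := norm_sum_tensor_map_le (ι := x.support) (fun r => x r) (fun r => r.1) T
    simp only [e, f, Finsupp.linearCombination_apply, Finsupp.sum]
    rw [← Finset.sum_coe_sort x.support, ← Finset.sum_coe_sort x.support]
    exact this
  refine ⟨f.extendOfNorm e, fun φ => ?_, LinearMap.opNorm_extendOfNorm_le hd (by positivity) hb⟩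
  have := LinearMap.extendOfNorm_eq hd ⟨_, hb⟩ (Finsupp.single φ 1)
  simpa [e, f] using this

theorem continuousLinearMap_ext_tensor {F : Type*} [NormedAddCommGroup F] [NormedSpace ℝ F]
    {S S' : TensorSpace m n τ →L[ℝ] F}
    (h : ∀ φ : Fin m → HSpace n τ, S (tensor φ) = S' (tensor φ)) : S = S' :=
  ContinuousLinearMap.ext_on dense_span_tensor (by rintro _ ⟨φ, rfl⟩; exact h φ)

theorem tensorPower_tensor (T : HSpace n τ →L[ℝ] HSpace n τ) (φ : Fin m → HSpace n τ) :
    tensorPower m T (tensor φ) = tensor fun a => T (φ a) := by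
  have h : ∃ S : TensorSpace m n τ →L[ℝ] TensorSpace m n τ,
      ∀ φ : Fin m → HSpace n τ, S (tensor φ) = tensor fun a => T (φ a) :=
    (exists_tensorPower T).imp fun _ h => h.1
  rw [tensorPower, dif_pos h]
  exact h.choose_spec φ

theorem norm_tensorPower_le (T : HSpace n τ →L[ℝ] HSpace n τ) : ‖tensorPower m T‖ ≤ ‖T‖ ^ m := by
  obtain ⟨S, hS, hn⟩ := exists_tensorPower (m := m) T
  rwa [continuousLinearMap_ext_tensor (S := tensorPower m T) (S' := S) fun φ => by
    rw [tensorPower_tensor, hS]]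

theorem IsC0Semigroup.tensorPower {G : ℝ≥0 → HSpace n τ →L[ℝ] HSpace n τ}
    (hG : IsC0Semigroup G) : IsC0Semigroup fun t => tensorPower m (G t) where
  map_zero := continuousLinearMap_ext_tensor fun φ => by
    simp [tensorPower_tensor, hG.map_zero]
  map_add s t := continuousLinearMap_ext_tensor fun φ => by
    simp [tensorPower_tensor, hG.map_add]
  continuous_orbit x := by
    have hspan : ∀ y ∈ Submodule.span ℝ (range (tensor : (Fin m → HSpace n τ) → _)),
        Continuous fun t => DelayCompound.tensorPower m (G t) y := by
      intro y hy
      induction hy using Submodule.span_induction with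
      | mem y hy =>
        obtain ⟨φ, rfl⟩ := hy
        simp only [tensorPower_tensor]
        exact (tensorMultilinear m n τ).cont.comp
          (continuous_pi fun a => hG.continuous_orbit (φ a))
      | zero => simpa using continuous_const
      | add y z _ _ hy hz => simp only [_root_.map_add]; exact hy.add hz
      | smul c y _ hy => simp only [map_smul]; exact hy.const_smul c
    refine continuous_iff_continuousAt.2 fun t₀ => ?_
    obtain ⟨C, hC⟩ := hG.exists_norm_le (t₀ + 1)
    have hC0 : 0 ≤ C := (norm_nonneg _).trans (hC t₀ (by simp))
    -- On the span the orbits are continuous. As the operators are bounded by `C ^ m` up to time `t₀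
    -- + 1`, an orbit of `x` is a uniform limit of such orbits.
    have hcont : ContinuousOn (fun t => DelayCompound.tensorPower m (G t) x) (Iic (t₀ + 1)) := by
      refine continuousOn_of_uniform_approx_of_continuousOn fun u hu => ?_
      obtain ⟨ε, hε, hεu⟩ := Metric.mem_uniformity_dist.1 hu
      obtain ⟨y, hy, hxy⟩ := Metric.dense_iff.1 (dense_span_tensor (m := m) (n := n) (τ := τ)) x
        -- The summand `1` keeps the denominator positive when `C = 0`.
        (ε / (C ^ m + 1)) (by positivity)
      refine ⟨_, (hspan y hxy).continuousOn, fun t ht => hεu ?_⟩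
      rw [dist_eq_norm, ← map_sub]
      have h1 : ‖DelayCompound.tensorPower m (G t)‖ ≤ C ^ m :=
        (norm_tensorPower_le _).trans (pow_le_pow_left₀ (norm_nonneg _) (hC t ht) m)
      have h2 : ‖x - y‖ < ε / (C ^ m + 1) := by
        rw [← dist_eq_norm, dist_comm]; exact hy
      have hp : 0 < C ^ m + 1 := by positivity
      calc _ ≤ C ^ m * ‖x - y‖ := ContinuousLinearMap.le_of_opNorm_le _ h1 _
        _ ≤ (C ^ m + 1) * ‖x - y‖ := by gcongr; linarith
        _ < ε := by rw [lt_div_iff₀ hp] at h2; linarith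
    exact hcont.continuousAt (Iic_mem_nhds (by simp))

/-- The additive compound on a decomposable tensor. -/
theorem tensor_mem_generatorGraph {G : ℝ≥0 → HSpace n τ →L[ℝ] HSpace n τ}
    (hG : IsC0Semigroup G) {φ ξ : Fin m → HSpace n τ}
    (h : ∀ a, (φ a, ξ a) ∈ generatorGraph G) :
    (tensor φ, ∑ a, tensor (Function.update φ a (ξ a)))
      ∈ generatorGraph fun t => tensorPower m (G t) := by
  have hd : ∀ a, HasDerivWithinAt (fun s : ℝ => G s.toNNReal (φ a)) (ξ a) (Ioi 0) 0 := by
    intro a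
    rw [hasDerivWithinAt_iff_tendsto_slope' (by simp)]
    refine (Tendsto.comp (h a) IsC0Semigroup.tendsto_toNNReal_nhdsGT_zero).congr' ?_
    filter_upwards [self_mem_nhdsWithin] with t ht
    simp [slope, hG.map_zero, Real.coe_toNNReal t (le_of_lt ht)]
  have hpi : HasDerivWithinAt (fun (s : ℝ) a => G s.toNNReal (φ a)) ξ (Ioi 0) 0 :=
    hasDerivWithinAt_pi.2 hd
  have h0 : (fun a => G (0 : ℝ).toNNReal (φ a)) = φ := by
    funext a; simp [hG.map_zero]
  -- The formula is the product rule: the derivative of a continuous multilinear map changes one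
  -- slot at a time.
  have hf : HasFDerivAt (tensorMultilinear m n τ) ((tensorMultilinear m n τ).linearDeriv φ)
      (fun a => G (0 : ℝ).toNNReal (φ a)) := by
    rw [h0]; exact (tensorMultilinear m n τ).hasFDerivAt φ
  have hc := hf.comp_hasDerivWithinAt (0 : ℝ) hpi
  rw [hasDerivWithinAt_iff_tendsto_slope' (by simp)] at hc
  have hlim := hc.comp IsC0Semigroup.tendsto_coe_nhdsGT_zero
  rw [ContinuousMultilinearMap.linearDeriv_apply] at hlim
  refine hlim.congr' ?_
  filter_upwards with t
  simp [slope, hG.map_zero, tensorPower_tensor]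

end TensorProducts

/-! ### Weak derivatives on the line -/

theorem memLp_two_integrableOn {F : Type*} [NormedAddCommGroup F] {s : Set ℝ} (hs : volume s ≠ ⊤) {g : ℝ → F}
    (hg : MemLp g 2 (volume.restrict s)) : IntegrableOn g s := by
  have : IsFiniteMeasure (volume.restrict s) := ⟨by simpa using hs.lt_top⟩
  exact hg.integrable (by norm_num)

section WeakDerivatives

variable {F : Type*} [NormedAddCommGroup F] [NormedSpace ℝ F] [CompleteSpace F]

theorem integral_deriv_eq_zero {ζ : ℝ → ℝ} (hζ : ContDiff ℝ ∞ ζ) (hc : HasCompactSupport ζ) :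
    ∫ t, deriv ζ t = 0 :=
  integral_eq_zero_of_hasDerivAt_of_integrable
    (fun t => (hζ.differentiable (by simp) t).hasDerivAt)
    ((hζ.continuous_deriv (by simp)).integrable_of_hasCompactSupport hc.deriv)
    (hζ.continuous.integrable_of_hasCompactSupport hc)

theorem integral_Ioi_deriv_eq {ζ : ℝ → ℝ} (hζ : ContDiff ℝ ∞ ζ) (hc : HasCompactSupport ζ) (s : ℝ) :
    ∫ t in Ioi s, deriv ζ t = -ζ s := by
  have h := integral_Ioi_of_hasDerivAt_of_tendsto' (a := s) (m := 0) (f := ζ) (f' := deriv ζ)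
    (fun t _ => (hζ.differentiable (by simp) t).hasDerivAt)
    ((hζ.continuous_deriv (by simp)).integrable_of_hasCompactSupport hc.deriv).integrableOn ?_
  · simpa using h
  · exact (hc.is_zero_at_infty).mono_left atTop_le_cocompact

/-- A primitive of an integrable function has this function as its weak derivative. -/
theorem integral_deriv_smul_primitive {g : ℝ → F} (hg : Integrable g) (c : F) {ζ : ℝ → ℝ}
    (hζ : ContDiff ℝ ∞ ζ) (hc : HasCompactSupport ζ) :
    ∫ t, deriv ζ t • (c + ∫ s in (0 : ℝ)..t, g s) = -∫ t, ζ t • g t := by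
  have hζ' : Integrable (deriv ζ) :=
    (hζ.continuous_deriv (by simp)).integrable_of_hasCompactSupport hc.deriv
  -- The base point is moved to `-∞`; the constant that arises is annihilated because `deriv ζ` has
  -- integral zero.
  have e : ∀ t, c + ∫ s in (0 : ℝ)..t, g s = (c - ∫ s in Iic 0, g s) + ∫ s in Iic t, g s := by
    intro t
    rw [← intervalIntegral.integral_Iic_sub_Iic hg.integrableOn hg.integrableOn]
    abel
  have hprod : Integrable (fun p : ℝ × ℝ => deriv ζ p.1 • g p.2) (volume.prod volume) :=
    hζ'.smul_prod hg
  have hset : MeasurableSet {p : ℝ × ℝ | p.2 ≤ p.1} := measurableSet_le measurable_snd measurable_fst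
  -- Fubini on the half-plane `s ≤ t` moves the derivative from the primitive to the test function.
  have hind : Integrable ({p : ℝ × ℝ | p.2 ≤ p.1}.indicator fun p => deriv ζ p.1 • g p.2)
      (volume.prod volume) := hprod.indicator hset
  have h1 : ∀ t, deriv ζ t • ∫ s in Iic t, g s
      = ∫ s, {p : ℝ × ℝ | p.2 ≤ p.1}.indicator (fun p => deriv ζ p.1 • g p.2) (t, s) := by
    intro t
    rw [← integral_smul, ← integral_indicator measurableSet_Iic]
    rfl
  have h2 : ∀ s, ∫ t, {p : ℝ × ℝ | p.2 ≤ p.1}.indicator (fun p => deriv ζ p.1 • g p.2) (t, s)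
      = -(ζ s • g s) := by
    intro s
    rw [← neg_smul, ← integral_Ioi_deriv_eq hζ hc s, ← integral_smul_const,
      ← integral_Ici_eq_integral_Ioi, ← integral_indicator measurableSet_Ici]
    rfl
  have hi1 : Integrable fun t => deriv ζ t • ∫ s in Iic t, g s := by
    simp only [h1]
    exact hind.integral_prod_left
  simp only [e, smul_add]
  rw [integral_add (hζ'.smul_const _) hi1, integral_smul_const, integral_deriv_eq_zero hζ hc,
    zero_smul, zero_add]
  simp only [h1]
  rw [integral_integral_swap (f := fun t s =>
    {p : ℝ × ℝ | p.2 ≤ p.1}.indicator (fun p => deriv ζ p.1 • g p.2) (t, s)) hind]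
  simp only [h2, integral_neg]

/-- The primitive from `-∞` vanishes to the left of the support in any case, and to the right
because the total integral is zero. -/
theorem exists_contDiff_primitive {a b : ℝ} {η : ℝ → ℝ} (hη : ContDiff ℝ ∞ η)
    (hc : HasCompactSupport η) (hs : tsupport η ⊆ Ioo a b) (h0 : ∫ t, η t = 0) :
    ∃ ζ : ℝ → ℝ, ContDiff ℝ ∞ ζ ∧ HasCompactSupport ζ ∧ tsupport ζ ⊆ Ioo a b ∧ deriv ζ = η := by
  -- A nonempty compact support attains its extrema, which leaves room to both ends of the open
  -- interval.
  obtain ⟨p, q, hpq, hap, hqb⟩ : ∃ p q, tsupport η ⊆ Icc p q ∧ a < p ∧ q < b ∨ tsupport η = ∅ := by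
    rcases (tsupport η).eq_empty_or_nonempty with h | h
    · exact ⟨0, 0, Or.inr h⟩
    · refine ⟨sInf (tsupport η), sSup (tsupport η), Or.inl ⟨?_, ?_, ?_⟩⟩
      · exact fun x hx => ⟨csInf_le hc.isCompact.bddBelow hx, le_csSup hc.isCompact.bddAbove hx⟩
      · exact (hs (hc.isCompact.sInf_mem h)).1
      · exact (hs (hc.isCompact.sSup_mem h)).2
  swap
  · have : η = 0 := by
      rw [← tsupport_eq_empty_iff]; assumption
    exact ⟨0, contDiff_const, HasCompactSupport.zero, by simp, by subst this; simp⟩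
  have hint : Integrable η := hη.continuous.integrable_of_hasCompactSupport hc
  have hz : ∀ t, t ∉ Icc p q → η t = 0 := fun t ht =>
    image_eq_zero_of_notMem_tsupport fun h => ht (hpq h)
  have hder : ∀ t, HasDerivAt (fun t => ∫ s in Iic t, η s) (η t) t := by
    intro t
    have h1 : (fun t => ∫ s in Iic t, η s) = fun t => (∫ s in Iic 0, η s) + ∫ s in (0:ℝ)..t, η s := by
      funext t
      rw [← intervalIntegral.integral_Iic_sub_Iic hint.integrableOn hint.integrableOn]
      ring
    rw [h1]
    exact (intervalIntegral.integral_hasDerivAt_right (hη.continuous.intervalIntegrable _ _)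
      (hη.continuous.stronglyMeasurableAtFilter _ _) hη.continuous.continuousAt).const_add _
  have hd : deriv (fun t => ∫ s in Iic t, η s) = η := funext fun t => (hder t).deriv
  have hsupp : tsupport (fun t => ∫ s in Iic t, η s) ⊆ Icc p q := by
    refine closure_minimal (fun t ht => ?_) isClosed_Icc
    by_contra h
    refine ht ?_
    rcases not_and_or.1 h with h | h
    · refine setIntegral_eq_zero_of_forall_eq_zero fun s hs => hz s fun h' => h ?_
      exact h'.1.trans hs
    · change ∫ s in Iic t, η s = 0
      have := setIntegral_eq_of_subset_of_forall_sdiff_eq_zero (μ := volume) MeasurableSet.univ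
        (subset_univ (Iic t)) fun s hs => hz s fun h' => h ((le_of_lt (not_le.1 hs.2)).trans h'.2)
      rw [← this, setIntegral_univ, h0]
  refine ⟨_, ?_, HasCompactSupport.of_support_subset_isCompact isCompact_Icc
    ((subset_tsupport _).trans hsupp), hsupp.trans fun x hx => ⟨hap.trans_le hx.1, hx.2.trans_lt hqb⟩,
    hd⟩
  rw [contDiff_infty_iff_deriv, hd]
  exact ⟨fun t => (hder t).differentiableAt, hη⟩

/-- A continuous function whose weak derivative vanishes is constant. -/
theorem eq_const_of_weakDeriv_eq_zero {a b : ℝ} (hab : a < b) {w : ℝ → F} (hw : Continuous w)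
    (h : ∀ ζ : ℝ → ℝ, ContDiff ℝ ∞ ζ → HasCompactSupport ζ → tsupport ζ ⊆ Ioo a b →
      ∫ t, deriv ζ t • w t = 0) : ∃ c, ∀ t ∈ Icc a b, w t = c := by
  obtain ⟨f, hf1, hf2, hf3⟩ : ∃ f : ContDiffBump ((a + b) / 2), tsupport f ⊆ Ioo a b ∧
      HasCompactSupport f ∧ ContDiff ℝ ∞ f := by
    refine ⟨⟨(b - a) / 8, (b - a) / 4, by linarith, by linarith⟩, ?_, ContDiffBump.hasCompactSupport _,
      ContDiffBump.contDiff _⟩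
    rw [ContDiffBump.tsupport_eq, Real.closedBall_eq_Icc]
    intro x hx
    simp only [mem_Icc] at hx
    constructor <;> linarith [hx.1, hx.2]
  set I := ∫ t, f t with hI
  have hI0 : I ≠ 0 := f.integral_pos.ne'
  refine ⟨I⁻¹ • ∫ t, f t • w t, ?_⟩
  have hsm : ∀ ζ : ℝ → ℝ, Continuous ζ → HasCompactSupport ζ → Integrable fun t => ζ t • w t :=
    fun ζ h1 h2 => (h1.smul hw).integrable_of_hasCompactSupport h2.smul_right
  have hae : ∀ᵐ t, t ∈ Ioo a b → w t - I⁻¹ • ∫ t, f t • w t = 0 := by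
    refine isOpen_Ioo.ae_eq_zero_of_integral_contDiff_smul_eq_zero
      ((hw.sub continuous_const).continuousOn.locallyIntegrableOn measurableSet_Ioo) ?_
    intro ζ hζ hζc hζs
    have hζi : Integrable ζ := hζ.continuous.integrable_of_hasCompactSupport hζc
    have hfi : Integrable f := hf3.continuous.integrable_of_hasCompactSupport hf2
    have hsub : tsupport (ζ - fun t => ((∫ t, ζ t) * I⁻¹) * f t) ⊆ Ioo a b := by
      refine (tsupport_sub _ _).trans (union_subset hζs ?_)
      exact (tsupport_mul_subset_right).trans hf1
    have hcomp : HasCompactSupport (ζ - fun t => ((∫ t, ζ t) * I⁻¹) * f t) :=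
      hζc.sub hf2.mul_left
    -- Subtracting the multiple of the bump with the same integral leaves a function of integral
    -- zero, that is, the derivative of a test function.
    obtain ⟨Z, hZ1, hZ2, hZ3, hZ4⟩ := exists_contDiff_primitive
      (η := ζ - fun t => ((∫ t, ζ t) * I⁻¹) * f t) (a := a) (b := b)
      (hζ.sub (contDiff_const.mul hf3)) hcomp hsub (by
        simp only [Pi.sub_apply]
        rw [integral_sub hζi (hfi.const_mul _), integral_const_mul, ← hI]
        field_simp
        ring)
    have := h Z hZ1 hZ2 hZ3
    rw [hZ4] at this
    simp only [Pi.sub_apply, sub_smul, mul_smul] at this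
    rw [integral_sub (hsm ζ hζ.continuous hζc), integral_smul, integral_smul] at this
    · simp only [smul_sub]
      rw [integral_sub (hsm ζ hζ.continuous hζc) (hζi.smul_const _), integral_smul_const]
      exact this
    · exact Integrable.smul (∫ t, ζ t) (Integrable.smul I⁻¹ (hsm f hf3.continuous hf2))
  have hcl : ∀ t ∈ Ioo a b, w t = I⁻¹ • ∫ t, f t • w t := by
    have := Measure.eqOn_open_of_ae_eq (μ := volume) (U := Ioo a b) (f := w)
      (g := fun _ => I⁻¹ • ∫ t, f t • w t) ?_ isOpen_Ioo hw.continuousOn continuousOn_const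
    · exact this
    · rw [Filter.EventuallyEq, ae_restrict_iff' measurableSet_Ioo]
      filter_upwards [hae] with t ht hm using sub_eq_zero.1 (ht hm)
  intro t ht
  rw [← closure_Ioo hab.ne] at ht
  exact (isClosed_eq hw continuous_const).closure_subset_iff.2 (fun t ht => hcl t ht) ht

/-- The continuous representative of a Sobolev function is a primitive of its weak derivative. -/
theorem HasSobolevDeriv.eq_primitive {a : ℝ} (ha : a < 0) {ψ g : ℝ → F}
    (h : HasSobolevDeriv (Ioo a 0) ψ g) (hψ : Continuous ψ) {t : ℝ} (ht : t ∈ Icc a 0) :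
    ψ t = ψ 0 + ∫ s in (0 : ℝ)..t, g s := by
  have hg : IntegrableOn g (Ioo a 0) := memLp_two_integrableOn (by simp) h.2.1
  have hgi : Integrable ((Ioo a 0).indicator g) := hg.integrable_indicator measurableSet_Ioo
  have hcont : Continuous fun t => ∫ s in (0 : ℝ)..t, (Ioo a 0).indicator g s :=
    intervalIntegral.continuous_primitive (fun _ _ => hgi.intervalIntegrable) 0
  obtain ⟨c, hc⟩ := eq_const_of_weakDeriv_eq_zero ha
    (w := fun t => ψ t - ∫ s in (0 : ℝ)..t, (Ioo a 0).indicator g s) (hψ.sub hcont) (by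
      intro ζ hζ hζc hζs
      have h1 := h.2.2 ζ hζ hζc hζs
      have h2 := integral_deriv_smul_primitive hgi 0 hζ hζc
      have hz : ∀ t, t ∉ Ioo a 0 → ζ t = 0 := fun t ht =>
        image_eq_zero_of_notMem_tsupport fun h => ht (hζs h)
      have hz' : ∀ t, t ∉ Ioo a 0 → deriv ζ t = 0 := fun t ht =>
        image_eq_zero_of_notMem_tsupport fun h => ht (hζs (tsupport_deriv_subset h))
      have hζ' := hζ.continuous_deriv (by simp)
      simp only [zero_add] at h2
      simp only [smul_sub]
      rw [integral_sub, h2, sub_neg_eq_add]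
      · rw [← integral_indicator measurableSet_Ioo, ← integral_indicator measurableSet_Ioo] at h1
        have e1 : (Ioo a 0).indicator (fun t => deriv ζ t • ψ t) = fun t => deriv ζ t • ψ t := by
          rw [indicator_eq_self]
          intro t ht
          by_contra h
          exact ht (by simp [hz' t h])
        have e2 : (Ioo a 0).indicator (fun t => ζ t • g t)
            = fun t => ζ t • (Ioo a 0).indicator g t := by
          funext t
          rw [indicator_smul_apply]
        rw [e1, e2] at h1
        rw [h1, neg_add_cancel]
      · exact (hζ'.smul hψ).integrable_of_hasCompactSupport hζc.deriv.smul_right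
      · exact (hζ'.smul hcont).integrable_of_hasCompactSupport hζc.deriv.smul_right)
  have h0 := hc 0 ⟨ha.le, le_rfl⟩
  have h1 := hc t ht
  simp only [intervalIntegral.integral_same, sub_zero] at h0
  rw [← h0, sub_eq_iff_eq_add] at h1
  rw [h1]
  congr 1
  refine intervalIntegral.integral_congr_ae ?_
  filter_upwards [Measure.ae_ne volume (0 : ℝ)] with s hs0 hs
  rw [uIoc_of_ge ht.2] at hs
  have hm : s ∈ Ioo a 0 := ⟨lt_of_le_of_lt ht.1 hs.1, lt_of_le_of_ne hs.2 hs0⟩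
  exact indicator_of_mem hm g

end WeakDerivatives

/-! ### Regularity of elements of the domain of the square -/

section SmoothDomain

variable {n : ℕ} {τ : ℝ}

/-- Continuously differentiable data for a pair in the graph of the delay operator. -/
structure SmoothPair (Atilde : C(Icc (-τ) (0 : ℝ), Vec n) →L[ℝ] Vec n) (φ ξ : HSpace n τ)
    (ψ : C(ℝ, Vec n)) (ψ' : ℝ → Vec n) : Prop where
  hasDerivAt : ∀ t, HasDerivAt ψ (ψ' t) t
  continuous_deriv : Continuous ψ'
  fst_ae_eq : φ =ᵐ[delayMeasure τ] ψ
  snd_ae_eq : ξ =ᵐ[delayMeasure τ] fun s =>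
    if s = 0 then Atilde (ψ.restrict (Icc (-τ) (0 : ℝ))) else ψ' s

/-- Since `ξ` is in the domain as well, the weak derivative of `ψ` agrees a.e. with a continuous
function `ψ'`. So `ψ` coincides on `[-τ, 0]` with the primitive of `ψ'`, which is continuously
differentiable on all of `ℝ`. -/
theorem exists_smoothPair (hτ : 0 < τ) {Atilde : C(Icc (-τ) (0 : ℝ), Vec n) →L[ℝ] Vec n}
    {φ ξ z : HSpace n τ} (h1 : (φ, ξ) ∈ delayOperator Atilde) (h2 : (ξ, z) ∈ delayOperator Atilde) :
    ∃ ψ ψ', SmoothPair Atilde φ ξ ψ ψ' := by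
  obtain ⟨ψ, g, hg, hφ, hξ⟩ := h1
  obtain ⟨ψ', -, -, hξ', -⟩ := h2
  simp only at hφ hξ hξ'
  -- The atom is left out: there `ξ` is given by `Atilde`, and the representative `g` is arbitrary.
  have hgψ : ∀ᵐ s ∂delayMeasure τ, s ≠ 0 → g s = ψ' s := by
    filter_upwards [hξ, hξ'] with s e1 e2 hs
    rw [← e2, e1, if_neg hs]
  have hgψ' : ∀ᵐ s : ℝ, s ∈ Icc (-τ) 0 → s ≠ 0 → g s = ψ' s := by
    rw [delayMeasure, ae_add_measure_iff] at hgψ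
    exact (ae_restrict_iff' measurableSet_Icc).1 hgψ.1
  have hder : ∀ t, HasDerivAt (fun t => ψ 0 + ∫ s in (0 : ℝ)..t, ψ' s) (ψ' t) t := fun t =>
    (intervalIntegral.integral_hasDerivAt_right (ψ'.continuous.intervalIntegrable _ _)
      (ψ'.continuous.stronglyMeasurableAtFilter _ _) ψ'.continuous.continuousAt).const_add _
  let ψ₁ : C(ℝ, Vec n) := ⟨fun t => ψ 0 + ∫ s in (0 : ℝ)..t, ψ' s,
    continuous_iff_continuousAt.2 fun t => (hder t).continuousAt⟩
  have heq : ∀ t ∈ Icc (-τ) 0, ψ t = ψ₁ t := by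
    intro t ht
    rw [hg.eq_primitive (by linarith) ψ.continuous ht]
    change _ = ψ 0 + ∫ s in (0 : ℝ)..t, ψ' s
    congr 1
    refine intervalIntegral.integral_congr_ae ?_
    filter_upwards [hgψ', Measure.ae_ne volume (0 : ℝ)] with s hs hs0 hst
    rw [uIoc_of_ge ht.2] at hst
    exact hs ⟨ht.1.trans hst.1.le, hst.2⟩ hs0
  have hres : ψ.restrict (Icc (-τ) (0 : ℝ)) = ψ₁.restrict (Icc (-τ) (0 : ℝ)) := by
    ext1 t
    exact heq t t.2
  have hIcc : ∀ᵐ s ∂delayMeasure τ, s ∈ Icc (-τ) 0 := by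
    rw [delayMeasure, ae_add_measure_iff]
    exact ⟨ae_restrict_mem measurableSet_Icc, (ae_dirac_iff measurableSet_Icc).2 ⟨by simpa using hτ.le, le_rfl⟩⟩
  refine ⟨ψ₁, ψ', hder, ψ'.continuous, ?_, ?_⟩
  · filter_upwards [hφ, hIcc] with s hs hm
    rw [hs, heq s hm]
  · filter_upwards [hξ, hgψ] with s hs hs'
    rw [hs, ← hres]
    split_ifs with h0
    · rfl
    · exact hs' h0

end SmoothDomain

/-! ### Faces of the cube and their measures -/

section FaceMeasures

variable {m : ℕ}

/-- Lebesgue measure on `[-τ, 0]` in the directions belonging to `S`, unit mass at `0` in the other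
directions. -/
noncomputable def faceCoord (τ : ℝ) (S : Finset (Fin m)) (a : Fin m) : Measure ℝ :=
  if a ∈ S then volume.restrict (Icc (-τ) 0) else Measure.dirac 0

instance (τ : ℝ) (S : Finset (Fin m)) (a : Fin m) : IsFiniteMeasure (faceCoord τ S a) := by
  unfold faceCoord; split_ifs <;> infer_instance

/-- Lebesgue measure on the face of `[-τ, 0]ᵐ` whose free directions are those in `S`. -/
noncomputable def faceMeasure (τ : ℝ) (S : Finset (Fin m)) : Measure (Fin m → ℝ) :=
  Measure.pi (faceCoord τ S)

instance (τ : ℝ) (S : Finset (Fin m)) : IsFiniteMeasure (faceMeasure τ S) := by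
  unfold faceMeasure; infer_instance

/-- Expanding `∏ (Lebesgue + Dirac)` on boxes yields one product measure for each choice of free
directions. Thus one function of `m` variables carries its values on all faces through the origin.
-/
theorem pi_delayMeasure (τ : ℝ) :
    (Measure.pi fun _ : Fin m => delayMeasure τ) = ∑ S : Finset (Fin m), faceMeasure τ S := by
  refine Measure.pi_eq fun s _ => ?_
  simp only [delayMeasure, Measure.coe_add, Pi.add_apply, Measure.finsetSum_apply, faceMeasure,
    Measure.pi_pi]
  rw [Finset.prod_add, Finset.powerset_univ]
  refine Finset.sum_congr rfl fun S _ => ?_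
  rw [← Finset.prod_mul_prod_compl S, Finset.compl_eq_univ_sdiff]
  congr 1
  · exact Finset.prod_congr rfl fun a ha => by simp [faceCoord, ha]
  · exact Finset.prod_congr rfl fun a ha => by
      simp [faceCoord, (Finset.mem_sdiff.1 ha).2]

theorem faceMeasure_le (τ : ℝ) (S : Finset (Fin m)) :
    faceMeasure τ S ≤ Measure.pi fun _ : Fin m => delayMeasure τ := by
  rw [pi_delayMeasure]
  refine Measure.le_iff.2 fun s _ => ?_
  rw [Measure.finsetSum_apply]
  exact Finset.single_le_sum (f := fun S => faceMeasure τ S s) (fun _ _ => zero_le)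
    (Finset.mem_univ S)

theorem faceCoord_erase (τ : ℝ) (S : Finset (Fin m)) (a : Fin m) :
    faceCoord τ (S.erase a) = Function.update (faceCoord τ S) a (Measure.dirac 0) := by
  funext b
  by_cases hb : b = a
  · subst hb; simp [faceCoord]
  · simp [faceCoord, hb]

/-- The embedding of `ℝᵏ` into `ℝᵐ` given by the directions `j₁ < ⋯ < j_k`. -/
noncomputable def faceEmbed {k : ℕ} (j : Fin k ↪o Fin m) (θ : Fin k → ℝ) : Fin m → ℝ :=
  Function.extend j θ 0

theorem faceEmbed_apply {k : ℕ} (j : Fin k ↪o Fin m) (θ : Fin k → ℝ) (i : Fin k) :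
    faceEmbed j θ (j i) = θ i := j.injective.extend_apply _ _ _

theorem faceEmbed_of_notMem {k : ℕ} (j : Fin k ↪o Fin m) (θ : Fin k → ℝ) {a : Fin m}
    (h : ¬∃ i, j i = a) : faceEmbed j θ a = 0 := Function.extend_apply' _ _ _ h

theorem continuous_faceEmbed {k : ℕ} (j : Fin k ↪o Fin m) : Continuous (faceEmbed j) := by
  refine continuous_pi fun a => ?_
  by_cases h : ∃ i, j i = a
  · obtain ⟨i, rfl⟩ := h
    simpa only [faceEmbed_apply] using continuous_apply i
  · simpa only [faceEmbed_of_notMem j _ h] using continuous_const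

/-- The free directions of a face. -/
def faceSet {k : ℕ} (j : Fin k ↪o Fin m) : Finset (Fin m) := Finset.univ.map j.toEmbedding

theorem mem_faceSet {k : ℕ} (j : Fin k ↪o Fin m) (a : Fin m) : a ∈ faceSet j ↔ ∃ i, j i = a := by
  simp [faceSet]

theorem faceSet_erase {k : ℕ} (j : Fin (k + 1) ↪o Fin m) (l : Fin (k + 1)) :
    faceSet (l.succAboveOrderEmb.trans j) = (faceSet j).erase (j l) := by
  ext a
  simp only [mem_faceSet, Finset.mem_erase, RelEmbedding.coe_trans, Function.comp_apply,
    Fin.succAboveOrderEmb_apply]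
  constructor
  · rintro ⟨i, rfl⟩
    exact ⟨fun h => Fin.succAbove_ne l i (j.injective h), _, rfl⟩
  · rintro ⟨h, i, rfl⟩
    obtain ⟨i', rfl⟩ := Fin.exists_succAbove_eq (fun h' : i = l => h (by rw [h']))
    exact ⟨i', rfl⟩

theorem exists_faceSet_eq {S : Finset (Fin m)} (hS : S.Nonempty) :
    ∃ k < m, ∃ j : Fin (k + 1) ↪o Fin m, faceSet j = S := by
  obtain ⟨k, hk⟩ := Nat.exists_eq_succ_of_ne_zero hS.card_ne_zero
  have hkm : S.card ≤ m := by simpa using S.card_le_univ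
  refine ⟨k, by omega, S.orderEmbOfFin hk, ?_⟩
  ext a
  rw [mem_faceSet]
  exact Set.ext_iff.1 (S.range_orderEmbOfFin hk) a

theorem volume_restrict_cube (τ : ℝ) (k : ℕ) :
    volume.restrict (cube τ k) = Measure.pi fun _ : Fin k => volume.restrict (Icc (-τ) (0 : ℝ)) := by
  rw [cube, volume_pi, Measure.restrict_pi_pi]
  congr 1
  funext i
  exact Measure.restrict_congr_set Ioo_ae_eq_Icc

/-- This makes restriction to a face meaningful for classes of functions and transfers its norms to
the cube of lower dimension. -/
theorem measurePreserving_faceEmbed (τ : ℝ) {k : ℕ} (j : Fin k ↪o Fin m) :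
    MeasurePreserving (faceEmbed j) (volume.restrict (cube τ k)) (faceMeasure τ (faceSet j)) := by
  refine ⟨(continuous_faceEmbed j).measurable, (Measure.pi_eq fun s hs => ?_).symm⟩
  rw [Measure.map_apply (continuous_faceEmbed j).measurable (MeasurableSet.univ_pi hs),
    volume_restrict_cube, ← Finset.prod_mul_prod_compl (faceSet j)]
  have h1 : ∏ a ∈ faceSet j, faceCoord τ (faceSet j) a (s a)
      = ∏ i, volume.restrict (Icc (-τ) (0 : ℝ)) (s (j i)) := by
    rw [faceSet, Finset.prod_map]
    refine Finset.prod_congr rfl fun i _ => ?_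
    simp [faceCoord]
  rw [h1]
  -- Either the box contains `0` in all fixed directions, and its preimage is a box, or it misses
  -- the face.
  by_cases h : ∀ a ∉ faceSet j, (0 : ℝ) ∈ s a
  · have h2 : ∏ a ∈ (faceSet j)ᶜ, faceCoord τ (faceSet j) a (s a) = 1 := by
      refine Finset.prod_eq_one fun a ha => ?_
      have ha' := Finset.mem_compl.1 ha
      simp [faceCoord, ha', hs a, h a ha']
    have h3 : faceEmbed j ⁻¹' Set.pi univ s = Set.pi univ fun i => s (j i) := by
      ext θ
      simp only [mem_preimage, Set.mem_pi, mem_univ, true_imp_iff]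
      refine ⟨fun H i => by simpa [faceEmbed_apply] using H (j i), fun H a => ?_⟩
      by_cases ha : ∃ i, j i = a
      · obtain ⟨i, rfl⟩ := ha
        simpa [faceEmbed_apply] using H i
      · rw [faceEmbed_of_notMem j θ ha]
        exact h a (by rwa [mem_faceSet])
    rw [h2, h3, mul_one, Measure.pi_pi]
  · push Not at h
    obtain ⟨a, ha, h0⟩ := h
    have h3 : faceEmbed j ⁻¹' Set.pi univ s = ∅ := by
      refine eq_empty_of_forall_notMem fun θ hθ => h0 ?_
      have := hθ a (mem_univ a)
      rwa [faceEmbed_of_notMem j θ (by rwa [mem_faceSet] at ha)] at this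
    rw [h3, measure_empty, Finset.prod_eq_zero (Finset.mem_compl.2 ha), mul_zero]
    simp [faceCoord, ha, hs a, h0]

/-- This geometric identity is why the trace of a restriction is the restriction to the smaller
face. -/
theorem faceEmbed_insertNth {k : ℕ} (j : Fin (k + 1) ↪o Fin m) (l : Fin (k + 1))
    (θ : Fin k → ℝ) :
    faceEmbed j (l.insertNth (α := fun _ => ℝ) 0 θ) = faceEmbed (l.succAboveOrderEmb.trans j) θ := by
  funext a
  by_cases h : ∃ i, (l.succAboveOrderEmb.trans j) i = a
  · obtain ⟨i, rfl⟩ := h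
    rw [faceEmbed_apply]
    simp [faceEmbed_apply]
  · rw [faceEmbed_of_notMem _ _ h]
    by_cases h' : ∃ i, j i = a
    · obtain ⟨i, rfl⟩ := h'
      rw [faceEmbed_apply]
      by_cases hi : i = l
      · subst hi; simp
      · obtain ⟨i', rfl⟩ := Fin.exists_succAbove_eq hi
        exact absurd ⟨i', rfl⟩ h
    · rw [faceEmbed_of_notMem _ _ h']

/-! ### Integration over products of measures on `[-τ, 0]` -/

theorem integrable_pi_of_continuous {τ : ℝ} {ν : Fin m → Measure ℝ} [∀ a, IsFiniteMeasure (ν a)]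
    (hν : ∀ a, ∀ᵐ s ∂ν a, s ∈ Icc (-τ) 0) {E : Type*} [NormedAddCommGroup E]
    {f : (Fin m → ℝ) → E} (hf : Continuous f) : Integrable f (Measure.pi ν) := by
  have hK : IsCompact (Set.pi univ fun _ : Fin m => Icc (-τ) (0 : ℝ)) :=
    isCompact_univ_pi fun _ => isCompact_Icc
  have h1 := hf.continuousOn.integrableOn_compact (μ := Measure.pi ν) hK
  have h2 : ∀ᵐ θ ∂Measure.pi ν, θ ∈ Set.pi univ fun _ : Fin m => Icc (-τ) (0 : ℝ) := by
    have : ∀ᵐ θ ∂Measure.pi ν, ∀ a, θ a ∈ Icc (-τ) (0 : ℝ) :=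
      ae_all_iff.2 fun a => (Measure.quasiMeasurePreserving_eval ν a).ae (hν a)
    filter_upwards [this] with θ hθ a _ using hθ a
  rwa [IntegrableOn, Measure.restrict_eq_self_of_ae_mem h2] at h1

instance isFiniteMeasure_update (ν : Fin m → Measure ℝ) [∀ a, IsFiniteMeasure (ν a)] (a : Fin m)
    (ρ : Measure ℝ) [IsFiniteMeasure ρ] (b : Fin m) :
    IsFiniteMeasure (Function.update ν a ρ b) := by
  by_cases hb : b = a
  · subst hb; simpa
  · rw [Function.update_of_ne hb]; infer_instance

theorem ae_mem_update {ν : Fin m → Measure ℝ} {s : Set ℝ} (hν : ∀ a, ∀ᵐ t ∂ν a, t ∈ s)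
    (a : Fin m) {ρ : Measure ℝ} (hρ : ∀ᵐ t ∂ρ, t ∈ s) (b : Fin m) :
    ∀ᵐ t ∂Function.update ν a ρ b, t ∈ s := by
  by_cases hb : b = a
  · subst hb; simpa using hρ
  · rw [Function.update_of_ne hb]; exact hν b

theorem integral_pi_update {k : ℕ} (ν : Fin (k + 1) → Measure ℝ) [∀ a, IsFiniteMeasure (ν a)]
    (a : Fin (k + 1)) (ρ : Measure ℝ) [IsFiniteMeasure ρ]
    {f : (Fin (k + 1) → ℝ) → ℝ} (hf : Integrable f (Measure.pi (Function.update ν a ρ))) :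
    ∫ θ, f θ ∂(Measure.pi (Function.update ν a ρ))
      = ∫ y, ∫ t, f (a.insertNth (α := fun _ => ℝ) t y) ∂ρ ∂(Measure.pi fun i => ν (a.succAbove i)) := by
  have hmp := (measurePreserving_piFinSuccAbove (Function.update ν a ρ) a).symm
  simp only [Function.update_self, Function.update_of_ne (Fin.succAbove_ne a _)] at hmp
  rw [← hmp.integral_comp', integral_prod_symm]
  · rfl
  · exact (hmp.integrable_comp_emb (MeasurableEquiv.measurableEmbedding _)).2 hf

/-- Integration of a partial derivative in one direction. -/
theorem integral_pi_deriv {τ : ℝ} {ν : Fin m → Measure ℝ} [∀ a, IsFiniteMeasure (ν a)]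
    (hν : ∀ a, ∀ᵐ s ∂ν a, s ∈ Icc (-τ) 0) (a : Fin m) {p q : ℝ} (hp : -τ ≤ p) (hpq : p ≤ q)
    (hq : q ≤ 0) {f D : (Fin m → ℝ) → ℝ} (hf : Continuous f) (hD : Continuous D)
    (hder : ∀ θ, HasDerivAt (fun t => f (Function.update θ a t)) (D θ) (θ a)) :
    ∫ θ, D θ ∂(Measure.pi (Function.update ν a (volume.restrict (Icc p q))))
      = ∫ θ, f θ ∂(Measure.pi (Function.update ν a (Measure.dirac q)))
        - ∫ θ, f θ ∂(Measure.pi (Function.update ν a (Measure.dirac p))) := by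
  obtain _ | k := m
  · exact a.elim0
  have hint : ∀ (ρ : Measure ℝ) [IsFiniteMeasure ρ] (_ : ∀ᵐ s ∂ρ, s ∈ Icc (-τ) 0)
      {h : (Fin (k + 1) → ℝ) → ℝ} (_ : Continuous h),
      Integrable h (Measure.pi (Function.update ν a ρ)) := by
    intro ρ _ hρ h hh
    exact integrable_pi_of_continuous (τ := τ) (ae_mem_update hν a hρ) hh
  have hdirac : ∀ s ∈ Icc (-τ) 0, ∀ᵐ t ∂(Measure.dirac s), t ∈ Icc (-τ) 0 := fun s hs =>
    (ae_dirac_iff measurableSet_Icc).2 hs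
  have hI : ∀ᵐ t ∂(volume.restrict (Icc p q)), t ∈ Icc (-τ) 0 := by
    filter_upwards [ae_restrict_mem measurableSet_Icc] with t ht
    exact ⟨hp.trans ht.1, ht.2.trans hq⟩
  rw [integral_pi_update ν a _ (hint _ hI hD),
    integral_pi_update ν a _ (hint _ (hdirac q ⟨hp.trans hpq, hq⟩) hf),
    integral_pi_update ν a _ (hint _ (hdirac p ⟨hp, hpq.trans hq⟩) hf)]
  simp only [integral_dirac]
  have hins : ∀ t, Continuous fun y : Fin k → ℝ => a.insertNth (α := fun _ => ℝ) t y := fun t =>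
    continuous_const.finInsertNth a continuous_id
  have hi : ∀ t, Integrable (fun y => f (a.insertNth (α := fun _ => ℝ) t y))
      (Measure.pi fun i => ν (a.succAbove i)) := fun t =>
    integrable_pi_of_continuous (τ := τ) (fun i => hν _) (hf.comp (hins t))
  rw [← integral_sub (hi q) (hi p)]
  refine integral_congr_ae (Eventually.of_forall fun y => ?_)
  have hc : Continuous fun t => D (a.insertNth (α := fun _ => ℝ) t y) :=
    hD.comp (Continuous.finInsertNth (A := fun _ => ℝ) a continuous_id continuous_const)
  simp only
  -- With the other coordinates fixed by Fubini, this is the fundamental theorem of calculus in the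
  -- direction `a`.
  rw [integral_Icc_eq_integral_Ioc, ← intervalIntegral.integral_of_le hpq]
  refine intervalIntegral.integral_eq_sub_of_hasDerivAt
    (f := fun t => f (a.insertNth (α := fun _ => ℝ) t y)) (fun t _ => ?_)
    (hc.intervalIntegrable _ _)
  have := hder (a.insertNth (α := fun _ => ℝ) t y)
  simpa using this

end FaceMeasures

/-! ### Bounds on slices and of the functional acting in one direction -/

section SliceEstimates

variable {m n : ℕ} {τ : ℝ}

theorem faceCoord_ae_mem (hτ : 0 ≤ τ) (S : Finset (Fin m)) (a : Fin m) :
    ∀ᵐ s ∂faceCoord τ S a, s ∈ Icc (-τ) 0 := by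
  unfold faceCoord
  split_ifs
  · exact ae_restrict_mem measurableSet_Icc
  · exact (ae_dirac_iff measurableSet_Icc).2 ⟨by linarith, le_rfl⟩

theorem integrable_faceMeasure (hτ : 0 ≤ τ) (S : Finset (Fin m)) {E : Type*}
    [NormedAddCommGroup E] {f : (Fin m → ℝ) → E} (hf : Continuous f) :
    Integrable f (faceMeasure τ S) :=
  integrable_pi_of_continuous (faceCoord_ae_mem hτ S) hf

theorem pi_update_restrict_le (ν : Fin m → Measure ℝ) [∀ a, IsFiniteMeasure (ν a)] (a : Fin m)
    (ρ : Measure ℝ) [IsFiniteMeasure ρ] (s : Set ℝ) :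
    Measure.pi (Function.update ν a (ρ.restrict s)) ≤ Measure.pi (Function.update ν a ρ) := by
  have : Function.update ν a (ρ.restrict s) = fun b => (Function.update ν a ρ b).restrict
      (Function.update (fun _ => univ) a s b) := by
    funext b
    by_cases hb : b = a
    · subst hb; simp
    · simp [Function.update_of_ne hb]
  rw [this, ← Measure.restrict_pi_pi]
  exact Measure.restrict_le_self

theorem integral_update_dirac {ν : Fin m → Measure ℝ} [∀ a, IsFiniteMeasure (ν a)] (hτ : 0 ≤ τ)
    (hν : ∀ a, ∀ᵐ s ∂ν a, s ∈ Icc (-τ) 0) (i : Fin m) {s : ℝ} (hs : s ∈ Icc (-τ) 0)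
    {f : (Fin m → ℝ) → ℝ} (hf : Continuous f) :
    ∫ θ, f (Function.update θ i s) ∂(Measure.pi (Function.update ν i (Measure.dirac 0)))
      = ∫ θ, f θ ∂(Measure.pi (Function.update ν i (Measure.dirac s))) := by
  obtain _ | k := m
  · exact i.elim0
  have hdirac : ∀ s ∈ Icc (-τ) 0, ∀ᵐ t ∂(Measure.dirac s), t ∈ Icc (-τ) 0 := fun s hs =>
    (ae_dirac_iff measurableSet_Icc).2 hs
  rw [integral_pi_update ν i (Measure.dirac s)
      (integrable_pi_of_continuous (ae_mem_update hν i (hdirac s hs)) hf),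
    integral_pi_update ν i (Measure.dirac 0) (f := fun θ => f (Function.update θ i s))
      (integrable_pi_of_continuous
      (ae_mem_update hν i (hdirac 0 ⟨by linarith, le_rfl⟩))
      (hf.comp (continuous_id.update i continuous_const)))]
  simp

/-- The square integral over a slice is bounded by the square integrals of the function and its
diagonal derivative and the square integrals over the faces containing the origin. -/
theorem slice_le (hτ : 0 ≤ τ) {S : Finset (Fin m)} {i : Fin m} (hi : i ∈ S)
    {f : (Fin m → ℝ) → ℝ} {D : Fin m → (Fin m → ℝ) → ℝ} (hf : Continuous f)
    (hD : ∀ a, Continuous (D a))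
    (hder : ∀ a θ, HasDerivAt (fun t => f (Function.update θ a t)) (D a θ) (θ a))
    {s : ℝ} (hs : s ∈ Icc (-τ) 0) :
    ∫ θ, f (Function.update θ i s) ^ 2 ∂faceMeasure τ (S.erase i)
      ≤ ∑ a ∈ S, ∫ θ, f θ ^ 2 ∂faceMeasure τ (S.erase a) + ∫ θ, f θ ^ 2 ∂faceMeasure τ S
        + ∫ θ, (∑ a ∈ S, D a θ) ^ 2 ∂faceMeasure τ S := by
  set ν := faceCoord τ S with hν
  -- Lebesgue measure on the part `s ≤ θᵢ ≤ 0` of the face; the divergence of `f²` along the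
  -- diagonal is integrated over it.
  set νs := Function.update ν i (volume.restrict (Icc s 0)) with hνs
  have hmem := faceCoord_ae_mem hτ S
  have hIs : ∀ᵐ t ∂(volume.restrict (Icc s 0)), t ∈ Icc (-τ) 0 := by
    filter_upwards [ae_restrict_mem measurableSet_Icc] with t ht
    exact ⟨hs.1.trans ht.1, ht.2⟩
  have hmems := ae_mem_update hmem i hIs
  have hfin : ∀ a, IsFiniteMeasure (νs a) := fun a => by rw [hνs]; infer_instance
  have hder2 : ∀ a θ, HasDerivAt (fun t => f (Function.update θ a t) ^ 2)
      (2 * f θ * D a θ) (θ a) := by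
    intro a θ
    have := (hder a θ).fun_pow 2
    simpa [mul_assoc] using this
  have hf2 : Continuous fun θ => f θ ^ 2 := hf.pow 2
  have hD2 : ∀ a, Continuous fun θ => 2 * f θ * D a θ := fun a =>
    (continuous_const.mul hf).mul (hD a)
  have hint : ∀ {h : (Fin m → ℝ) → ℝ}, Continuous h → Integrable h (Measure.pi νs) := fun hh =>
    integrable_pi_of_continuous hmems hh
  have hSi : ∀ a ∈ S, Function.update ν a (volume.restrict (Icc (-τ) 0)) = ν := by
    intro a ha
    have : ν a = volume.restrict (Icc (-τ) 0) := by simp [hν, faceCoord, ha]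
    rw [← this, Function.update_eq_self]
  -- integration in the direction `i`
  have h1 : ∫ θ, 2 * f θ * D i θ ∂(Measure.pi νs)
      = ∫ θ, f θ ^ 2 ∂faceMeasure τ (S.erase i)
        - ∫ θ, f (Function.update θ i s) ^ 2 ∂faceMeasure τ (S.erase i) := by
    rw [hνs, integral_pi_deriv hmem i hs.1 hs.2 le_rfl hf2 (hD2 i) (hder2 i), faceMeasure,
      faceCoord_erase, integral_update_dirac hτ hmem i hs hf2]
  -- integration in the other directions
  have h2 : ∀ a ∈ S.erase i, ∫ θ, 2 * f θ * D a θ ∂(Measure.pi νs)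
      ≤ ∫ θ, f θ ^ 2 ∂faceMeasure τ (S.erase a) := by
    intro a ha
    obtain ⟨hai, haS⟩ := Finset.mem_erase.1 ha
    have hup : Function.update νs a (volume.restrict (Icc (-τ) 0)) = νs := by
      rw [hνs, Function.update_comm hai.symm, hSi a haS]
    have e := integral_pi_deriv hmems a le_rfl (by linarith) le_rfl hf2 (hD2 a) (hder2 a)
    rw [← hνs, hup] at e
    rw [e]
    -- The side `θₐ = 0` of this region is only a part of the corresponding face.
    have hle : Measure.pi (Function.update νs a (Measure.dirac 0)) ≤ faceMeasure τ (S.erase a) := by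
      have e1 : Function.update (faceCoord τ (S.erase a)) i (volume.restrict (Icc (-τ) 0))
          = faceCoord τ (S.erase a) := by
        have : faceCoord τ (S.erase a) i = volume.restrict (Icc (-τ) 0) := by
          simp [faceCoord, hi, Ne.symm hai]
        rw [← this, Function.update_eq_self]
      have e2 : Function.update νs a (Measure.dirac 0) = Function.update (faceCoord τ (S.erase a)) i
          ((volume.restrict (Icc (-τ) 0)).restrict (Icc s 0)) := by
        rw [Measure.restrict_restrict measurableSet_Icc,
          inter_eq_left.2 (Icc_subset_Icc_left hs.1), faceCoord_erase, ← hν,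
          Function.update_comm hai.symm]
      rw [e2, faceMeasure]
      conv_rhs => rw [← e1]
      exact pi_update_restrict_le _ _ _ _
    have h3 := integral_mono_measure hle (Eventually.of_forall fun θ => sq_nonneg (f θ))
      (integrable_faceMeasure hτ _ hf2)
    -- The side `θₐ = -τ` enters with a minus sign and may be dropped. No values away from the faces
    -- through the origin are needed.
    have h4 : 0 ≤ ∫ θ, f θ ^ 2 ∂(Measure.pi (Function.update νs a (Measure.dirac (-τ)))) :=
      integral_nonneg fun θ => sq_nonneg _
    linarith
  have hle : Measure.pi νs ≤ faceMeasure τ S := by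
    have e2 : νs = Function.update ν i ((volume.restrict (Icc (-τ) 0)).restrict (Icc s 0)) := by
      rw [Measure.restrict_restrict measurableSet_Icc, inter_eq_left.2 (Icc_subset_Icc_left hs.1)]
    rw [e2, faceMeasure, ← hν]
    conv_rhs => rw [← hSi i hi]
    exact pi_update_restrict_le _ _ _ _
  set g := fun θ => ∑ a ∈ S, D a θ with hg
  have hgc : Continuous g := continuous_finsetSum _ fun a _ => hD a
  have hg2 : Continuous fun θ => g θ ^ 2 := hgc.pow 2
  -- The pointwise bound `-(f² + g²) ≤ 2fg`, followed by enlarging the region to the whole face.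
  have h5 : -(∫ θ, f θ ^ 2 ∂faceMeasure τ S + ∫ θ, g θ ^ 2 ∂faceMeasure τ S)
      ≤ ∫ θ, 2 * f θ * g θ ∂(Measure.pi νs) := by
    rw [← integral_add (integrable_faceMeasure hτ _ hf2) (integrable_faceMeasure hτ _ hg2),
      neg_le, ← integral_neg]
    refine le_trans ?_ (integral_mono_measure hle
      (Eventually.of_forall fun θ => add_nonneg (sq_nonneg (f θ)) (sq_nonneg (g θ)))
      (integrable_faceMeasure hτ _ (hf2.add hg2)))
    refine integral_mono (hint ((continuous_const.mul hf).mul hgc).neg)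
      (hint (hf2.add hg2)) fun θ => ?_
    simp only
    nlinarith [sq_nonneg (f θ + g θ)]
  have h6 : ∫ θ, 2 * f θ * g θ ∂(Measure.pi νs) = ∑ a ∈ S, ∫ θ, 2 * f θ * D a θ ∂(Measure.pi νs) := by
    rw [← integral_finsetSum _ fun a _ => hint (hD2 a)]
    simp only [hg, Finset.mul_sum]
  rw [h6, ← Finset.add_sum_erase _ _ hi, h1] at h5
  have h7 := Finset.sum_le_sum h2
  have h8 := Finset.add_sum_erase S (fun a => ∫ θ, f θ ^ 2 ∂faceMeasure τ (S.erase a)) hi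
  linarith

/-- A finite linear combination of decomposable tensors of functions. -/
noncomputable def sumTensor {ι : Type*} [Fintype ι] (c : ι → ℝ) (ψ : ι → Fin m → ℝ → Vec n)
    (θ : Fin m → ℝ) : TensorVec m n :=
  ∑ r, c r • tensorVec fun a => ψ r a (θ a)

theorem continuous_update_fun {ι : Type*} {ψ : ι → Fin m → ℝ → Vec n} (hψ : ∀ r a, Continuous (ψ r a))
    (i : Fin m) {u : ι → ℝ → Vec n} (hu : ∀ r, Continuous (u r)) (r : ι) (a : Fin m) :
    Continuous (Function.update (ψ r) i (u r) a) := by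
  by_cases h : a = i
  · subst h; simpa using hu r
  · rw [Function.update_of_ne h]; exact hψ r a

variable {ι : Type*} [Fintype ι]

theorem sumTensor_apply (c : ι → ℝ) (ψ : ι → Fin m → ℝ → Vec n) (θ : Fin m → ℝ)
    (κ : Fin m → Fin n) : sumTensor c ψ θ κ = ∑ r, c r * ∏ a, ψ r a (θ a) (κ a) := by
  simp [sumTensor, tensorVec_apply]

theorem sumTensor_update_apply (c : ι → ℝ) (ψ : ι → Fin m → ℝ → Vec n) (i : Fin m)
    (u : ι → ℝ → Vec n) (θ : Fin m → ℝ) (κ : Fin m → Fin n) :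
    sumTensor c (fun r => Function.update (ψ r) i (u r)) θ κ
      = ∑ r, c r * (u r (θ i) (κ i) * ∏ b ∈ Finset.univ.erase i, ψ r b (θ b) (κ b)) := by
  rw [sumTensor_apply]
  refine Finset.sum_congr rfl fun r _ => ?_
  rw [prod_update_apply (fun b (v : ℝ → Vec n) => v (θ b) (κ b))]

theorem sumTensor_apply_update (c : ι → ℝ) (ψ : ι → Fin m → ℝ → Vec n) (i : Fin m)
    (θ : Fin m → ℝ) (κ : Fin m → Fin n) (s : ℝ) (d : Fin n) :
    sumTensor c ψ (Function.update θ i s) (Function.update κ i d)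
      = ∑ r, c r * (ψ r i s d * ∏ b ∈ Finset.univ.erase i, ψ r b (θ b) (κ b)) := by
  rw [sumTensor_apply]
  refine Finset.sum_congr rfl fun r _ => ?_
  rw [← Finset.mul_prod_erase _ _ (Finset.mem_univ i), Function.update_self, Function.update_self]
  congr 2
  refine Finset.prod_congr rfl fun b hb => ?_
  rw [Function.update_of_ne (Finset.ne_of_mem_erase hb),
    Function.update_of_ne (Finset.ne_of_mem_erase hb)]

theorem continuous_sumTensor_apply (c : ι → ℝ) {ψ : ι → Fin m → ℝ → Vec n}
    (hψ : ∀ r a, Continuous (ψ r a)) (κ : Fin m → Fin n) :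
    Continuous fun θ => sumTensor c ψ θ κ := by
  simp only [sumTensor_apply]
  refine continuous_finsetSum _ fun r _ => continuous_const.mul
    (continuous_finsetProd _ fun a _ => ?_)
  exact (EuclideanSpace.proj (𝕜 := ℝ) (κ a)).continuous.comp ((hψ r a).comp (continuous_apply a))

theorem continuous_sumTensor (c : ι → ℝ) {ψ : ι → Fin m → ℝ → Vec n}
    (hψ : ∀ r a, Continuous (ψ r a)) : Continuous (sumTensor c ψ) :=
  (PiLp.continuous_toLp 2 _).comp (continuous_pi (continuous_sumTensor_apply c hψ))

theorem hasDerivAt_sumTensor_apply (c : ι → ℝ) {ψ ψ' : ι → Fin m → ℝ → Vec n}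
    (hψ : ∀ r a t, HasDerivAt (ψ r a) (ψ' r a t) t) (a : Fin m) (θ : Fin m → ℝ)
    (κ : Fin m → Fin n) :
    HasDerivAt (fun t => sumTensor c ψ (Function.update θ a t) κ)
      (sumTensor c (fun r => Function.update (ψ r) a (ψ' r a)) θ κ) (θ a) := by
  rw [sumTensor_update_apply]
  have e : (fun t => sumTensor c ψ (Function.update θ a t) κ) = fun t =>
      ∑ r, c r * (ψ r a t (κ a) * ∏ b ∈ Finset.univ.erase a, ψ r b (θ b) (κ b)) := by
    funext t
    simpa using sumTensor_apply_update c ψ a θ κ t (κ a)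
  rw [e]
  refine HasDerivAt.fun_sum fun r _ => ((HasDerivAt.mul_const ?_ _).const_mul _)
  exact (EuclideanSpace.proj (𝕜 := ℝ) (κ a)).hasFDerivAt.comp_hasDerivAt _ (hψ r a (θ a))

/-- The quadratic polynomial `x ↦ ∫ (x f + g)²` is nonnegative, so its discriminant is not positive.
-/
theorem sq_integral_mul_le {α : Type*} [MeasurableSpace α] {μ : Measure α} {f g : α → ℝ}
    (hf : Integrable (fun x => f x ^ 2) μ) (hg : Integrable (fun x => g x ^ 2) μ)
    (hfg : Integrable (fun x => f x * g x) μ) :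
    (∫ x, f x * g x ∂μ) ^ 2 ≤ (∫ x, f x ^ 2 ∂μ) * ∫ x, g x ^ 2 ∂μ := by
  have h : ∀ x : ℝ, 0 ≤ (∫ x, f x ^ 2 ∂μ) * (x * x) + (2 * ∫ x, f x * g x ∂μ) * x
      + ∫ x, g x ^ 2 ∂μ := by
    intro x
    have : ∫ y, (f y * x + g y) ^ 2 ∂μ = (∫ x, f x ^ 2 ∂μ) * (x * x)
        + (2 * ∫ x, f x * g x ∂μ) * x + ∫ x, g x ^ 2 ∂μ := by
      have h12 : Integrable (fun y => f y ^ 2 * (x * x) + 2 * (f y * g y) * x) μ :=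
        (hf.mul_const _).add ((hfg.const_mul 2).mul_const _)
      rw [← integral_mul_const, ← integral_const_mul, ← integral_mul_const, ← integral_add
        (hf.mul_const _) ((hfg.const_mul 2).mul_const _), ← integral_add h12 hg]
      congr 1
      funext y
      ring
    rw [← this]
    exact integral_nonneg fun y => sq_nonneg _
  have := discrim_le_zero h
  rw [discrim] at this
  linarith

theorem integral_norm_sq_eq_sum {ν : Measure (Fin m → ℝ)} {F : (Fin m → ℝ) → TensorVec m n}
    (hF : ∀ κ, Integrable (fun θ => F θ κ ^ 2) ν) :
    ∫ θ, ‖F θ‖ ^ 2 ∂ν = ∑ κ, ∫ θ, F θ κ ^ 2 ∂ν := by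
  rw [← integral_finsetSum _ fun κ _ => hF κ]
  simp only [EuclideanSpace.real_norm_sq_eq]

/-- The functional `Atilde` acting in the direction `i` is bounded in terms of the function, its
diagonal derivative and its restrictions to the adjacent faces. -/
theorem integral_functional_le (hτ : 0 ≤ τ)
    (Atilde : C(Icc (-τ) (0 : ℝ), Vec n) →L[ℝ] Vec n) (c : ι → ℝ) (ψ : ι → Fin m → C(ℝ, Vec n))
    {ψ' : ι → Fin m → ℝ → Vec n} (hψ : ∀ r a t, HasDerivAt (ψ r a) (ψ' r a t) t)
    (hψ' : ∀ r a, Continuous (ψ' r a)) {S : Finset (Fin m)} {i : Fin m} (hi : i ∈ S) :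
    ∫ θ, ‖sumTensor c (fun r => Function.update (fun a => (ψ r a : ℝ → Vec n)) i
        fun _ => Atilde ((ψ r i).restrict (Icc (-τ) (0 : ℝ)))) θ‖ ^ 2 ∂faceMeasure τ (S.erase i)
      ≤ n ^ (m + 1) * ‖Atilde‖ ^ 2 *
        (∑ a ∈ S, ∫ θ, ‖sumTensor c (fun r a => ψ r a) θ‖ ^ 2 ∂faceMeasure τ (S.erase a)
          + ∫ θ, ‖sumTensor c (fun r a => ψ r a) θ‖ ^ 2 ∂faceMeasure τ S
          + ∫ θ, ‖∑ a ∈ S, sumTensor c (fun r => Function.update (fun a => (ψ r a : ℝ → Vec n)) a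
              (ψ' r a)) θ‖ ^ 2 ∂faceMeasure τ S) := by
  set A := fun r => Atilde ((ψ r i).restrict (Icc (-τ) (0 : ℝ))) with hA
  set F := sumTensor c (fun r a => (ψ r a : ℝ → Vec n)) with hF
  set D := fun a => sumTensor c (fun r => Function.update (fun a => (ψ r a : ℝ → Vec n)) a
    (ψ' r a)) with hD
  set L := sumTensor c (fun r => Function.update (fun a => (ψ r a : ℝ → Vec n)) i
    fun _ => A r) with hL
  set W := ∑ a ∈ S, ∫ θ, ‖F θ‖ ^ 2 ∂faceMeasure τ (S.erase a) + ∫ θ, ‖F θ‖ ^ 2 ∂faceMeasure τ S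
    + ∫ θ, ‖∑ a ∈ S, D a θ‖ ^ 2 ∂faceMeasure τ S with hW
  have hψc : ∀ r a, Continuous (ψ r a : ℝ → Vec n) := fun r a => (ψ r a).continuous
  have hFc := continuous_sumTensor c hψc
  have hFκ := continuous_sumTensor_apply c hψc
  have hDc : ∀ a, Continuous (D a) := fun a => continuous_sumTensor c
    (continuous_update_fun hψc a fun r => hψ' r a)
  have hDκ : ∀ a κ, Continuous fun θ => D a θ κ := fun a => continuous_sumTensor_apply c
    (continuous_update_fun hψc a fun r => hψ' r a)
  have hLκ : ∀ κ, Continuous fun θ => L θ κ := continuous_sumTensor_apply c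
    (continuous_update_fun hψc i fun r => continuous_const)
  -- The bound is uniform in `s`. It is what replaces a pointwise bound of the function fed to
  -- `Atilde`.
  have hWκ : ∀ κ, ∀ s ∈ Icc (-τ) 0,
      ∫ θ, F (Function.update θ i s) κ ^ 2 ∂faceMeasure τ (S.erase i) ≤ W := by
    intro κ s hs
    refine (slice_le hτ hi (hFκ κ) (fun a => hDκ a κ)
      (fun a θ => hasDerivAt_sumTensor_apply c hψ a θ κ) hs).trans ?_
    have hle : ∀ v : TensorVec m n, v κ ^ 2 ≤ ‖v‖ ^ 2 := fun v => by
      rw [← sq_abs (v κ)]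
      exact pow_le_pow_left₀ (abs_nonneg _) (PiLp.norm_apply_le v κ) 2
    have hmono : ∀ (H : (Fin m → ℝ) → TensorVec m n) (S : Finset (Fin m)), Continuous H →
        ∫ θ, H θ κ ^ 2 ∂faceMeasure τ S ≤ ∫ θ, ‖H θ‖ ^ 2 ∂faceMeasure τ S := fun H S hH =>
      integral_mono (integrable_faceMeasure hτ _
        (((EuclideanSpace.proj (𝕜 := ℝ) κ).continuous.comp hH).pow 2))
        (integrable_faceMeasure hτ _ (hH.norm.pow 2)) fun θ => hle _
    refine add_le_add (add_le_add (Finset.sum_le_sum fun a _ => hmono F _ hFc) (hmono F _ hFc)) ?_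
    have := hmono (fun θ => ∑ a ∈ S, D a θ) S (continuous_finsetSum _ fun a _ => hDc a)
    simpa only [WithLp.ofLp_sum, Finset.sum_apply] using this
  have hW0 : 0 ≤ W := by positivity
  have key : ∀ κ : Fin m → Fin n,
      ∫ θ, L θ κ ^ 2 ∂faceMeasure τ (S.erase i) ≤ n * ‖Atilde‖ ^ 2 * W := by
    intro κ
    set ν := faceMeasure τ (S.erase i) with hν
    set V := ∫ θ, L θ κ ^ 2 ∂ν with hV
    set p := fun r (θ : Fin m → ℝ) => ∏ b ∈ Finset.univ.erase i, ψ r b (θ b) (κ b) with hp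
    have hpc : ∀ r, Continuous (p r) := fun r => continuous_finsetProd _ fun a _ =>
      (EuclideanSpace.proj (𝕜 := ℝ) (κ a)).continuous.comp ((hψc r a).comp (continuous_apply a))
    have hint : ∀ {h : (Fin m → ℝ) → ℝ}, Continuous h → Integrable h ν := fun hh =>
      integrable_faceMeasure hτ _ hh
    have hLp : ∀ θ, L θ κ = ∑ r, c r * (A r (κ i) * p r θ) := fun θ => by
      rw [hL, sumTensor_update_apply]
    have hLpi : ∀ r, Integrable (fun θ => L θ κ * p r θ) ν := fun r =>
      hint ((hLκ κ).mul (hpc r))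
    -- Duality: integrating the coordinate `L · κ` against the slices of `F` yields a single
    -- continuous function `χ` of the variable in direction `i`.
    set q := fun r => c r * ∫ θ, L θ κ * p r θ ∂ν with hq
    set χ : C(Icc (-τ) (0 : ℝ), Vec n) := ∑ r, q r • (ψ r i).restrict (Icc (-τ) (0 : ℝ)) with hχ
    -- By linearity `Atilde` may be taken out of the integral, which turns the slices of `F` back
    -- into `L`.
    have h1 : V = Atilde χ (κ i) := by
      have e : ∀ θ, L θ κ ^ 2 = ∑ r, (c r * A r (κ i)) * (L θ κ * p r θ) := fun θ => by
        rw [pow_two]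
        nth_rw 2 [hLp]
        rw [Finset.mul_sum]
        exact Finset.sum_congr rfl fun r _ => by ring
      rw [hV]
      simp only [e]
      rw [integral_finsetSum _ fun r _ => (hLpi r).const_mul _]
      simp only [integral_const_mul, hχ, map_sum, map_smul, WithLp.ofLp_sum, Finset.sum_apply,
        PiLp.smul_apply, smul_eq_mul, hq]
      exact Finset.sum_congr rfl fun r _ => by ring
    have hV0 : 0 ≤ V := integral_nonneg fun θ => sq_nonneg _
    -- At each `s`, Cauchy–Schwarz bounds each of the `n` coordinates of `χ s` by the norm of `L ·
    -- κ` and that of a slice of `F`.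
    have h2 : ‖χ‖ ≤ √(n * (V * W)) := by
      refine (ContinuousMap.norm_le _ (Real.sqrt_nonneg _)).2 fun s => Real.le_sqrt_of_sq_le ?_
      have hχs : ∀ d, χ s d = ∫ θ, L θ κ * F (Function.update θ i s) (Function.update κ i d) ∂ν := by
        intro d
        have e : ∀ θ, L θ κ * F (Function.update θ i s) (Function.update κ i d)
            = ∑ r, (c r * ψ r i s d) * (L θ κ * p r θ) := fun θ => by
          rw [hF, sumTensor_apply_update, Finset.mul_sum]
          exact Finset.sum_congr rfl fun r _ => by ring
        simp only [e]
        rw [integral_finsetSum _ fun r _ => (hLpi r).const_mul _]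
        simp only [integral_const_mul, hχ, ContinuousMap.coe_sum, Finset.sum_apply,
          ContinuousMap.coe_smul, Pi.smul_apply, WithLp.ofLp_sum, PiLp.smul_apply, smul_eq_mul, hq,
          ContinuousMap.restrict_apply]
        exact Finset.sum_congr rfl fun r _ => by ring
      rw [EuclideanSpace.real_norm_sq_eq]
      have hd : ∀ d, χ s d ^ 2 ≤ V * W := by
        intro d
        rw [hχs]
        have hFu : Continuous fun θ => F (Function.update θ i s) (Function.update κ i d) :=
          (hFκ _).comp (continuous_id.update i continuous_const)
        exact (sq_integral_mul_le (hint ((hLκ κ).pow 2)) (hint (hFu.pow 2))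
          (hint ((hLκ κ).mul hFu))).trans (mul_le_mul_of_nonneg_left (hWκ _ s s.2) hV0)
      calc _ ≤ ∑ _d : Fin n, V * W := Finset.sum_le_sum fun d _ => hd d
        _ = _ := by simp
    have h3 : V ≤ ‖Atilde‖ * √(n * (V * W)) := by
      rw [h1]
      calc Atilde χ (κ i) ≤ ‖Atilde χ (κ i)‖ := Real.le_norm_self _
        _ ≤ ‖Atilde χ‖ := PiLp.norm_apply_le _ _
        _ ≤ ‖Atilde‖ * ‖χ‖ := Atilde.le_opNorm _
        _ ≤ _ := by rw [← h1]; gcongr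
    -- The estimate of `V` contains `V` itself under a root; squaring and cancelling one factor
    -- closes the argument.
    have h4 : V ^ 2 ≤ V * (n * ‖Atilde‖ ^ 2 * W) := by
      calc V ^ 2 ≤ (‖Atilde‖ * √(n * (V * W))) ^ 2 := pow_le_pow_left₀ hV0 h3 2
        _ = _ := by rw [mul_pow, Real.sq_sqrt (by positivity)]; ring
    rcases hV0.eq_or_lt with h | h
    · rw [← h]; positivity
    · rw [pow_two] at h4; exact le_of_mul_le_mul_left h4 h
  rw [integral_norm_sq_eq_sum fun κ => integrable_faceMeasure hτ _ ((hLκ κ).pow 2)]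
  -- There are `n ^ m` coordinates, which gives the power `m + 1` together with the factor `n`
  -- above.
  calc _ ≤ ∑ _κ : Fin m → Fin n, n * ‖Atilde‖ ^ 2 * W := Finset.sum_le_sum fun κ _ => key κ
    _ = _ := by simp; ring

end SliceEstimates

/-! ### Smooth decomposable triples and the compound on a face -/

section Core

variable {m n : ℕ} {τ : ℝ}

theorem lp_norm_sq_eq_integral {α F : Type*} [MeasurableSpace α] {μ : Measure α}
    [NormedAddCommGroup F] [InnerProductSpace ℝ F] (f : Lp F 2 μ) :
    ‖f‖ ^ 2 = ∫ x, ‖f x‖ ^ 2 ∂μ := by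
  rw [← real_inner_self_eq_norm_sq, L2.inner_def]
  simp only [real_inner_self_eq_norm_sq]

theorem faceMeasure_absolutelyContinuous (τ : ℝ) (S : Finset (Fin m)) :
    faceMeasure τ S ≪ Measure.pi fun _ : Fin m => delayMeasure τ :=
  Measure.absolutelyContinuous_of_le (faceMeasure_le τ S)

theorem norm_sq_eq_sum_faces (Φ : TensorSpace m n τ) :
    ‖Φ‖ ^ 2 = ∑ S : Finset (Fin m), ∫ θ, ‖Φ θ‖ ^ 2 ∂faceMeasure τ S := by
  have h : Integrable (fun θ => ‖Φ θ‖ ^ 2) (Measure.pi fun _ : Fin m => delayMeasure τ) :=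
    (memLp_two_iff_integrable_sq_norm (Lp.aestronglyMeasurable Φ)).1 (Lp.memLp Φ)
  rw [lp_norm_sq_eq_integral, ← integral_finsetSum_measure fun S _ => h.mono_measure
    (faceMeasure_le τ S), ← pi_delayMeasure]

/-- The space of families of square integrable functions on the faces. -/
abbrev FaceFamily (m n : ℕ) (τ : ℝ) : Type :=
  (S : Finset (Fin m)) → Lp (TensorVec m n) 2 (faceMeasure τ S)

/-- The function of the action of the delay operator on a smooth function. -/
noncomputable def delayValue (Atilde : C(Icc (-τ) (0 : ℝ), Vec n) →L[ℝ] Vec n) (ψ : C(ℝ, Vec n))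
    (ψ' : ℝ → Vec n) (s : ℝ) : Vec n :=
  if s = 0 then Atilde (ψ.restrict (Icc (-τ) (0 : ℝ))) else ψ' s

/-- Decomposable tensors of smooth functions in the domain of the delay operator, with the values of
the additive compound and with the diagonal derivatives on all faces. -/
def pureTriples (m : ℕ) (Atilde : C(Icc (-τ) (0 : ℝ), Vec n) →L[ℝ] Vec n) :
    Set ((TensorSpace m n τ × TensorSpace m n τ) × FaceFamily m n τ) :=
  {x | ∃ (φ ξ ζ : Fin m → HSpace n τ) (ψ : Fin m → C(ℝ, Vec n)) (ψ' : Fin m → ℝ → Vec n),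
    (∀ a, (φ a, ξ a) ∈ delayOperator Atilde) ∧ (∀ a, (ξ a, ζ a) ∈ delayOperator Atilde) ∧
    (∀ a, SmoothPair Atilde (φ a) (ξ a) (ψ a) (ψ' a)) ∧
    x.1 = (tensor φ, ∑ a, tensor (Function.update φ a (ξ a))) ∧
    ∀ S, x.2 S =ᵐ[faceMeasure τ S] fun θ => ∑ a ∈ S, tensorVec fun b =>
      Function.update (fun b => (ψ b : ℝ → Vec n)) a (ψ' a) b (θ b)}

/-- The linear span of the decomposable smooth triples. -/
noncomputable def coreTriples (m : ℕ) (Atilde : C(Icc (-τ) (0 : ℝ), Vec n) →L[ℝ] Vec n) :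
    Submodule ℝ ((TensorSpace m n τ × TensorSpace m n τ) × FaceFamily m n τ) :=
  Submodule.span ℝ (pureTriples m Atilde)

theorem continuous_tensorVec {f : Fin m → ℝ → Vec n} (hf : ∀ a, Continuous (f a)) :
    Continuous fun θ : Fin m → ℝ => tensorVec fun a => f a (θ a) := by
  have := continuous_sumTensor (fun _ : Unit => (1 : ℝ)) (ψ := fun _ => f) fun _ => hf
  have e : sumTensor (fun _ : Unit => (1 : ℝ)) (fun _ => f)
      = fun θ : Fin m → ℝ => tensorVec fun a => f a (θ a) := by
    funext θ; simp [sumTensor]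
  rwa [e] at this

theorem memLp_faceMeasure (hτ : 0 ≤ τ) (S : Finset (Fin m)) {f : (Fin m → ℝ) → TensorVec m n}
    (hf : Continuous f) : MemLp f 2 (faceMeasure τ S) :=
  (memLp_two_iff_integrable_sq_norm hf.aestronglyMeasurable).2
    (integrable_faceMeasure hτ S (hf.norm.pow 2))

theorem exists_mem_pureTriples (hτ : 0 < τ) {Atilde : C(Icc (-τ) (0 : ℝ), Vec n) →L[ℝ] Vec n}
    {φ ξ ζ : Fin m → HSpace n τ} (h1 : ∀ a, (φ a, ξ a) ∈ delayOperator Atilde)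
    (h2 : ∀ a, (ξ a, ζ a) ∈ delayOperator Atilde) :
    ∃ g, ((tensor φ, ∑ a, tensor (Function.update φ a (ξ a))), g) ∈ pureTriples m Atilde := by
  choose ψ ψ' hψ using fun a => exists_smoothPair hτ (h1 a) (h2 a)
  have hc : ∀ S : Finset (Fin m), Continuous fun θ : Fin m → ℝ => ∑ a ∈ S, tensorVec fun b =>
      Function.update (fun b => (ψ b : ℝ → Vec n)) a (ψ' a) b (θ b) := fun S =>
    continuous_finsetSum _ fun a _ => continuous_tensorVec
      (continuous_update_fun (ι := Unit) (ψ := fun _ b => (ψ b : ℝ → Vec n))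
        (fun _ b => (ψ b).continuous) a (u := fun _ => ψ' a) (fun _ => (hψ a).continuous_deriv) ())
  exact ⟨fun S => (memLp_faceMeasure hτ.le S (hc S)).toLp _, φ, ξ, ζ, ψ, ψ', h1, h2, hψ, rfl,
    fun S => (memLp_faceMeasure hτ.le S (hc S)).coeFn_toLp⟩

/-- Representation of the elements of the core by continuously differentiable functions. -/
theorem exists_rep_of_mem_coreTriples {Atilde : C(Icc (-τ) (0 : ℝ), Vec n) →L[ℝ] Vec n}
    {x : (TensorSpace m n τ × TensorSpace m n τ) × FaceFamily m n τ}
    (hx : x ∈ coreTriples m Atilde) :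
    ∃ (N : ℕ) (c : Fin N → ℝ) (ψ : Fin N → Fin m → C(ℝ, Vec n)) (ψ' : Fin N → Fin m → ℝ → Vec n),
      (∀ r a t, HasDerivAt (ψ r a) (ψ' r a t) t) ∧ (∀ r a, Continuous (ψ' r a)) ∧
      (x.1.1 =ᵐ[Measure.pi fun _ : Fin m => delayMeasure τ] sumTensor c fun r a => ψ r a) ∧
      (x.1.2 =ᵐ[Measure.pi fun _ : Fin m => delayMeasure τ] fun θ => ∑ a, sumTensor c
        (fun r => Function.update (fun a => (ψ r a : ℝ → Vec n)) a
          (delayValue Atilde (ψ r a) (ψ' r a))) θ) ∧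
      ∀ S, x.2 S =ᵐ[faceMeasure τ S] fun θ => ∑ a ∈ S, sumTensor c
        (fun r => Function.update (fun a => (ψ r a : ℝ → Vec n)) a (ψ' r a)) θ := by
  obtain ⟨N, c, y, rfl⟩ := (Submodule.mem_span_set').1 hx
  choose φ ξ ζ ψ ψ' h1 h2 hs he hg using fun r => (y r).2
  refine ⟨N, c, ψ, ψ', fun r a => (hs r a).hasDerivAt, fun r a => (hs r a).continuous_deriv,
    ?_, ?_, fun S => ?_⟩
  · have e : (∑ r, c r • (y r : (TensorSpace m n τ × TensorSpace m n τ) × FaceFamily m n τ)).1.1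
        = ∑ r, c r • tensor (φ r) := by
      simp [Prod.fst_sum, he]
    rw [e]
    have h3 := fun r => tensor_ae_eq fun a => (hs r a).fst_ae_eq
    have h4 := fun r => Lp.coeFn_smul (c r) (tensor (φ r))
    filter_upwards [Lp.coeFn_finsetSum Finset.univ fun r => c r • tensor (φ r),
      ae_all_iff.2 h3, ae_all_iff.2 h4] with θ e1 e2 e3
    rw [e1]
    simp [sumTensor, e2, e3]
  · have e : (∑ r, c r • (y r : (TensorSpace m n τ × TensorSpace m n τ) × FaceFamily m n τ)).1.2
        = ∑ p : Fin N × Fin m, c p.1 • tensor (Function.update (φ p.1) p.2 (ξ p.1 p.2)) := by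
      simp [Prod.fst_sum, Prod.snd_sum, he, Fintype.sum_prod_type, Finset.smul_sum]
    rw [e]
    have h3 := fun p : Fin N × Fin m =>
      tensor_ae_eq (φ := Function.update (φ p.1) p.2 (ξ p.1 p.2))
        (f := Function.update (fun b => (ψ p.1 b : ℝ → Vec n)) p.2
          (delayValue Atilde (ψ p.1 p.2) (ψ' p.1 p.2))) fun b => by
        by_cases hb : b = p.2
        · subst hb
          rw [Function.update_self, Function.update_self]
          exact (hs p.1 p.2).snd_ae_eq
        · simpa [Function.update_of_ne hb] using (hs p.1 b).fst_ae_eq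
    have h4 := fun p : Fin N × Fin m =>
      Lp.coeFn_smul (c p.1) (tensor (Function.update (φ p.1) p.2 (ξ p.1 p.2)))
    filter_upwards [Lp.coeFn_finsetSum Finset.univ fun p : Fin N × Fin m =>
      c p.1 • tensor (Function.update (φ p.1) p.2 (ξ p.1 p.2)),
      ae_all_iff.2 h3, ae_all_iff.2 h4] with θ e1 e2 e3
    rw [e1]
    simp only [Finset.sum_apply, e3, Pi.smul_apply, e2, Fintype.sum_prod_type, sumTensor]
    rw [Finset.sum_comm]
  · have e : (∑ r, c r • (y r : (TensorSpace m n τ × TensorSpace m n τ) × FaceFamily m n τ)).2 S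
        = ∑ r, c r • (y r).1.2 S := by
      simp [Prod.snd_sum]
    rw [e]
    have h4 := fun r => Lp.coeFn_smul (c r) ((y r).1.2 S)
    filter_upwards [Lp.coeFn_finsetSum Finset.univ fun r => c r • (y r).1.2 S,
      ae_all_iff.2 fun r => hg r S, ae_all_iff.2 h4] with θ e1 e2 e3
    rw [e1]
    simp only [Finset.sum_apply, e3, Pi.smul_apply, e2, sumTensor, Finset.smul_sum]
    rw [Finset.sum_comm]

/-- This decides almost everywhere on a face which branch of `delayValue` is taken in each
direction: the derivative in the free ones, `Atilde` in the others. -/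
theorem faceMeasure_ae (τ : ℝ) (S : Finset (Fin m)) :
    ∀ᵐ θ ∂faceMeasure τ S, ∀ a, (a ∈ S → θ a ≠ 0) ∧ (a ∉ S → θ a = 0) := by
  refine ae_all_iff.2 fun a => ?_
  have h : ∀ᵐ s ∂faceCoord τ S a, (a ∈ S → s ≠ 0) ∧ (a ∉ S → s = 0) := by
    by_cases ha : a ∈ S
    · simp only [faceCoord, ha, if_true, true_imp_iff, not_true, false_imp_iff, and_true]
      exact ae_restrict_of_ae (Measure.ae_ne volume 0)
    · simp only [faceCoord, ha, if_false, false_imp_iff, not_false_iff, true_imp_iff, true_and]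
      exact (ae_dirac_iff (measurableSet_singleton (0 : ℝ))).2 rfl
  exact (Measure.quasiMeasurePreserving_eval (faceCoord τ S) a).ae h

theorem sumTensor_update_congr {ι : Type*} [Fintype ι] (c : ι → ℝ) (ψ : ι → Fin m → ℝ → Vec n)
    (a : Fin m) {u v : ι → ℝ → Vec n} {θ : Fin m → ℝ} (h : ∀ r, u r (θ a) = v r (θ a)) :
    sumTensor c (fun r => Function.update (ψ r) a (u r)) θ
      = sumTensor c (fun r => Function.update (ψ r) a (v r)) θ := by
  ext κ
  rw [sumTensor_update_apply, sumTensor_update_apply]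
  simp only [h]

/-- Cauchy–Schwarz for at most `m + 1` summands. -/
theorem norm_add_sum_sq_le {F : Type*} [NormedAddCommGroup F] (T : Finset (Fin m)) (v : F)
    (w : Fin m → F) :
    ‖v + ∑ i ∈ T, w i‖ ^ 2 ≤ (m + 1) * (‖v‖ ^ 2 + ∑ i ∈ T, ‖w i‖ ^ 2) := by
  have h1 : ‖v + ∑ i ∈ T, w i‖ ≤ ‖v‖ + ∑ i ∈ T, ‖w i‖ :=
    (norm_add_le _ _).trans (add_le_add le_rfl (norm_sum_le _ _))
  have h2 : (∑ i ∈ T, ‖w i‖) ^ 2 ≤ m * ∑ i ∈ T, ‖w i‖ ^ 2 := by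
    refine (sq_sum_le_card_mul_sum_sq).trans ?_
    have : (T.card : ℝ) ≤ m := by exact_mod_cast (by simpa using T.card_le_univ)
    gcongr
  have h0 : 0 ≤ ∑ i ∈ T, ‖w i‖ := by positivity
  have h00 : 0 ≤ ∑ i ∈ T, ‖w i‖ ^ 2 := by positivity
  have h3 : ‖v + ∑ i ∈ T, w i‖ ^ 2 ≤ (‖v‖ + ∑ i ∈ T, ‖w i‖) ^ 2 :=
    pow_le_pow_left₀ (norm_nonneg _) h1 2
  rcases Nat.eq_zero_or_pos m with hm | hm
  · subst hm
    have : T = ∅ := Subsingleton.elim _ _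
    subst this
    simp
  · have hm' : (1 : ℝ) ≤ m := by exact_mod_cast hm
    have hm0 : (0 : ℝ) < m := by linarith
    -- The weight `m` balances one summand against up to `m` others, so that both squares receive
    -- the constant `m + 1`.
    have h4 : 2 * ‖v‖ * ∑ i ∈ T, ‖w i‖ ≤ m * ‖v‖ ^ 2 + (∑ i ∈ T, ‖w i‖) ^ 2 / m := by
      have := sq_nonneg (m * ‖v‖ - ∑ i ∈ T, ‖w i‖)
      have h5 : 2 * ‖v‖ * ∑ i ∈ T, ‖w i‖ ≤ (m ^ 2 * ‖v‖ ^ 2 + (∑ i ∈ T, ‖w i‖) ^ 2) / m := by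
        rw [le_div_iff₀ hm0]; nlinarith
      calc _ ≤ _ := h5
        _ = _ := by field_simp
    have h6 : (∑ i ∈ T, ‖w i‖) ^ 2 / m ≤ ∑ i ∈ T, ‖w i‖ ^ 2 := by
      rw [div_le_iff₀ hm0]; linarith
    nlinarith

/-- The relation between the additive compound and the diagonal derivative on a face: each of them is
bounded by the other one, up to the diagonal derivatives on the adjacent faces of higher
dimension. -/
theorem core_bounds (hτ : 0 ≤ τ) {Atilde : C(Icc (-τ) (0 : ℝ), Vec n) →L[ℝ] Vec n}
    {x : (TensorSpace m n τ × TensorSpace m n τ) × FaceFamily m n τ}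
    (hx : x ∈ coreTriples m Atilde) (J : Finset (Fin m)) :
    ‖x.2 J‖ ^ 2 ≤ (m + 1) * (∫ θ, ‖x.1.2 θ‖ ^ 2 ∂faceMeasure τ J + ∑ i ∈ Jᶜ,
        n ^ (m + 1) * ‖Atilde‖ ^ 2 * ((m + 1) * ‖x.1.1‖ ^ 2 + ‖x.2 (insert i J)‖ ^ 2)) ∧
    ∫ θ, ‖x.1.2 θ‖ ^ 2 ∂faceMeasure τ J ≤ (m + 1) * (‖x.2 J‖ ^ 2 + ∑ i ∈ Jᶜ,
        n ^ (m + 1) * ‖Atilde‖ ^ 2 * ((m + 1) * ‖x.1.1‖ ^ 2 + ‖x.2 (insert i J)‖ ^ 2)) := by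
  obtain ⟨N, c, ψ, ψ', hψ, hψ', hΦ, hΨ, hg⟩ := exists_rep_of_mem_coreTriples hx
  set F := sumTensor c (fun r a => (ψ r a : ℝ → Vec n)) with hF
  set D := fun a => sumTensor c (fun r => Function.update (fun a => (ψ r a : ℝ → Vec n)) a
    (ψ' r a)) with hD
  set L := fun i => sumTensor c (fun r => Function.update (fun a => (ψ r a : ℝ → Vec n)) i
    fun _ => Atilde ((ψ r i).restrict (Icc (-τ) (0 : ℝ)))) with hL
  have hψc : ∀ r a, Continuous (ψ r a : ℝ → Vec n) := fun r a => (ψ r a).continuous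
  have hDc : ∀ a, Continuous (D a) := fun a => continuous_sumTensor c
    (continuous_update_fun hψc a fun r => hψ' r a)
  have hLc : ∀ i, Continuous (L i) := fun i => continuous_sumTensor c
    (continuous_update_fun hψc i fun r => continuous_const)
  have hgJ : ∀ S, ‖x.2 S‖ ^ 2 = ∫ θ, ‖∑ a ∈ S, D a θ‖ ^ 2 ∂faceMeasure τ S := fun S => by
    rw [lp_norm_sq_eq_integral]
    refine integral_congr_ae ?_
    filter_upwards [hg S] with θ hθ
    rw [hθ]
  have hQ : ∀ S, ∫ θ, ‖F θ‖ ^ 2 ∂faceMeasure τ S ≤ ‖x.1.1‖ ^ 2 := fun S => by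
    have e : ∫ θ, ‖F θ‖ ^ 2 ∂faceMeasure τ S = ∫ θ, ‖x.1.1 θ‖ ^ 2 ∂faceMeasure τ S := by
      refine integral_congr_ae ?_
      filter_upwards [(faceMeasure_absolutelyContinuous τ S).ae_eq hΦ] with θ hθ
      rw [hθ]
    rw [e, norm_sq_eq_sum_faces x.1.1]
    exact Finset.single_le_sum (f := fun S => ∫ θ, ‖x.1.1 θ‖ ^ 2 ∂faceMeasure τ S)
      (fun S _ => integral_nonneg fun θ => by positivity) (Finset.mem_univ S)
  have hLb : ∀ i ∈ Jᶜ, ∫ θ, ‖L i θ‖ ^ 2 ∂faceMeasure τ J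
      ≤ n ^ (m + 1) * ‖Atilde‖ ^ 2 * ((m + 1) * ‖x.1.1‖ ^ 2 + ‖x.2 (insert i J)‖ ^ 2) := by
    intro i hi
    have hi' := Finset.mem_compl.1 hi
    -- The functional in direction `i` on the face `J` sees the face `insert i J`, whose dimension
    -- is larger by one.
    have h := integral_functional_le hτ Atilde c ψ hψ hψ' (Finset.mem_insert_self i J)
    rw [Finset.erase_insert hi'] at h
    refine h.trans ?_
    rw [hgJ]
    refine mul_le_mul_of_nonneg_left (add_le_add ?_ le_rfl) (by positivity)
    -- At most `m` adjacent faces; with the face `insert i J` itself this makes the factor `m + 1`.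
    have h1 : ∑ a ∈ insert i J, ∫ θ, ‖F θ‖ ^ 2 ∂faceMeasure τ ((insert i J).erase a)
        ≤ m * ‖x.1.1‖ ^ 2 := by
      refine (Finset.sum_le_sum fun a _ => hQ _).trans ?_
      rw [Finset.sum_const, nsmul_eq_mul]
      have : ((insert i J).card : ℝ) ≤ m := by
        exact_mod_cast (by simpa using (insert i J).card_le_univ)
      gcongr
    have h2 := hQ (insert i J)
    linarith
  -- The structural identity: on a face the compound is the diagonal derivative plus the
  -- contributions of `Atilde` in the fixed directions.
  have hdec : x.1.2 =ᵐ[faceMeasure τ J] fun θ => ∑ a ∈ J, D a θ + ∑ i ∈ Jᶜ, L i θ := by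
    filter_upwards [(faceMeasure_absolutelyContinuous τ J).ae_eq hΨ, faceMeasure_ae τ J]
      with θ h1 h2
    rw [h1, ← Finset.sum_add_sum_compl J]
    congr 1
    · refine Finset.sum_congr rfl fun a ha => sumTensor_update_congr c _ a fun r => ?_
      simp [delayValue, (h2 a).1 ha]
    · refine Finset.sum_congr rfl fun a ha => sumTensor_update_congr c _ a fun r => ?_
      simp [delayValue, (h2 a).2 (Finset.mem_compl.1 ha)]
  have hPc : Continuous fun θ => ∑ a ∈ J, D a θ := continuous_finsetSum _ fun a _ => hDc a
  have hRc : Continuous fun θ => ∑ i ∈ Jᶜ, L i θ := continuous_finsetSum _ fun a _ => hLc a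
  have hn2 : ∀ {H : (Fin m → ℝ) → TensorVec m n}, Continuous H →
      Integrable (fun θ => ‖H θ‖ ^ 2) (faceMeasure τ J) := fun hH =>
    integrable_faceMeasure hτ J (hH.norm.pow 2)
  have hΨ2 : ∫ θ, ‖x.1.2 θ‖ ^ 2 ∂faceMeasure τ J
      = ∫ θ, ‖∑ a ∈ J, D a θ + ∑ i ∈ Jᶜ, L i θ‖ ^ 2 ∂faceMeasure τ J := by
    refine integral_congr_ae ?_
    filter_upwards [hdec] with θ hθ
    rw [hθ]
  have hsum : ∀ {H : (Fin m → ℝ) → TensorVec m n}, Continuous H →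
      ∫ θ, (m + 1) * (‖H θ‖ ^ 2 + ∑ i ∈ Jᶜ, ‖L i θ‖ ^ 2) ∂faceMeasure τ J
        = (m + 1) * (∫ θ, ‖H θ‖ ^ 2 ∂faceMeasure τ J
          + ∑ i ∈ Jᶜ, ∫ θ, ‖L i θ‖ ^ 2 ∂faceMeasure τ J) := fun hH => by
    rw [integral_const_mul, integral_add (hn2 hH) (integrable_finsetSum _ fun i _ => hn2 (hLc i)),
      integral_finsetSum _ fun i _ => hn2 (hLc i)]
  have hbi : ∀ {H : (Fin m → ℝ) → TensorVec m n}, Continuous H →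
      Integrable (fun θ => (m + 1) * (‖H θ‖ ^ 2 + ∑ i ∈ Jᶜ, ‖L i θ‖ ^ 2)) (faceMeasure τ J) :=
    fun hH => ((hn2 hH).add (integrable_finsetSum _ fun i _ => hn2 (hLc i))).const_mul _
  constructor
  · rw [hgJ, hΨ2]
    refine (integral_mono (hn2 hPc) (hbi (hPc.add hRc)) fun θ => ?_).trans ((hsum
      (hPc.add hRc)).trans_le ?_)
    · have := norm_add_sum_sq_le Jᶜ (∑ a ∈ J, D a θ + ∑ i ∈ Jᶜ, L i θ) (fun i => -L i θ)
      simpa [Finset.sum_neg_distrib] using this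
    · exact mul_le_mul_of_nonneg_left (add_le_add le_rfl (Finset.sum_le_sum hLb)) (by positivity)
  · rw [hgJ, hΨ2]
    refine (integral_mono (hn2 (hPc.add hRc)) (hbi hPc) fun θ => ?_).trans ((hsum
      hPc).trans_le ?_)
    · exact norm_add_sum_sq_le Jᶜ (∑ a ∈ J, D a θ) (fun i => L i θ)
    · exact mul_le_mul_of_nonneg_left (add_le_add le_rfl (Finset.sum_le_sum hLb)) (by positivity)

end Core

/-! ### A priori bounds and the closure of the core -/

section GraphClosure

variable {m n : ℕ} {τ : ℝ}

/-- The diagonal derivatives on all faces are bounded by the graph norm. -/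
theorem exists_bound_of_mem_coreTriples (hτ : 0 ≤ τ) (m : ℕ)
    (Atilde : C(Icc (-τ) (0 : ℝ), Vec n) →L[ℝ] Vec n) :
    ∃ C : ℝ, 0 ≤ C ∧ ∀ x ∈ coreTriples m Atilde, ∀ J,
      ‖x.2 J‖ ^ 2 ≤ C * (‖x.1.1‖ ^ 2 + ‖x.1.2‖ ^ 2) := by
  -- Induction on the codimension of the face. On the top face there are no `Atilde` terms, and each
  -- step involves only faces of smaller codimension.
  have key : ∀ k : ℕ, ∃ C : ℝ, 0 ≤ C ∧ ∀ x ∈ coreTriples m Atilde, ∀ J : Finset (Fin m),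
      Jᶜ.card ≤ k → ‖x.2 J‖ ^ 2 ≤ C * (‖x.1.1‖ ^ 2 + ‖x.1.2‖ ^ 2) := by
    intro k
    set B : ℝ := n ^ (m + 1) * ‖Atilde‖ ^ 2 with hB
    have hB0 : 0 ≤ B := by positivity
    have hface : ∀ (Ψ : TensorSpace m n τ) J, ∫ θ, ‖Ψ θ‖ ^ 2 ∂faceMeasure τ J ≤ ‖Ψ‖ ^ 2 := by
      intro Ψ J
      rw [norm_sq_eq_sum_faces Ψ]
      exact Finset.single_le_sum (f := fun S => ∫ θ, ‖Ψ θ‖ ^ 2 ∂faceMeasure τ S)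
        (fun S _ => integral_nonneg fun θ => by positivity) (Finset.mem_univ J)
    induction k with
    | zero =>
      refine ⟨m + 1, by positivity, fun x hx J hJ => ?_⟩
      have h := (core_bounds hτ hx J).1
      rw [Finset.card_eq_zero.1 (Nat.le_zero.1 hJ), Finset.sum_empty, add_zero] at h
      refine h.trans (mul_le_mul_of_nonneg_left ?_ (by positivity))
      have := hface x.1.2 J
      have := sq_nonneg ‖x.1.1‖
      linarith
    | succ k ih =>
      obtain ⟨C, hC, ih⟩ := ih
      refine ⟨(m + 1) * (1 + m * (B * ((m + 1) + C))), by positivity, fun x hx J hJ => ?_⟩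
      refine (core_bounds hτ hx J).1.trans ?_
      rw [mul_assoc]
      refine mul_le_mul_of_nonneg_left ?_ (by positivity)
      set E := ‖x.1.1‖ ^ 2 + ‖x.1.2‖ ^ 2 with hE
      have hE1 : ‖x.1.1‖ ^ 2 ≤ E := by rw [hE]; linarith [sq_nonneg ‖x.1.2‖]
      have hE2 : ∫ θ, ‖x.1.2 θ‖ ^ 2 ∂faceMeasure τ J ≤ E :=
        (hface _ _).trans (by rw [hE]; linarith [sq_nonneg ‖x.1.1‖])
      have hE0 : 0 ≤ E := by positivity
      have h1 : ∀ i ∈ Jᶜ, B * ((m + 1) * ‖x.1.1‖ ^ 2 + ‖x.2 (insert i J)‖ ^ 2)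
          ≤ B * (((m + 1) + C) * E) := by
        intro i hi
        refine mul_le_mul_of_nonneg_left ?_ hB0
        have h2 := ih x hx (insert i J) (by
          rw [Finset.compl_insert, Finset.card_erase_of_mem hi]; omega)
        rw [add_mul ((m : ℝ) + 1)]
        exact add_le_add (mul_le_mul_of_nonneg_left hE1 (by positivity)) h2
      have h3 := Finset.sum_le_sum h1
      rw [Finset.sum_const, nsmul_eq_mul] at h3
      have h4 : (Jᶜ.card : ℝ) * (B * (((m + 1) + C) * E)) ≤ m * (B * (((m + 1) + C) * E)) := by
        have : (Jᶜ.card : ℝ) ≤ m := by exact_mod_cast (by simpa using Jᶜ.card_le_univ)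
        gcongr
      linarith
  obtain ⟨C, hC, h⟩ := key m
  exact ⟨C, hC, fun x hx J => h x hx J (by simpa using Jᶜ.card_le_univ)⟩

/-- The graph norm is bounded by the norms of the function and its diagonal derivatives on all
faces. -/
theorem exists_lower_bound_of_mem_coreTriples (hτ : 0 ≤ τ) (m : ℕ)
    (Atilde : C(Icc (-τ) (0 : ℝ), Vec n) →L[ℝ] Vec n) :
    ∃ C : ℝ, 0 ≤ C ∧ ∀ x ∈ coreTriples m Atilde,
      ‖x.1.2‖ ^ 2 ≤ C * (‖x.1.1‖ ^ 2 + ∑ J, ‖x.2 J‖ ^ 2) := by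
  set B : ℝ := n ^ (m + 1) * ‖Atilde‖ ^ 2 with hB
  have hB0 : 0 ≤ B := by positivity
  -- The squared norm is a sum over `2 ^ m` faces, each estimated by the second half of
  -- `core_bounds`.
  refine ⟨2 ^ m * ((m + 1) * (1 + m * (B * ((m + 1) + 1)))), by positivity, fun x hx => ?_⟩
  rw [norm_sq_eq_sum_faces x.1.2]
  set E := ‖x.1.1‖ ^ 2 + ∑ J, ‖x.2 J‖ ^ 2 with hE
  have hs0 : 0 ≤ ∑ J, ‖x.2 J‖ ^ 2 := by positivity
  have hE1 : ‖x.1.1‖ ^ 2 ≤ E := by rw [hE]; linarith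
  have hE2 : ∀ J, ‖x.2 J‖ ^ 2 ≤ E := fun J => by
    have := Finset.single_le_sum (f := fun J => ‖x.2 J‖ ^ 2) (fun S _ => by positivity)
      (Finset.mem_univ J)
    rw [hE]; linarith [sq_nonneg ‖x.1.1‖]
  have hE0 : 0 ≤ E := by positivity
  have h : ∀ J ∈ (Finset.univ : Finset (Finset (Fin m))), ∫ θ, ‖x.1.2 θ‖ ^ 2 ∂faceMeasure τ J
      ≤ ((m + 1) * (1 + m * (B * ((m + 1) + 1)))) * E := by
    intro J _
    refine (core_bounds hτ hx J).2.trans ?_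
    rw [mul_assoc]
    refine mul_le_mul_of_nonneg_left ?_ (by positivity)
    have h1 : ∀ i ∈ Jᶜ, B * ((m + 1) * ‖x.1.1‖ ^ 2 + ‖x.2 (insert i J)‖ ^ 2)
        ≤ B * (((m + 1) + 1) * E) := by
      intro i hi
      refine mul_le_mul_of_nonneg_left ?_ hB0
      have h2 := hE2 (insert i J)
      rw [add_mul ((m : ℝ) + 1), one_mul]
      exact add_le_add (mul_le_mul_of_nonneg_left hE1 (by positivity)) h2
    have h3 := Finset.sum_le_sum h1
    rw [Finset.sum_const, nsmul_eq_mul] at h3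
    have h4 : (Jᶜ.card : ℝ) * (B * (((m + 1) + 1) * E)) ≤ m * (B * (((m + 1) + 1) * E)) := by
      have : (Jᶜ.card : ℝ) ≤ m := by exact_mod_cast (by simpa using Jᶜ.card_le_univ)
      gcongr
    have h5 := hE2 J
    linarith
  refine (Finset.sum_le_sum h).trans (le_of_eq ?_)
  simp [mul_assoc]

/-- The bound makes `M` the graph of a bounded map over its first projection, so convergence of the
first components forces the second ones to be Cauchy. -/
theorem exists_mem_closure_of_fst_mem_closure {Y Z : Type*} [NormedAddCommGroup Y]
    [NormedSpace ℝ Y] [NormedAddCommGroup Z] [NormedSpace ℝ Z] [CompleteSpace Z]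
    {M : Submodule ℝ (Y × Z)} {C : ℝ} (hC : ∀ x ∈ M, ‖x.2‖ ≤ C * ‖x.1‖) {y : Y}
    (hy : y ∈ closure (Prod.fst '' (M : Set (Y × Z)))) :
    ∃ z, (y, z) ∈ closure (M : Set (Y × Z)) := by
  obtain ⟨u, hu, hlim⟩ := mem_closure_iff_seq_limit.1 hy
  choose x hx hxu using hu
  have hcau : CauchySeq fun k => (x k).2 := by
    have h1 : CauchySeq fun k => C • u k := (hlim.const_smul C).cauchySeq
    rw [Metric.cauchySeq_iff] at h1 ⊢
    intro ε hε
    obtain ⟨K, hK⟩ := h1 ε hε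
    refine ⟨K, fun k hk l hl => lt_of_le_of_lt ?_ (hK k hk l hl)⟩
    rw [dist_eq_norm, dist_eq_norm, ← smul_sub, norm_smul, ← hxu, ← hxu]
    exact (hC _ (M.sub_mem (hx k) (hx l))).trans
      (mul_le_mul_of_nonneg_right (Real.le_norm_self C) (norm_nonneg _))
  obtain ⟨z, hz⟩ := cauchySeq_tendsto_of_complete hcau
  refine ⟨z, mem_closure_of_tendsto (hlim.prodMk_nhds hz) (Eventually.of_forall fun k => ?_)⟩
  rw [← hxu]
  exact hx k

theorem norm_le_of_mem_coreTriples (hτ : 0 ≤ τ) (m : ℕ)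
    (Atilde : C(Icc (-τ) (0 : ℝ), Vec n) →L[ℝ] Vec n) :
    ∃ C : ℝ, ∀ x ∈ coreTriples m Atilde, ‖x.2‖ ≤ C * ‖x.1‖ := by
  obtain ⟨C, hC, h⟩ := exists_bound_of_mem_coreTriples hτ m Atilde
  refine ⟨√(C * 2), fun x hx => ?_⟩
  refine (pi_norm_le_iff_of_nonneg (by positivity)).2 fun J => ?_
  refine abs_le_of_sq_le_sq' ?_ (by positivity) |>.2
  rw [mul_pow, Real.sq_sqrt (by positivity), mul_assoc]
  refine (h x hx J).trans (mul_le_mul_of_nonneg_left ?_ hC)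
  have h1 : ‖x.1.1‖ ^ 2 ≤ ‖x.1‖ ^ 2 := pow_le_pow_left₀ (norm_nonneg _) (norm_fst_le x.1) 2
  have h2 : ‖x.1.2‖ ^ 2 ≤ ‖x.1‖ ^ 2 := pow_le_pow_left₀ (norm_nonneg _) (norm_snd_le x.1) 2
  linarith

/-- At least one factor is needed: for `m = 0` the empty tensor is preserved. -/
theorem tensorPower_zero (hm : 0 < m) :
    tensorPower m (0 : HSpace n τ →L[ℝ] HSpace n τ) = 0 := by
  refine continuousLinearMap_ext_tensor fun φ => ?_
  rw [tensorPower_tensor, zero_apply, ← norm_eq_zero, norm_tensor]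
  exact Finset.prod_eq_zero (Finset.mem_univ ⟨0, hm⟩) (by simp)

/-- Every pair in the graph of the additive compound is a limit of smooth decomposable pairs together
with their diagonal derivatives on all faces. -/
theorem exists_mem_closure_coreTriples (hm : 0 < m) (hτ : 0 < τ)
    (Atilde : C(Icc (-τ) (0 : ℝ), Vec n) →L[ℝ] Vec n) {q : TensorSpace m n τ × TensorSpace m n τ}
    (hq : q ∈ additiveCompound m Atilde) :
    ∃ g, (q, g) ∈ closure (coreTriples m Atilde : Set
      ((TensorSpace m n τ × TensorSpace m n τ) × FaceFamily m n τ)) := by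
  by_cases hA : ∃ G : ℝ≥0 → HSpace n τ →L[ℝ] HSpace n τ,
      IsC0Semigroup G ∧ generatorGraph G = delayOperator Atilde
  swap
  -- If no semigroup is generated, the default value `0` makes the graph trivial: `-h⁻¹ • q.1`
  -- converges only for `q.1 = 0`.
  · have h0 : ∀ t, tensorPower m (generatedSemigroup (delayOperator Atilde) t) = 0 := by
      intro t
      rw [generatedSemigroup, dif_neg hA]
      exact tensorPower_zero hm
    have h1 : Tendsto (fun h : ℝ≥0 => (h : ℝ)⁻¹ • (0 - q.1)) (𝓝[>] 0) (𝓝 q.2) := by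
      have : Tendsto _ _ _ := hq
      simpa only [h0, zero_apply] using this
    have h2 : q.1 = 0 := by
      have h3 : Tendsto (fun h : ℝ≥0 => (h : ℝ)) (𝓝[>] 0) (𝓝 0) :=
        IsC0Semigroup.tendsto_coe_nhdsGT_zero.mono_right nhdsWithin_le_nhds
      have h4 := h3.smul h1
      rw [zero_smul] at h4
      have h5 : Tendsto (fun _ : ℝ≥0 => 0 - q.1) (𝓝[>] (0 : ℝ≥0)) (𝓝 (0 - q.1)) :=
        tendsto_const_nhds
      have h6 : (0 : TensorSpace m n τ) = 0 - q.1 := by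
        refine tendsto_nhds_unique (h4.congr' ?_) h5
        filter_upwards [self_mem_nhdsWithin] with h hh
        have : (h : ℝ) ≠ 0 := by exact_mod_cast (ne_of_gt hh)
        rw [smul_smul, mul_inv_cancel₀ this, one_smul]
      simpa using h6
    have h7 : q.2 = 0 := by
      simp only [h2, sub_zero, smul_zero] at h1
      exact tendsto_nhds_unique h1 tendsto_const_nhds
    have : q = 0 := Prod.ext h2 h7
    exact ⟨0, subset_closure (by rw [this]; exact (coreTriples m Atilde).zero_mem)⟩
  · have hG : IsC0Semigroup (generatedSemigroup (delayOperator Atilde)) ∧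
        generatorGraph (generatedSemigroup (delayOperator Atilde)) = delayOperator Atilde := by
      rw [generatedSemigroup, dif_pos hA]
      exact hA.choose_spec
    set G := generatedSemigroup (delayOperator Atilde) with hGdef
    obtain ⟨hG, hgen⟩ := hG
    obtain ⟨C, hC⟩ := norm_le_of_mem_coreTriples hτ.le m Atilde
    refine exists_mem_closure_of_fst_mem_closure hC ?_
    -- The pairs underlying the smooth triples are shown to form a core; the bound on the third
    -- components then lifts approximation of pairs to approximation of triples.
    let N : Submodule ℝ (TensorSpace m n τ × TensorSpace m n τ) :=
      (coreTriples m Atilde).map (LinearMap.fst ℝ _ _)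
    have hNspan : N = Submodule.span ℝ (Prod.fst '' pureTriples m Atilde) := by
      simp only [N, coreTriples, Submodule.map_span]
      rfl
    have hsub : (N : Set _) ⊆ generatorGraph fun t => tensorPower m (G t) := by
      have : N ≤ generatorSubmodule fun t => tensorPower m (G t) := by
        rw [hNspan, Submodule.span_le]
        rintro _ ⟨x, ⟨φ, ξ, ζ, ψ, ψ', h1, h2, h3, h4, h5⟩, rfl⟩
        rw [h4]
        exact tensor_mem_generatorGraph hG fun a => hgen ▸ h1 a
      exact this
    -- The semigroup preserves the domain of the square of `A` and acts factor by factor.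
    have hinv : ∀ (t : ℝ≥0) (p : TensorSpace m n τ × TensorSpace m n τ), p ∈ N →
        (tensorPower m (G t) p.1, tensorPower m (G t) p.2) ∈ N := by
      intro t p hp
      have hle : N ≤ N.comap ((tensorPower m (G t)).toLinearMap.prodMap
          (tensorPower m (G t)).toLinearMap) := by
        conv_lhs => rw [hNspan]
        rw [Submodule.span_le]
        rintro _ ⟨x, ⟨φ, ξ, ζ, ψ, ψ', h1, h2, h3, h4, h5⟩, rfl⟩
        have h1' : ∀ a, (G t (φ a), G t (ξ a)) ∈ delayOperator Atilde := fun a =>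
          hgen ▸ hG.map_mem_generatorGraph t (hgen ▸ h1 a)
        have h2' : ∀ a, (G t (ξ a), G t (ζ a)) ∈ delayOperator Atilde := fun a =>
          hgen ▸ hG.map_mem_generatorGraph t (hgen ▸ h2 a)
        obtain ⟨g, hg⟩ := exists_mem_pureTriples hτ h1' h2'
        change (tensorPower m (G t) x.1.1, tensorPower m (G t) x.1.2) ∈ N
        rw [h4, hNspan]
        refine Submodule.subset_span ⟨_, hg, ?_⟩
        simp only [map_sum, tensorPower_tensor]
        congr 1
        refine Finset.sum_congr rfl fun a _ => ?_
        congr 1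
        funext b
        by_cases hb : b = a
        · subst hb; simp
        · simp [Function.update_of_ne hb]
      exact hle hp
    have hdense : Dense (Prod.fst '' (N : Set (TensorSpace m n τ × TensorSpace m n τ))) := by
      have hd := dense_span_tensor_of_dense (m := m) hG.dense_domainSq
      refine hd.mono ?_
      have : Submodule.span ℝ (tensor '' Set.pi univ fun _ : Fin m => IsC0Semigroup.domainSq G)
          ≤ N.map (LinearMap.fst ℝ _ _) := by
        rw [Submodule.span_le]
        rintro _ ⟨φ, hφ, rfl⟩
        choose ξ ζ h1 h2 using fun a => hφ a (mem_univ a)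
        obtain ⟨g, hg⟩ := exists_mem_pureTriples hτ (fun a => hgen ▸ h1 a) (fun a => hgen ▸ h2 a)
        exact ⟨(tensor φ, ∑ a, tensor (Function.update φ a (ξ a))),
          ⟨_, Submodule.subset_span hg, rfl⟩, rfl⟩
      exact this
    exact hG.tensorPower.generatorGraph_subset_closure N hsub hinv hdense hq

/-- The properties of a limit of smooth triples that concern norms. -/
theorem exists_bounds_closure_coreTriples (hτ : 0 ≤ τ) (m : ℕ)
    (Atilde : C(Icc (-τ) (0 : ℝ), Vec n) →L[ℝ] Vec n) :
    ∃ C : ℝ, 0 ≤ C ∧ ∀ x ∈ closure (coreTriples m Atilde : Set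
      ((TensorSpace m n τ × TensorSpace m n τ) × FaceFamily m n τ)),
      (∀ J, ‖x.2 J‖ ^ 2 ≤ C * (‖x.1.1‖ ^ 2 + ‖x.1.2‖ ^ 2)) ∧
      ‖x.1.2‖ ^ 2 ≤ C * (‖x.1.1‖ ^ 2 + ∑ J, ‖x.2 J‖ ^ 2) ∧ x.2 ∅ = 0 := by
  obtain ⟨C₁, hC₁, h₁⟩ := exists_bound_of_mem_coreTriples hτ m Atilde
  obtain ⟨C₂, hC₂, h₂⟩ := exists_lower_bound_of_mem_coreTriples hτ m Atilde
  refine ⟨max C₁ C₂, hC₁.trans (le_max_left _ _), fun x hx => ⟨fun J => ?_, ?_, ?_⟩⟩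
  · refine closure_minimal (s := (coreTriples m Atilde : Set _))
      (t := {x : (TensorSpace m n τ × TensorSpace m n τ) × FaceFamily m n τ | ‖x.2 J‖ ^ 2 ≤ max C₁ C₂ * (‖x.1.1‖ ^ 2 + ‖x.1.2‖ ^ 2)})
      (fun x hx => (h₁ x hx J).trans ?_) (isClosed_le (by fun_prop) (by fun_prop)) hx
    gcongr
    exact le_max_left _ _
  · refine closure_minimal (s := (coreTriples m Atilde : Set _))
      (t := {x : (TensorSpace m n τ × TensorSpace m n τ) × FaceFamily m n τ | ‖x.1.2‖ ^ 2 ≤ max C₁ C₂ * (‖x.1.1‖ ^ 2 + ∑ J, ‖x.2 J‖ ^ 2)})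
      (fun x hx => (h₂ x hx).trans ?_) (isClosed_le (by fun_prop) (by fun_prop)) hx
    gcongr
    exact le_max_right _ _
  -- On the zero-dimensional face the diagonal derivative is an empty sum, and its vanishing is a
  -- closed condition.
  · refine closure_minimal (s := (coreTriples m Atilde : Set _)) (t := {x : (TensorSpace m n τ × TensorSpace m n τ) × FaceFamily m n τ | x.2 ∅ = 0})
      (fun x hx => ?_) (isClosed_eq (by fun_prop) continuous_const) hx
    obtain ⟨N, c, ψ, ψ', -, -, -, -, h⟩ := exists_rep_of_mem_coreTriples hx
    refine (Lp.eq_zero_iff_ae_eq_zero).2 ((h ∅).trans ?_)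
    simp only [Finset.sum_empty]
    rfl

end GraphClosure

/-! ### Coordinates adapted to diagonal lines, and null sets -/

section DiagonalLines

variable {k : ℕ}

/-- The point of the diagonal line through the point `θ` of the face `θ_l = 0` with the parameter
`t`. -/
def facePoint (l : Fin (k + 1)) (q : (Fin k → ℝ) × ℝ) : Fin (k + 1) → ℝ :=
  diagShift (l.insertNth (α := fun _ => ℝ) 0 q.1) q.2

@[simp]
theorem facePoint_same (l : Fin (k + 1)) (q : (Fin k → ℝ) × ℝ) : facePoint l q l = q.2 := by
  simp [facePoint, diagShift]

@[simp]
theorem facePoint_succAbove (l : Fin (k + 1)) (q : (Fin k → ℝ) × ℝ) (i : Fin k) :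
    facePoint l q (l.succAbove i) = q.1 i + q.2 := by
  simp [facePoint, diagShift]

theorem continuous_facePoint (l : Fin (k + 1)) : Continuous (facePoint l) := by
  refine continuous_pi fun i => ?_
  rcases Fin.eq_self_or_eq_succAbove l i with rfl | ⟨i, rfl⟩
  · simpa using continuous_snd
  · simp only [facePoint_succAbove]
    fun_prop

/-- Coordinates on `ℝ^{k+1}` that consist of a point of the face `θ_l = 0` and of the parameter on the
diagonal line through this point. -/
def faceEquiv (l : Fin (k + 1)) : (Fin k → ℝ) × ℝ ≃ᵐ (Fin (k + 1) → ℝ) where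
  toFun := facePoint l
  invFun x := (fun i => x (l.succAbove i) - x l, x l)
  left_inv q := by
    ext <;> simp
  right_inv x := by
    funext i
    rcases Fin.eq_self_or_eq_succAbove l i with rfl | ⟨i, rfl⟩ <;> simp
  measurable_toFun := (continuous_facePoint l).measurable
  measurable_invFun := by
    refine Continuous.measurable ?_
    change Continuous fun x : Fin (k + 1) → ℝ => (fun i => x (l.succAbove i) - x l, x l)
    fun_prop

theorem faceEquiv_apply (l : Fin (k + 1)) (q : (Fin k → ℝ) × ℝ) : faceEquiv l q = facePoint l q :=
  rfl

theorem faceEquiv_symm_apply (l : Fin (k + 1)) (x : Fin (k + 1) → ℝ) :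
    (faceEquiv l).symm x = (fun i => x (l.succAbove i) - x l, x l) := rfl

theorem faceEquiv_symm_diagShift (l : Fin (k + 1)) (x : Fin (k + 1) → ℝ) (t : ℝ) :
    (faceEquiv l).symm (diagShift x t) = (((faceEquiv l).symm x).1, ((faceEquiv l).symm x).2 + t) := by
  simp only [faceEquiv_symm_apply, diagShift, add_sub_add_right_eq_sub]

/-- The shear `(t, x) ↦ (t, x + (t, …, t))` preserves the Lebesgue measure. -/
theorem measurePreserving_shear :
    MeasurePreserving (fun p : ℝ × (Fin k → ℝ) => (p.1, diagShift p.2 p.1))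
      (volume.prod volume) (volume.prod volume) := by
  refine (MeasurePreserving.id volume).skew_product (g := fun t x => diagShift x t) ?_
    (Eventually.of_forall fun t => ?_)
  · refine Continuous.measurable ?_
    change Continuous fun p : ℝ × (Fin k → ℝ) => fun i => p.2 i + p.1
    fun_prop
  · exact map_add_right_eq_self volume (fun _ : Fin k => t)

/-- The coordinate change is a swap, a shear along the diagonal and the insertion of a coordinate.
-/
theorem measurePreserving_faceEquiv (l : Fin (k + 1)) :
    MeasurePreserving (faceEquiv l) (volume.prod volume) volume := by
  have h1 : MeasurePreserving (Prod.swap : (Fin k → ℝ) × ℝ → ℝ × (Fin k → ℝ))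
    (volume.prod volume) (volume.prod volume) := Measure.measurePreserving_swap
  have h2 := (volume_preserving_piFinSuccAbove (fun _ : Fin (k + 1) => ℝ) l).symm
  have h3 := (h2.comp measurePreserving_shear).comp h1
  have e : ⇑(faceEquiv l) = ((⇑(MeasurableEquiv.piFinSuccAbove (fun _ : Fin (k + 1) => ℝ) l).symm ∘
      fun p : ℝ × (Fin k → ℝ) => (p.1, diagShift p.2 p.1)) ∘ Prod.swap) := by
    funext q i
    change facePoint l q i = l.insertNth (α := fun _ => ℝ) q.2 (diagShift q.1 q.2) i
    rcases Fin.eq_self_or_eq_succAbove l i with rfl | ⟨i, rfl⟩ <;> simp [diagShift]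
  rw [e]
  exact h3

/-- Fubini after the shear: almost every diagonal line meets a null set in a null set. -/
theorem ae_ae_diagShift {P : (Fin k → ℝ) → Prop} (h : ∀ᵐ y, P y) :
    ∀ᵐ x : Fin k → ℝ, ∀ᵐ t : ℝ, P (diagShift x t) := by
  have h1 : ∀ᵐ p ∂((volume : Measure ℝ).prod (volume : Measure (Fin k → ℝ))), P (diagShift p.2 p.1) :=
    ((Measure.quasiMeasurePreserving_snd).comp
      measurePreserving_shear.quasiMeasurePreserving).ae h
  exact Measure.ae_ae_of_ae_prod
    ((Measure.measurePreserving_swap (μ := (volume : Measure (Fin k → ℝ)))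
      (ν := (volume : Measure ℝ))).quasiMeasurePreserving.ae h1)

/-- The converse of `ae_ae_diagShift`, where Fubini needs measurability. Exchanging the quantifiers
gives some `t` for which a translate of the set is null, and translations preserve null sets. -/
theorem ae_of_ae_ae_diagShift {N : Set (Fin k → ℝ)} (hN : NullMeasurableSet N)
    (h : ∀ᵐ x : Fin k → ℝ, ∀ᵐ t : ℝ, diagShift x t ∉ N) : ∀ᵐ y, y ∉ N := by
  obtain ⟨T, hT, hTN⟩ := hN
  have h1 : ∀ᵐ x : Fin k → ℝ, ∀ᵐ t : ℝ, diagShift x t ∉ T := by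
    filter_upwards [h, ae_ae_diagShift hTN] with x h1 h2
    filter_upwards [h1, h2] with t h1 h2 h3
    exact h1 (h2.mpr h3)
  have hm : Measurable fun p : (Fin k → ℝ) × ℝ => diagShift p.1 p.2 := by
    refine Continuous.measurable ?_
    change Continuous fun p : (Fin k → ℝ) × ℝ => fun i => p.1 i + p.2
    fun_prop
  have h2 := (Measure.ae_prod_iff_ae_ae (μ := (volume : Measure (Fin k → ℝ)))
      (ν := (volume : Measure ℝ)) (p := fun p => diagShift p.1 p.2 ∉ T) (hm hT.compl)).2 h1
  have h3 := Measure.ae_ae_of_ae_prod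
    ((Measure.measurePreserving_swap (μ := (volume : Measure ℝ))
      (ν := (volume : Measure (Fin k → ℝ)))).quasiMeasurePreserving.ae h2)
  obtain ⟨t, ht⟩ := h3.exists
  have h4 : ∀ᵐ y : Fin k → ℝ, y ∉ T := by
    have := (measurePreserving_add_right volume (fun _ : Fin k => -t)).quasiMeasurePreserving.ae ht
    filter_upwards [this] with y hy
    have e : diagShift (y + fun _ => -t) t = y := by
      funext i; simp [diagShift]
    simpa [e] using hy
  filter_upwards [h4, hTN] with y h1 h2 h3
  exact h1 (h2.mp h3)

end DiagonalLines

/-! ### Calculus and uniqueness of weak and diagonal derivatives -/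

section Uniqueness

variable {F : Type*} [NormedAddCommGroup F] [NormedSpace ℝ F]

theorem HasSobolevDeriv.sum {ι : Type*} (s : Finset ι) {I : Set ℝ} {f g : ι → ℝ → F}
    (h : ∀ i ∈ s, HasSobolevDeriv I (f i) (g i)) :
    HasSobolevDeriv I (fun t => ∑ i ∈ s, f i t) (fun t => ∑ i ∈ s, g i t) := by
  refine ⟨memLp_finsetSum s fun i hi => (h i hi).1, memLp_finsetSum s fun i hi => (h i hi).2.1,
    fun ζ hζ hζc hζs => ?_⟩
  have hL : ∀ {η : ℝ → ℝ} {w : ℝ → F}, Continuous η → HasCompactSupport η →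
      MemLp w 2 (volume.restrict I) → IntegrableOn (fun t => η t • w t) I := by
    intro η w h1 h2 h3
    have h4 : MemLp η 2 (volume.restrict I) := (h1.memLp_of_hasCompactSupport h2).restrict I
    exact memLp_one_iff_integrable.1 (h3.smul h4)
  simp only [Finset.smul_sum]
  rw [integral_finsetSum _ fun i hi => hL (hζ.continuous_deriv (by simp)) hζc.deriv (h i hi).1,
    integral_finsetSum _ fun i hi => hL hζ.continuous hζc (h i hi).2.1, ← Finset.sum_neg_distrib]
  exact Finset.sum_congr rfl fun i hi => (h i hi).2.2 ζ hζ hζc hζs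

theorem HasSobolevDeriv.comp_add_left {f g : ℝ → F} (h : HasSobolevDeriv univ f g) (s : ℝ) :
    HasSobolevDeriv univ (fun t => f (s + t)) (fun t => g (s + t)) := by
  obtain ⟨hf, hg, h⟩ := h
  simp only [Measure.restrict_univ] at hf hg h
  refine ⟨?_, ?_, fun ζ hζ hζc _ => ?_⟩
  · rw [Measure.restrict_univ]
    exact hf.comp_measurePreserving (measurePreserving_add_left volume s)
  · rw [Measure.restrict_univ]
    exact hg.comp_measurePreserving (measurePreserving_add_left volume s)
  · rw [Measure.restrict_univ]
    have h1 := h (fun t => ζ (-s + t)) (hζ.comp (contDiff_const.add contDiff_id))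
      (hζc.comp_homeomorph (Homeomorph.addLeft (-s))) (subset_univ _)
    simp only [deriv_comp_const_add] at h1
    rw [← integral_add_left_eq_self (fun t => deriv ζ (-s + t) • f t) s,
      ← integral_add_left_eq_self (fun t => ζ (-s + t) • g t) s] at h1
    simpa using h1

theorem HasSobolevDeriv.mono {I J : Set ℝ} (hJ : MeasurableSet J) (hJI : J ⊆ I) {f g f' g' : ℝ → F}
    (h : HasSobolevDeriv I f g) (hf : ∀ᵐ t, t ∈ J → f' t = f t) (hg : ∀ᵐ t, t ∈ J → g' t = g t) :
    HasSobolevDeriv J f' g' := by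
  have hf' := (ae_restrict_iff' hJ).2 hf
  have hg' := (ae_restrict_iff' hJ).2 hg
  refine ⟨(memLp_congr_ae hf').2 (h.1.mono_measure (Measure.restrict_mono_set _ hJI)),
    (memLp_congr_ae hg').2 (h.2.1.mono_measure (Measure.restrict_mono_set _ hJI)),
    fun ζ hζ hζc hζs => ?_⟩
  have key : ∀ {η : ℝ → ℝ} {w w' : ℝ → F}, tsupport η ⊆ J → w' =ᵐ[volume.restrict J] w →
      ∫ t in J, η t • w' t = ∫ t in I, η t • w t := by
    intro η w w' hη hw
    have hz : ∀ t, t ∉ J → η t • w t = 0 := fun t ht => by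
      rw [image_eq_zero_of_notMem_tsupport fun h => ht (hη h), zero_smul]
    rw [setIntegral_eq_integral_of_forall_compl_eq_zero fun t ht => hz t fun h => ht (hJI h),
      ← setIntegral_eq_integral_of_forall_compl_eq_zero hz]
    refine integral_congr_ae ?_
    filter_upwards [hw] with t ht
    rw [ht]
  rw [key ((tsupport_deriv_subset).trans hζs) hf', key hζs hg']
  exact h.2.2 ζ hζ hζc (hζs.trans hJI)

theorem HasSobolevDeriv.ae_eq [CompleteSpace F] {I : Set ℝ} (hI : IsOpen I) {f g g' : ℝ → F}
    (h : HasSobolevDeriv I f g) (h' : HasSobolevDeriv I f g') : ∀ᵐ t, t ∈ I → g t = g' t := by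
  have hloc : ∀ {w : ℝ → F}, MemLp w 2 (volume.restrict I) → LocallyIntegrableOn w I := fun hw =>
    locallyIntegrableOn_of_locallyIntegrable_restrict (hw.locallyIntegrable (by norm_num))
  have := hI.ae_eq_zero_of_integral_contDiff_smul_eq_zero (f := fun t => g t - g' t)
    ((hloc h.2.1).sub (hloc h'.2.1)) ?_
  · filter_upwards [this] with t ht hm using sub_eq_zero.1 (ht hm)
  · intro ζ hζ hζc hζs
    have h1 := h.2.2 ζ hζ hζc hζs
    have h2 := h'.2.2 ζ hζ hζc hζs
    rw [h1, neg_inj] at h2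
    have hL : ∀ {w : ℝ → F}, MemLp w 2 (volume.restrict I) →
        IntegrableOn (fun t => ζ t • w t) I := fun h3 => by
      have h4 : MemLp ζ 2 (volume.restrict I) :=
        (hζ.continuous.memLp_of_hasCompactSupport hζc).restrict I
      exact memLp_one_iff_integrable.1 (h3.smul h4)
    have h3 : ∫ t in I, ζ t • (g t - g' t) = 0 := by
      simp only [smul_sub]
      rw [integral_sub (hL h.2.1) (hL h'.2.1), h2, sub_self]
    rw [← h3]
    refine (setIntegral_eq_integral_of_forall_compl_eq_zero fun t ht => ?_).symm
    rw [image_eq_zero_of_notMem_tsupport fun h => ht (hζs h), zero_smul]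

theorem isOpen_diagLine {k : ℕ} {Ω : Set (Fin k → ℝ)} (hΩ : IsOpen Ω) (x : Fin k → ℝ) :
    IsOpen {t | diagShift x t ∈ Ω} := by
  refine hΩ.preimage ?_
  change Continuous fun t : ℝ => fun i => x i + t
  fun_prop

/-- Weak derivatives are unique on almost every line, and a null-measurable set that is null on
almost every line is null. Hence the chosen `diagDeriv` is determined up to null sets. -/
theorem HasDiagDeriv.ae_eq [CompleteSpace F] {k : ℕ} {Ω : Set (Fin k → ℝ)} (hΩ : IsOpen Ω)
    {f g g' : (Fin k → ℝ) → F} (h : HasDiagDeriv Ω f g) (h' : HasDiagDeriv Ω f g') :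
    g =ᵐ[volume.restrict Ω] g' := by
  have hN : NullMeasurableSet {y | ¬ (y ∈ Ω → g y = g' y)} := by
    have h1 : NullMeasurableSet {y | g y = g' y} (volume.restrict Ω) :=
      h.2.1.1.nullMeasurableSet_eq_fun h'.2.1.1
    have h2 := (nullMeasurableSet_restrict hΩ.measurableSet.nullMeasurableSet).1 h1.compl
    convert h2 using 1
    ext y
    simp [and_comm]
  have h3 := ae_of_ae_ae_diagShift hN (by
    filter_upwards [h.2.2, h'.2.2] with x hx hx'
    filter_upwards [hx.ae_eq (isOpen_diagLine hΩ x) hx'] with t ht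
    simpa using ht)
  rw [Filter.EventuallyEq, ae_restrict_iff' hΩ.measurableSet]
  filter_upwards [h3] with y hy
  simpa using hy

theorem HasDiagDeriv.sum {ι : Type*} [Fintype ι] {k : ℕ} {Ω : Set (Fin k → ℝ)}
    {f g : ι → (Fin k → ℝ) → F} (h : ∀ i, HasDiagDeriv Ω (f i) (g i)) :
    HasDiagDeriv Ω (fun x => ∑ i, f i x) (fun x => ∑ i, g i x) := by
  refine ⟨memLp_finsetSum _ fun i _ => (h i).1, memLp_finsetSum _ fun i _ => (h i).2.1, ?_⟩
  filter_upwards [ae_all_iff.2 fun i => (h i).2.2] with x hx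
  exact HasSobolevDeriv.sum _ fun i _ => hx i

/-- Restriction of a function with a diagonal derivative to an open set. -/
theorem HasDiagDeriv.restrict {k : ℕ} {Ω : Set (Fin k → ℝ)} (hΩ : IsOpen Ω)
    {f g f' g' : (Fin k → ℝ) → F} (h : HasDiagDeriv univ f g) (hf : f' =ᵐ[volume.restrict Ω] f)
    (hg : g' =ᵐ[volume.restrict Ω] g) : HasDiagDeriv Ω f' g' := by
  refine ⟨(memLp_congr_ae hf).2 (h.1.mono_measure (Measure.restrict_mono_set _ (subset_univ _))),
    (memLp_congr_ae hg).2 (h.2.1.mono_measure (Measure.restrict_mono_set _ (subset_univ _))), ?_⟩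
  filter_upwards [h.2.2, ae_ae_diagShift ((ae_restrict_iff' hΩ.measurableSet).1 hf),
    ae_ae_diagShift ((ae_restrict_iff' hΩ.measurableSet).1 hg)] with x h1 h2 h3
  exact h1.mono (isOpen_diagLine hΩ x).measurableSet (fun _ _ => mem_univ _) h2 h3

end Uniqueness

/-! ### Uniqueness of traces -/

section FaceTraces

variable {F : Type*} [NormedAddCommGroup F]

theorem isOpen_cube (τ : ℝ) (k : ℕ) : IsOpen (cube τ k) :=
  isOpen_set_pi finite_univ fun _ _ => isOpen_Ioo

theorem mem_cube {τ : ℝ} {k : ℕ} {x : Fin k → ℝ} : x ∈ cube τ k ↔ ∀ i, x i ∈ Ioo (-τ) 0 := by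
  simp [cube]

theorem facePoint_mem_cube {τ : ℝ} {k : ℕ} (l : Fin (k + 1)) (q : (Fin k → ℝ) × ℝ) :
    facePoint l q ∈ cube τ (k + 1) ↔ q.2 ∈ Ioo (-τ) 0 ∧ ∀ i, q.1 i + q.2 ∈ Ioo (-τ) 0 := by
  rw [mem_cube, l.forall_iff_succAbove]
  simp

/-- From a point interior to the face, the diagonal line runs inside the cube for small negative
`t`. Two continuous functions that agree a.e. there agree at `0`. -/
theorem HasFaceTrace.ae_eq {τ : ℝ} (hτ : 0 < τ) {k : ℕ} {l : Fin (k + 1)}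
    {f : (Fin (k + 1) → ℝ) → F} {u u' : (Fin k → ℝ) → F} (h : HasFaceTrace τ l f u)
    (h' : HasFaceTrace τ l f u') : u =ᵐ[volume.restrict (cube τ k)] u' := by
  filter_upwards [h, h', ae_restrict_mem (isOpen_cube τ k).measurableSet] with θ h1 h2 hθ
  obtain ⟨w, hw, h1⟩ := h1
  obtain ⟨w', hw', h2⟩ := h2
  have hev : ∀ᶠ t in 𝓝[<] (0 : ℝ), facePoint l (θ, t) ∈ cube τ (k + 1) := by
    have h3 : ∀ᶠ t in 𝓝 (0 : ℝ), -τ < t ∧ ∀ i, -τ < θ i + t ∧ θ i + t < 0 := by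
      refine (eventually_gt_nhds (by linarith)).and (eventually_all.2 fun i => ?_)
      have hc : ContinuousAt (fun t => θ i + t) 0 := by fun_prop
      have := hc.eventually_mem (s := Ioo (-τ) 0) (isOpen_Ioo.mem_nhds (by
        simpa using mem_cube.1 hθ i))
      exact this
    filter_upwards [self_mem_nhdsWithin, nhdsWithin_le_nhds h3] with t ht h4
    exact (facePoint_mem_cube l _).2 ⟨⟨h4.1, ht⟩, h4.2⟩
  obtain ⟨a, ha, hsub⟩ := (mem_nhdsLT_iff_exists_Ioo_subset).1 hev
  have ha : a < 0 := ha
  have heq : EqOn w w' (Ioo a 0) := by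
    refine Measure.eqOn_open_of_ae_eq (μ := volume) ?_ isOpen_Ioo w.continuous.continuousOn
      w'.continuous.continuousOn
    rw [Filter.EventuallyEq, ae_restrict_iff' measurableSet_Ioo]
    filter_upwards [h1, h2] with t h3 h4 ht
    rw [← h3 (hsub ht), ← h4 (hsub ht)]
  have h0 : (0 : ℝ) ∈ closure (Ioo a 0) := by
    rw [closure_Ioo ha.ne]; exact ⟨ha.le, le_rfl⟩
  rw [← hw, ← hw']
  exact heq.closure w.continuous w'.continuous h0

end FaceTraces

/-! ### Square integrable functions on a product with a bounded interval -/

section Square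

variable {α F : Type*} [MeasurableSpace α] {μ : Measure α} [NormedAddCommGroup F] {τ : ℝ}

theorem ae_memLp_two_prod [SFinite μ] {H : α × ℝ → F} (hH : MemLp H 2 (μ.prod volume)) :
    ∀ᵐ a ∂μ, MemLp (fun r => H (a, r)) 2 volume := by
  filter_upwards [hH.1.prodMk_left,
    ((memLp_two_iff_integrable_sq_norm hH.1).1 hH).prod_right_ae] with a h1 h2
  exact (memLp_two_iff_integrable_sq_norm h1).2 h2

theorem integrable_of_memLp_two {h : ℝ → F} (hh : MemLp h 2 volume)
    (h0 : ∀ r, r ∉ Ioo (-τ) 0 → h r = 0) : Integrable h := by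
  have h1 : IntegrableOn h (Ioo (-τ) 0) := memLp_two_integrableOn (by simp) (hh.restrict _)
  refine (integrableOn_iff_integrable_of_support_subset fun r hr => ?_).1 h1
  by_contra h
  exact hr (h0 r h)

theorem memLp_cutoff [NormedSpace ℝ F] {χ : ℝ → ℝ} (hχ : Continuous χ) (hχc : HasCompactSupport χ)
    {H : α × ℝ → F} (hH : MemLp H 2 (μ.prod volume)) :
    MemLp (fun q => χ q.2 • H q) 2 (μ.prod volume) := by
  obtain ⟨C, hC⟩ := hχc.exists_bound_of_continuous hχ
  refine hH.of_le_mul (c := C) ((hχ.comp_aestronglyMeasurable (by fun_prop)).smul hH.1)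
    (Eventually.of_forall fun q => ?_)
  rw [norm_smul]
  exact mul_le_mul_of_nonneg_right (hC _) (norm_nonneg _)

/-- Cauchy–Schwarz against the indicator of an interval of length `τ`. -/
theorem sq_integral_norm_le (hτ : 0 ≤ τ) {h : ℝ → F} (hh : MemLp h 2 volume)
    (h0 : ∀ r, r ∉ Ioo (-τ) 0 → h r = 0) : (∫ r, ‖h r‖) ^ 2 ≤ τ * ∫ r, ‖h r‖ ^ 2 := by
  have e : ∀ r, (Ioo (-τ) 0).indicator (fun _ => (1 : ℝ)) r * ‖h r‖ = ‖h r‖ := by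
    intro r
    by_cases hr : r ∈ Ioo (-τ) 0
    · simp [hr]
    · simp [h0 r hr]
  have e1 : ∀ r, (Ioo (-τ) 0).indicator (fun _ => (1 : ℝ)) r ^ 2
      = (Ioo (-τ) 0).indicator (fun _ => (1 : ℝ)) r := by
    intro r
    by_cases hr : r ∈ Ioo (-τ) 0 <;> simp [hr]
  have h1 := sq_integral_mul_le (μ := volume) (f := (Ioo (-τ) 0).indicator fun _ => (1 : ℝ))
    (g := fun r => ‖h r‖) (by
      simp only [e1]
      exact (integrable_indicator_iff measurableSet_Ioo).2 (integrableOn_const (by simp)))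
    ((memLp_two_iff_integrable_sq_norm hh.1).1 hh) (by
      simp only [e]
      exact (integrable_of_memLp_two hh h0).norm)
  simp only [e, e1] at h1
  rw [integral_indicator measurableSet_Ioo] at h1
  simpa [hτ] using h1

end Square

/-! ### Cut off primitives along lines -/

section Extension

variable {α F : Type*} [MeasurableSpace α] {μ : Measure α} [SFinite μ] [NormedAddCommGroup F]
  [NormedSpace ℝ F] {τ : ℝ}

/-- A single half-line replaces the oriented integral for both signs of `t`, which makes joint
measurability and uniform bounds accessible. -/
theorem intervalIntegral_eq_neg_integral_Ioi {h : ℝ → F} (hh : ∀ r, 0 ≤ r → h r = 0) (t : ℝ) :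
    ∫ r in (0 : ℝ)..t, h r = -∫ r in Ioi t, h r := by
  rcases le_total t 0 with ht | ht
  · rw [intervalIntegral.integral_symm, intervalIntegral.integral_of_le ht,
      setIntegral_eq_of_subset_of_forall_sdiff_eq_zero measurableSet_Ioi Ioc_subset_Ioi_self]
    intro r hr
    refine hh r ?_
    by_contra h
    exact hr.2 ⟨hr.1, (not_le.1 h).le⟩
  · rw [intervalIntegral.integral_of_le ht, setIntegral_eq_zero_of_forall_eq_zero,
      setIntegral_eq_zero_of_forall_eq_zero, neg_zero]
    · exact fun r hr => hh r (ht.trans (le_of_lt hr))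
    · exact fun r hr => hh r hr.1.le

theorem aestronglyMeasurable_primitive {H : α × ℝ → F} (hH : AEStronglyMeasurable H (μ.prod volume))
    (h0 : ∀ a r, 0 ≤ r → H (a, r) = 0) :
    AEStronglyMeasurable (fun q : α × ℝ => ∫ r in (0 : ℝ)..q.2, H (q.1, r)) (μ.prod volume) := by
  have e : (fun q : α × ℝ => ∫ r in (0 : ℝ)..q.2, H (q.1, r)) = fun q => -∫ r,
      {p : (α × ℝ) × ℝ | p.1.2 < p.2}.indicator (fun p => H (p.1.1, p.2)) (q, r) := by
    funext q
    rw [intervalIntegral_eq_neg_integral_Ioi (h0 q.1), ← integral_indicator measurableSet_Ioi]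
    rfl
  rw [e]
  refine AEStronglyMeasurable.neg (AEStronglyMeasurable.integral_prod_right' ?_)
  refine AEStronglyMeasurable.indicator ?_ (measurableSet_lt (by fun_prop) (by fun_prop))
  exact hH.comp_quasiMeasurePreserving
    (QuasiMeasurePreserving.prodMap Measure.quasiMeasurePreserving_fst
      (Measure.QuasiMeasurePreserving.id volume))

/-- A primitive in the second variable, cut off by a function of this variable. -/
noncomputable def cutoffPrimitive (χ : ℝ → ℝ) (U : α → F) (H : α × ℝ → F) (q : α × ℝ) : F :=
  χ q.2 • (U q.1 + ∫ r in (0 : ℝ)..q.2, H (q.1, r))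

/-- The function is dominated by the product of `‖U‖ + ∫ ‖H‖`, square integrable in the first
variable, and the cutoff, square integrable in the second. -/
theorem memLp_cutoffPrimitive (hτ : 0 ≤ τ) {χ : ℝ → ℝ} (hχ : Continuous χ) (hχc : HasCompactSupport χ)
    {U : α → F} (hU : MemLp U 2 μ) {H : α × ℝ → F} (hH : MemLp H 2 (μ.prod volume))
    (h0 : ∀ a r, r ∉ Ioo (-τ) 0 → H (a, r) = 0) :
    MemLp (cutoffPrimitive χ U H) 2 (μ.prod volume) := by
  have hae := ae_memLp_two_prod hH
  have hK : MemLp (fun a => ∫ r, ‖H (a, r)‖) 2 μ := by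
    have hm : AEStronglyMeasurable (fun a => ∫ r, ‖H (a, r)‖) μ := hH.1.norm.integral_prod_right'
    refine (memLp_two_iff_integrable_sq hm).2 ?_
    refine (((memLp_two_iff_integrable_sq_norm hH.1).1 hH).integral_prod_left.const_mul τ).mono'
      (hm.pow 2) ?_
    filter_upwards [hae] with a ha
    rw [Real.norm_of_nonneg (sq_nonneg _)]
    exact sq_integral_norm_le hτ ha (h0 a)
  have hB : MemLp (fun a => ‖U a‖ + ∫ r, ‖H (a, r)‖) 2 μ := hU.norm.add hK
  have hprod : MemLp (fun q : α × ℝ => (‖U q.1‖ + ∫ r, ‖H (q.1, r)‖) * χ q.2) 2 (μ.prod volume) := by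
    refine (memLp_two_iff_integrable_sq ?_).2 ?_
    · exact hB.1.comp_fst.mul (hχ.comp_aestronglyMeasurable (by fun_prop))
    · have hχ2 : Integrable fun t => χ t ^ 2 := by
        refine (hχ.pow 2).integrable_of_hasCompactSupport ?_
        simpa only [pow_two] using hχc.mul_right
      have h2 := hB.integrable_sq.mul_prod hχ2
      simpa only [mul_pow] using h2
  refine hprod.of_le ?_ ?_
  · refine (hχ.comp_aestronglyMeasurable (by fun_prop)).smul ?_
    exact hU.1.comp_fst.add (aestronglyMeasurable_primitive hH.1 fun a r hr =>
      h0 a r fun h => absurd h.2 (not_lt.2 hr))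
  · filter_upwards [(Measure.quasiMeasurePreserving_fst).ae hae] with q hq
    rw [cutoffPrimitive, norm_smul, norm_mul, mul_comm, Real.norm_of_nonneg (r := ‖U q.1‖ + _)
      (by positivity)]
    refine mul_le_mul_of_nonneg_right ((norm_add_le _ _).trans (add_le_add le_rfl ?_)) (norm_nonneg _)
    rw [intervalIntegral_eq_neg_integral_Ioi fun r hr => h0 _ r fun h => absurd h.2 (not_lt.2 hr),
      norm_neg]
    exact (norm_integral_le_integral_norm _).trans (setIntegral_le_integral
      (integrable_of_memLp_two hq (h0 _)).norm (Eventually.of_forall fun r => norm_nonneg _))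

/-- The weak derivative of a cut off primitive. -/
theorem ae_hasSobolevDeriv_cutoffPrimitive [CompleteSpace F] (hτ : 0 ≤ τ) {χ : ℝ → ℝ}
    (hχ : ContDiff ℝ ∞ χ) (hχc : HasCompactSupport χ)
    {U : α → F} (hU : MemLp U 2 μ) {H : α × ℝ → F} (hH : MemLp H 2 (μ.prod volume))
    (h0 : ∀ a r, r ∉ Ioo (-τ) 0 → H (a, r) = 0) :
    ∀ᵐ a ∂μ, HasSobolevDeriv univ (fun t => cutoffPrimitive χ U H (a, t))
      (fun t => cutoffPrimitive (deriv χ) U H (a, t) + χ t • H (a, t)) := by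
  have hχ' := hχ.continuous_deriv (by simp)
  filter_upwards [ae_memLp_two_prod (memLp_cutoffPrimitive hτ hχ.continuous hχc hU hH h0),
    ae_memLp_two_prod (memLp_cutoffPrimitive hτ hχ' hχc.deriv hU hH h0),
    ae_memLp_two_prod (memLp_cutoff hχ.continuous hχc hH), ae_memLp_two_prod hH] with a h1 h2 h3 h4
  have hi := integrable_of_memLp_two h4 (h0 a)
  refine ⟨by simpa using h1, by rw [Measure.restrict_univ]; exact h2.add h3, fun ζ hζ hζc _ => ?_⟩
  have hL : ∀ {η : ℝ → ℝ} {w : ℝ → F}, Continuous η → HasCompactSupport η →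
      MemLp w 2 volume → Integrable (fun t => η t • w t) := by
    intro η w h1 h2 h3
    exact memLp_one_iff_integrable.1 (h3.smul (h1.memLp_of_hasCompactSupport h2 (p := 2)))
  rw [Measure.restrict_univ]
  have hd : deriv (fun t => ζ t * χ t) = fun t => deriv ζ t * χ t + ζ t * deriv χ t := by
    funext t
    exact deriv_fun_mul (hζ.differentiable (by simp) t) (hχ.differentiable (by simp) t)
  -- Testing the primitive with `ζ χ` moves the cutoff from the function to the test function.
  have key := integral_deriv_smul_primitive hi (U a) (ζ := fun t => ζ t * χ t) (hζ.mul hχ)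
    hζc.mul_right
  rw [hd] at key
  have e1 : ∀ t, (deriv ζ t * χ t + ζ t * deriv χ t) • (U a + ∫ s in (0 : ℝ)..t, H (a, s))
      = deriv ζ t • cutoffPrimitive χ U H (a, t)
        + ζ t • cutoffPrimitive (deriv χ) U H (a, t) := fun t => by
    simp only [cutoffPrimitive, add_smul, mul_smul]
  simp only [e1, mul_smul] at key
  rw [integral_add (hL (hζ.continuous_deriv (by simp)) hζc.deriv h1) (hL hζ.continuous hζc h2)] at key
  simp only [smul_add (ζ _)]
  rw [integral_add (hL hζ.continuous hζc h2) (hL hζ.continuous hζc h3), neg_add, ← key]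
  abel

end Extension

/-! ### The representation along diagonals and its stability -/

section Slab

variable {k : ℕ} {τ : ℝ}

/-- The part of the cube on the diagonal lines through the interior of the face `θ_l = 0`. -/
def faceSlab (τ : ℝ) (l : Fin (k + 1)) : Set ((Fin k → ℝ) × ℝ) :=
  {q | q.1 ∈ cube τ k ∧ facePoint l q ∈ cube τ (k + 1)}

theorem measurableSet_faceSlab (τ : ℝ) (l : Fin (k + 1)) : MeasurableSet (faceSlab τ l) :=
  (measurable_fst (isOpen_cube τ k).measurableSet).inter
    ((continuous_facePoint l).measurable (isOpen_cube τ (k + 1)).measurableSet)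

theorem faceSlab_subset (τ : ℝ) (l : Fin (k + 1)) : faceSlab τ l ⊆ cube τ k ×ˢ Ioo (-τ) 0 :=
  fun q hq => ⟨hq.1, ((facePoint_mem_cube l q).1 hq.2).1⟩

theorem restrict_faceSlab_le_prod (τ : ℝ) (l : Fin (k + 1)) :
    (volume.prod volume).restrict (faceSlab τ l)
      ≤ (volume.restrict (cube τ k)).prod (volume.restrict (Ioo (-τ) 0)) := by
  rw [Measure.prod_restrict]
  exact Measure.restrict_mono_set _ (faceSlab_subset τ l)

theorem measurePreserving_facePoint_cube (τ : ℝ) (l : Fin (k + 1)) :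
    MeasurePreserving (facePoint l)
      ((volume.prod volume).restrict (facePoint l ⁻¹' cube τ (k + 1)))
      (volume.restrict (cube τ (k + 1))) :=
  (measurePreserving_faceEquiv l).restrict_preimage (isOpen_cube τ (k + 1)).measurableSet

theorem restrict_faceSlab_le (τ : ℝ) (l : Fin (k + 1)) :
    (volume.prod volume).restrict (faceSlab τ l)
      ≤ (volume.prod volume).restrict (facePoint l ⁻¹' cube τ (k + 1)) :=
  Measure.restrict_mono_set _ fun _ hq => hq.2

theorem lintegral_faceSlab_le (l : Fin (k + 1)) (h : (Fin (k + 1) → ℝ) → ℝ≥0∞) :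
    ∫⁻ q in faceSlab τ l, h (facePoint l q) ∂(volume.prod volume) ≤ ∫⁻ x in cube τ (k + 1), h x := by
  rw [← (measurePreserving_facePoint_cube τ l).lintegral_comp_emb
    (faceEquiv l).measurableEmbedding h]
  exact lintegral_mono' (restrict_faceSlab_le τ l) le_rfl

theorem lintegral_prod_fst {α β : Type*} [MeasurableSpace α] [MeasurableSpace β] {μ : Measure α}
    {ν : Measure β} [SFinite ν] {G : α → ℝ≥0∞} (hG : AEMeasurable G μ) :
    ∫⁻ q, G q.1 ∂(μ.prod ν) = ν univ * ∫⁻ a, G a ∂μ := by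
  rw [lintegral_prod _ hG.comp_fst]
  simp only [lintegral_const]
  rw [lintegral_mul_const'' _ hG, mul_comm]

theorem lintegral_faceSlab_fst_le (l : Fin (k + 1)) {G : (Fin k → ℝ) → ℝ≥0∞}
    (hG : AEMeasurable G (volume.restrict (cube τ k))) :
    ∫⁻ q in faceSlab τ l, G q.1 ∂(volume.prod volume)
      ≤ ENNReal.ofReal τ * ∫⁻ θ in cube τ k, G θ := by
  refine (lintegral_mono' (restrict_faceSlab_le_prod τ l) le_rfl).trans ?_
  rw [lintegral_prod_fst hG]
  simp

variable {F : Type*} [NormedAddCommGroup F]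

/-- A function on the cube in the coordinates given by the face `θ_l = 0`. -/
noncomputable def faceLift (τ : ℝ) (l : Fin (k + 1)) (g : (Fin (k + 1) → ℝ) → F) :
    (Fin k → ℝ) × ℝ → F :=
  (faceSlab τ l).indicator fun q => g (facePoint l q)

theorem memLp_faceLift {l : Fin (k + 1)} {g : (Fin (k + 1) → ℝ) → F}
    (hg : MemLp g 2 (volume.restrict (cube τ (k + 1)))) :
    MemLp (faceLift τ l g) 2 (volume.prod volume) := by
  refine (memLp_indicator_iff_restrict (measurableSet_faceSlab τ l)).2 ?_
  exact (hg.comp_measurePreserving (measurePreserving_facePoint_cube τ l)).mono_measure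
    (restrict_faceSlab_le τ l)

theorem faceLift_of_notMem (l : Fin (k + 1)) (g : (Fin (k + 1) → ℝ) → F) (θ : Fin k → ℝ) (r : ℝ)
    (hr : r ∉ Ioo (-τ) 0) : faceLift τ l g (θ, r) = 0 :=
  indicator_of_notMem (fun h => hr (faceSlab_subset τ l h).2) _

theorem faceLift_of_fst_notMem (l : Fin (k + 1)) (g : (Fin (k + 1) → ℝ) → F) {θ : Fin k → ℝ} (r : ℝ)
    (hθ : θ ∉ cube τ k) : faceLift τ l g (θ, r) = 0 :=
  indicator_of_notMem (fun h => hθ (faceSlab_subset τ l h).1) _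

theorem ae_integrable_faceLift {l : Fin (k + 1)} {g : (Fin (k + 1) → ℝ) → F}
    (hg : MemLp g 2 (volume.restrict (cube τ (k + 1)))) :
    ∀ᵐ θ : Fin k → ℝ, Integrable fun r => faceLift τ l g (θ, r) := by
  filter_upwards [ae_memLp_two_prod (memLp_faceLift (l := l) hg)] with θ hθ
  exact integrable_of_memLp_two hθ (faceLift_of_notMem l g θ)

theorem isFiniteMeasure_restrict_cube (τ : ℝ) (k : ℕ) :
    IsFiniteMeasure (volume.restrict (cube τ k)) := by
  rw [volume_restrict_cube]; infer_instance

/-- On a finite measure space convergence in mean square implies convergence in the mean. -/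
theorem tendsto_lintegral_of_tendsto_eLpNorm {α : Type*} [MeasurableSpace α] {μ : Measure α}
    [IsFiniteMeasure μ] {f : ℕ → α → F} (hf : ∀ N, AEStronglyMeasurable (f N) μ)
    (h : Tendsto (fun N => eLpNorm (f N) 2 μ) atTop (𝓝 0)) :
    Tendsto (fun N => ∫⁻ x, ‖f N x‖ₑ ∂μ) atTop (𝓝 0) := by
  have h1 : Tendsto (fun N => eLpNorm (f N) 2 μ * μ univ ^ (1 / (1 : ℝ≥0∞).toReal -
      1 / (2 : ℝ≥0∞).toReal)) atTop (𝓝 0) := by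
    have := ENNReal.Tendsto.mul_const (b := μ univ ^ (1 / (1 : ℝ≥0∞).toReal -
      1 / (2 : ℝ≥0∞).toReal)) h (Or.inr (ENNReal.rpow_ne_top_of_nonneg (by norm_num)
        (measure_ne_top μ univ)))
    simpa using this
  refine tendsto_of_tendsto_of_tendsto_of_le_of_le tendsto_const_nhds h1 (fun _ => zero_le)
    fun N => ?_
  rw [← eLpNorm_one_eq_lintegral_enorm]
  exact eLpNorm_le_eLpNorm_mul_rpow_measure_univ (by norm_num) (hf N)

variable [NormedSpace ℝ F]

/-- Along the diagonal lines through the face `θ_l = 0`, the function `f` is the primitive of `g`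
with the values `u` on the face. -/
def DiagRep (τ : ℝ) (l : Fin (k + 1)) (f g : (Fin (k + 1) → ℝ) → F) (u : (Fin k → ℝ) → F) : Prop :=
  ∀ᵐ q ∂((volume : Measure (Fin k → ℝ)).prod (volume : Measure ℝ)), q ∈ faceSlab τ l →
    f (facePoint l q) = u q.1 + ∫ r in (0 : ℝ)..q.2, faceLift τ l g (q.1, r)

theorem enorm_intervalIntegral_faceLift_le (l : Fin (k + 1)) (g : (Fin (k + 1) → ℝ) → F)
    (θ : Fin k → ℝ) (t : ℝ) : ‖∫ r in (0 : ℝ)..t, faceLift τ l g (θ, r)‖ₑ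
      ≤ ∫⁻ r, ‖faceLift τ l g (θ, r)‖ₑ := by
  rw [intervalIntegral_eq_neg_integral_Ioi fun r hr => faceLift_of_notMem l g θ r
    fun h => absurd h.2 (not_lt.2 hr), enorm_neg]
  exact (enorm_integral_le_lintegral_enorm _).trans (setLIntegral_le_lintegral _ _)

/-- The representation is stable under convergence in the mean square. -/
theorem DiagRep.of_tendsto {l : Fin (k + 1)} {f g : (Fin (k + 1) → ℝ) → F}
    {u : (Fin k → ℝ) → F} {f' g' : ℕ → (Fin (k + 1) → ℝ) → F} {u' : ℕ → (Fin k → ℝ) → F}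
    (hf : MemLp f 2 (volume.restrict (cube τ (k + 1))))
    (hg : MemLp g 2 (volume.restrict (cube τ (k + 1)))) (hu : MemLp u 2 (volume.restrict (cube τ k)))
    (hf' : ∀ N, MemLp (f' N) 2 (volume.restrict (cube τ (k + 1))))
    (hg' : ∀ N, MemLp (g' N) 2 (volume.restrict (cube τ (k + 1))))
    (hu' : ∀ N, MemLp (u' N) 2 (volume.restrict (cube τ k)))
    (h : ∀ N, DiagRep τ l (f' N) (g' N) (u' N))
    (hlf : Tendsto (fun N => eLpNorm (f - f' N) 2 (volume.restrict (cube τ (k + 1)))) atTop (𝓝 0))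
    (hlg : Tendsto (fun N => eLpNorm (g - g' N) 2 (volume.restrict (cube τ (k + 1)))) atTop (𝓝 0))
    (hlu : Tendsto (fun N => eLpNorm (u - u' N) 2 (volume.restrict (cube τ k))) atTop (𝓝 0)) :
    DiagRep τ l f g u := by
  have hfin := isFiniteMeasure_restrict_cube τ k
  have hfin' := isFiniteMeasure_restrict_cube τ (k + 1)
  have tf := tendsto_lintegral_of_tendsto_eLpNorm (fun N => (hf.sub (hf' N)).1) hlf
  have tg := tendsto_lintegral_of_tendsto_eLpNorm (fun N => (hg.sub (hg' N)).1) hlg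
  have tu := tendsto_lintegral_of_tendsto_eLpNorm (fun N => (hu.sub (hu' N)).1) hlu
  set S := ((volume : Measure (Fin k → ℝ)).prod (volume : Measure ℝ)).restrict (faceSlab τ l) with hS
  -- The defect of the limit relation is independent of `N`, and subtracting the exact relation for
  -- `f' N` bounds its integral by the three errors. The factors `τ` are due to terms that do not
  -- depend on the parameter on the line.
  have hbound : ∀ N, ∫⁻ q, ‖f (facePoint l q) - (u q.1 + ∫ r in (0 : ℝ)..q.2,
      faceLift τ l g (q.1, r))‖ₑ ∂S ≤ (∫⁻ x in cube τ (k + 1), ‖(f - f' N) x‖ₑ)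
        + (ENNReal.ofReal τ * ∫⁻ θ in cube τ k, ‖(u - u' N) θ‖ₑ)
        + ENNReal.ofReal τ * ∫⁻ x in cube τ (k + 1), ‖(g - g' N) x‖ₑ := by
    intro N
    have hgN := memLp_faceLift (l := l) (hg.sub (hg' N))
    have hmG : AEMeasurable (fun θ : Fin k → ℝ => ∫⁻ r, ‖faceLift τ l (g - g' N) (θ, r)‖ₑ) volume :=
      hgN.1.enorm.lintegral_prod_right'
    have hmu : AEMeasurable (fun θ => ‖(u - u' N) θ‖ₑ) (volume.restrict (cube τ k)) :=
      (hu.sub (hu' N)).1.enorm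
    have hmf : AEMeasurable (fun q => ‖(f - f' N) (facePoint l q)‖ₑ) S :=
      (((hf.sub (hf' N)).comp_measurePreserving (measurePreserving_facePoint_cube τ l)).mono_measure
        (restrict_faceSlab_le τ l)).1.enorm
    have hmu' : AEMeasurable (fun q : (Fin k → ℝ) × ℝ => ‖(u - u' N) q.1‖ₑ) S :=
      hmu.comp_fst.mono_measure (restrict_faceSlab_le_prod τ l)
    have hle : ∀ᵐ q ∂S, ‖f (facePoint l q) - (u q.1 + ∫ r in (0 : ℝ)..q.2,
        faceLift τ l g (q.1, r))‖ₑ ≤ ‖(f - f' N) (facePoint l q)‖ₑ + ‖(u - u' N) q.1‖ₑ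
          + ∫⁻ r, ‖faceLift τ l (g - g' N) (q.1, r)‖ₑ := by
      have hi1 := (Measure.quasiMeasurePreserving_fst (μ := (volume : Measure (Fin k → ℝ)))
        (ν := (volume : Measure ℝ))).ae (ae_integrable_faceLift (l := l) hg)
      have hi2 := (Measure.quasiMeasurePreserving_fst (μ := (volume : Measure (Fin k → ℝ)))
        (ν := (volume : Measure ℝ))).ae (ae_integrable_faceLift (l := l) (hg' N))
      rw [hS, ae_restrict_iff' (measurableSet_faceSlab τ l)]
      filter_upwards [h N, hi1, hi2] with q e1 h1 h2 hq
      have e2 : ∫ r in (0 : ℝ)..q.2, faceLift τ l (g - g' N) (q.1, r)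
          = (∫ r in (0 : ℝ)..q.2, faceLift τ l g (q.1, r))
            - ∫ r in (0 : ℝ)..q.2, faceLift τ l (g' N) (q.1, r) := by
        rw [← intervalIntegral.integral_sub h1.intervalIntegrable h2.intervalIntegrable]
        congr 1
        funext r
        simp only [faceLift, indicator]
        split_ifs <;> simp
      have e3 : f (facePoint l q) - (u q.1 + ∫ r in (0 : ℝ)..q.2, faceLift τ l g (q.1, r))
          = (f - f' N) (facePoint l q) - (u - u' N) q.1
            - ∫ r in (0 : ℝ)..q.2, faceLift τ l (g - g' N) (q.1, r) := by
        rw [e2, Pi.sub_apply, Pi.sub_apply, e1 hq]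
        abel
      rw [e3]
      exact enorm_sub_le.trans (add_le_add enorm_sub_le (enorm_intervalIntegral_faceLift_le l _ _ _))
    refine (lintegral_mono_ae hle).trans ?_
    have hmfu : AEMeasurable (fun q => ‖(f - f' N) (facePoint l q)‖ₑ + ‖(u - u' N) q.1‖ₑ) S :=
      hmf.add hmu'
    rw [lintegral_add_left' hmfu, lintegral_add_left' hmf]
    refine add_le_add (add_le_add (lintegral_faceSlab_le l fun x => ‖(f - f' N) x‖ₑ)
      (lintegral_faceSlab_fst_le l hmu)) ((lintegral_faceSlab_fst_le l hmG.restrict).trans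
      (mul_le_mul_right ?_ _))
    refine (setLIntegral_le_lintegral _ _).trans ?_
    rw [← lintegral_prod _ hgN.1.enorm]
    have e : ∀ q, ‖faceLift τ l (g - g' N) q‖ₑ
        = (faceSlab τ l).indicator (fun q => ‖(g - g' N) (facePoint l q)‖ₑ) q := fun q =>
      enorm_indicator_eq_indicator_enorm _ _
    simp only [e]
    rw [lintegral_indicator (measurableSet_faceSlab τ l)]
    exact lintegral_faceSlab_le l fun x => ‖(g - g' N) x‖ₑ
  have h0 : ∫⁻ q, ‖f (facePoint l q) - (u q.1 + ∫ r in (0 : ℝ)..q.2,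
      faceLift τ l g (q.1, r))‖ₑ ∂S = 0 := by
    have h1 := (tf.add (ENNReal.Tendsto.const_mul (a := ENNReal.ofReal τ) tu (Or.inr (by simp)))).add
      (ENNReal.Tendsto.const_mul (a := ENNReal.ofReal τ) tg (Or.inr (by simp)))
    simp only [mul_zero, add_zero] at h1
    exact le_antisymm (ge_of_tendsto' h1 hbound) zero_le
  have hm : AEStronglyMeasurable (fun q => f (facePoint l q) - (u q.1 + ∫ r in (0 : ℝ)..q.2,
      faceLift τ l g (q.1, r))) S := by
    refine AEStronglyMeasurable.sub ?_ (AEStronglyMeasurable.add ?_ ?_)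
    · exact ((hf.comp_measurePreserving (measurePreserving_facePoint_cube τ l)).mono_measure
        (restrict_faceSlab_le τ l)).1
    · exact hu.1.comp_fst.mono_measure (restrict_faceSlab_le_prod τ l)
    · exact (aestronglyMeasurable_primitive (memLp_faceLift hg).1 fun a r hr =>
        faceLift_of_notMem l g a r fun h => absurd h.2 (not_lt.2 hr)).restrict
  have h2 := (lintegral_eq_zero_iff' hm.enorm).1 h0
  rw [hS, Filter.EventuallyEq, ae_restrict_iff' (measurableSet_faceSlab τ l)] at h2
  filter_upwards [h2] with q hq hmem
  simpa [sub_eq_zero] using hq hmem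

end Slab

/-! ### Extension from the cube, and the Sobolev norm -/

section CubeExtension

variable {k : ℕ} {τ : ℝ} {F : Type*} [NormedAddCommGroup F] [NormedSpace ℝ F]

/-- The right side of the representation is continuous in the parameter and has the value `u` at
`0`. -/
theorem DiagRep.hasFaceTrace {l : Fin (k + 1)} {f g : (Fin (k + 1) → ℝ) → F}
    {u : (Fin k → ℝ) → F} (h : DiagRep τ l f g u)
    (hg : MemLp g 2 (volume.restrict (cube τ (k + 1)))) : HasFaceTrace τ l f u := by
  filter_upwards [ae_restrict_of_ae (Measure.ae_ae_of_ae_prod h),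
    ae_restrict_of_ae (ae_integrable_faceLift (l := l) hg),
    ae_restrict_mem (isOpen_cube τ k).measurableSet] with θ h1 h2 hθ
  refine ⟨⟨fun t => u θ + ∫ r in (0 : ℝ)..t, faceLift τ l g (θ, r), continuous_const.add
    (intervalIntegral.continuous_primitive (fun _ _ => h2.intervalIntegrable) 0)⟩, by simp, ?_⟩
  filter_upwards [h1] with t ht hm
  exact ht ⟨hθ, hm⟩

/-- The line parametrized from `x` is that from its point on the hyperplane `x_l = 0`, up to a
translation of the parameter. -/
theorem hasDiagDeriv_univ_of_faceEquiv (l : Fin (k + 1)) {E E' : (Fin k → ℝ) × ℝ → F}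
    (hE : MemLp E 2 (volume.prod volume)) (hE' : MemLp E' 2 (volume.prod volume))
    (h : ∀ᵐ θ : Fin k → ℝ, HasSobolevDeriv univ (fun t => E (θ, t)) fun t => E' (θ, t)) :
    HasDiagDeriv univ (fun x => E ((faceEquiv l).symm x)) fun x => E' ((faceEquiv l).symm x) := by
  have hmp := (measurePreserving_faceEquiv l).symm
  refine ⟨?_, ?_, ?_⟩
  · rw [Measure.restrict_univ]; exact hE.comp_measurePreserving hmp
  · rw [Measure.restrict_univ]; exact hE'.comp_measurePreserving hmp
  · have h1 := hmp.quasiMeasurePreserving.ae ((Measure.quasiMeasurePreserving_fst).ae h)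
    filter_upwards [h1] with x hx
    simp only [faceEquiv_symm_diagShift]
    exact hx.comp_add_left _

theorem exists_cutoff (hτ : 0 < τ) : ∃ χ : ℝ → ℝ, ContDiff ℝ ∞ χ ∧ HasCompactSupport χ ∧
    (∀ t ∈ Ioo (-τ) 0, χ t = 1) ∧ ∀ t ∈ Ioo (-τ) 0, deriv χ t = 0 := by
  -- The inner ball `[-3τ/2, τ/2]` contains `(-τ, 0)`.
  let χ : ContDiffBump (-τ / 2) := ⟨τ, 2 * τ, hτ, by linarith⟩
  have h1 : ∀ t ∈ Ioo (-τ) 0, χ t = 1 := fun t ht => χ.one_of_mem_closedBall (by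
    rw [Real.closedBall_eq_Icc]
    constructor <;> simp only [χ] <;> linarith [ht.1, ht.2])
  refine ⟨χ, χ.contDiff, χ.hasCompactSupport, h1, fun t ht => ?_⟩
  have : (χ : ℝ → ℝ) =ᶠ[𝓝 t] fun _ => 1 := by
    filter_upwards [isOpen_Ioo.mem_nhds ht] with s hs using h1 s hs
  rw [this.deriv_eq, deriv_const]

/-- This excludes points with two equal coordinates, so that the maximal coordinate is unique. -/
theorem ae_faceEquiv_symm_ne_zero : ∀ᵐ x : Fin (k + 1) → ℝ, ∀ (l : Fin (k + 1)) (i : Fin k),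
    ((faceEquiv l).symm x).1 i ≠ 0 := by
  refine ae_all_iff.2 fun l => ae_all_iff.2 fun i => ?_
  have h1 : ∀ᵐ θ : Fin k → ℝ, θ i ≠ 0 :=
    (Measure.quasiMeasurePreserving_eval (fun _ : Fin k => (volume : Measure ℝ)) i).ae
      (Measure.ae_ne volume 0)
  exact (measurePreserving_faceEquiv l).symm.quasiMeasurePreserving.ae
    ((Measure.quasiMeasurePreserving_fst).ae h1)

/-- A function on the cube with representations along the lines through all faces extends to a function
with a diagonal derivative on the whole space. -/
theorem exists_extension_of_diagRep [CompleteSpace F] (hτ : 0 < τ) {f g : (Fin (k + 1) → ℝ) → F}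
    {u : Fin (k + 1) → (Fin k → ℝ) → F} (hg : MemLp g 2 (volume.restrict (cube τ (k + 1))))
    (hu : ∀ l, MemLp (u l) 2 (volume.restrict (cube τ k))) (h : ∀ l, DiagRep τ l f g (u l)) :
    ∃ f' g' : (Fin (k + 1) → ℝ) → F, HasDiagDeriv univ f' g' ∧
      f =ᵐ[volume.restrict (cube τ (k + 1))] f' ∧ g =ᵐ[volume.restrict (cube τ (k + 1))] g' := by
  obtain ⟨χ, hχ, hχc, hχ1, hχ0⟩ := exists_cutoff hτ
  have hχ' := hχ.continuous_deriv (by simp)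
  -- Extension by zero makes the contribution of each face vanish on the lines that do not pass
  -- through its interior; the extensions for the different faces may then be added.
  set U : Fin (k + 1) → (Fin k → ℝ) → F := fun l => (cube τ k).indicator (u l) with hU
  have hU2 : ∀ l, MemLp (U l) 2 volume := fun l =>
    (memLp_indicator_iff_restrict (isOpen_cube τ k).measurableSet).2 (hu l)
  set H := fun l => faceLift τ l g with hH
  have hH2 : ∀ l, MemLp (H l) 2 (volume.prod volume) := fun l => memLp_faceLift hg
  have hH0 : ∀ l a r, r ∉ Ioo (-τ) 0 → H l (a, r) = 0 := fun l => faceLift_of_notMem l g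
  set E := fun l => cutoffPrimitive χ (U l) (H l) with hE
  set E' := fun l (q : (Fin k → ℝ) × ℝ) => cutoffPrimitive (deriv χ) (U l) (H l) q + χ q.2 • H l q
    with hE'
  have hD : ∀ l, HasDiagDeriv univ (fun x => E l ((faceEquiv l).symm x))
      fun x => E' l ((faceEquiv l).symm x) := fun l =>
    hasDiagDeriv_univ_of_faceEquiv l
      (memLp_cutoffPrimitive hτ.le hχ.continuous hχc (hU2 l) (hH2 l) (hH0 l))
      ((memLp_cutoffPrimitive hτ.le hχ' hχc.deriv (hU2 l) (hH2 l) (hH0 l)).add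
        (memLp_cutoff hχ.continuous hχc (hH2 l)))
      (ae_hasSobolevDeriv_cutoffPrimitive hτ.le hχ hχc (hU2 l) (hH2 l) (hH0 l))
  have hout : ∀ l θ t, θ ∉ cube τ k → E l (θ, t) = 0 ∧ E' l (θ, t) = 0 := by
    intro l θ t hθ
    have h1 : ∀ r, H l (θ, r) = 0 := fun r => faceLift_of_fst_notMem l g r hθ
    have h2 : U l θ = 0 := indicator_of_notMem hθ _
    simp [hE, hE', cutoffPrimitive, h1, h2]
  have hx : ∀ᵐ x : Fin (k + 1) → ℝ, ∀ l, (faceEquiv l).symm x ∈ faceSlab τ l →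
      f x = u l ((faceEquiv l).symm x).1 + ∫ r in (0 : ℝ)..((faceEquiv l).symm x).2,
        H l (((faceEquiv l).symm x).1, r) := by
    refine ae_all_iff.2 fun l => ?_
    filter_upwards [(measurePreserving_faceEquiv l).symm.quasiMeasurePreserving.ae (h l)]
      with x hx hm
    rw [← hx hm, ← faceEquiv_apply, MeasurableEquiv.apply_symm_apply]
  have hkey : ∀ᵐ x : Fin (k + 1) → ℝ, x ∈ cube τ (k + 1) →
      f x = ∑ l, E l ((faceEquiv l).symm x) ∧ g x = ∑ l, E' l ((faceEquiv l).symm x) := by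
    filter_upwards [hx, ae_faceEquiv_symm_ne_zero] with x h1 h2 hxc
    have hxc' := mem_cube.1 hxc
    -- In the direction of growing parameter, the line through `x` leaves the cube where the largest
    -- coordinate reaches `0`.
    obtain ⟨l, hl⟩ := Finite.exists_max x
    have hlm : ((faceEquiv l).symm x).1 ∈ cube τ k := by
      refine mem_cube.2 fun i => ⟨?_, lt_of_le_of_ne ?_ (h2 l i)⟩
      · rw [faceEquiv_symm_apply]
        linarith [(hxc' (l.succAbove i)).1, (hxc' l).2]
      · rw [faceEquiv_symm_apply]
        linarith [hl (l.succAbove i)]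
    have hslab : (faceEquiv l).symm x ∈ faceSlab τ l := by
      refine ⟨hlm, ?_⟩
      rwa [← faceEquiv_apply, MeasurableEquiv.apply_symm_apply]
    -- The point of the line with `x_{l'} = 0` has a positive `l`-th coordinate, or zero in case of
    -- a tie, so it is outside the open face.
    have hne : ∀ l' ∈ (Finset.univ : Finset (Fin (k + 1))), l' ≠ l →
        E l' ((faceEquiv l').symm x) = 0 ∧ E' l' ((faceEquiv l').symm x) = 0 := by
      intro l' _ hl'
      refine hout l' _ _ fun hm => ?_
      obtain ⟨i, hi⟩ := Fin.exists_succAbove_eq hl'.symm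
      have h3 : x (l'.succAbove i) - x l' < 0 := (mem_cube.1 hm i).2
      rw [hi] at h3
      linarith [hl l']
    have ht : ((faceEquiv l).symm x).2 ∈ Ioo (-τ) 0 := hxc' l
    rw [Finset.sum_eq_single l (fun l' hl' hn => (hne l' hl' hn).1) (by simp),
      Finset.sum_eq_single l (fun l' hl' hn => (hne l' hl' hn).2) (by simp)]
    constructor
    · rw [h1 l hslab]
      simp only [hE, cutoffPrimitive, hχ1 _ ht, one_smul]
      have hUl : U l ((faceEquiv l).symm x).1 = u l ((faceEquiv l).symm x).1 :=
        indicator_of_mem hlm _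
      rw [hUl]
    · simp only [hE', cutoffPrimitive, hχ1 _ ht, hχ0 _ ht, one_smul, zero_smul, zero_add]
      have hHl : H l ((faceEquiv l).symm x) = g (faceEquiv l ((faceEquiv l).symm x)) :=
        indicator_of_mem hslab _
      rw [hHl, MeasurableEquiv.apply_symm_apply]
  refine ⟨_, _, HasDiagDeriv.sum hD, ?_, ?_⟩
  · rw [Filter.EventuallyEq, ae_restrict_iff' (isOpen_cube τ (k + 1)).measurableSet]
    filter_upwards [hkey] with x hx hm using (hx hm).1
  · rw [Filter.EventuallyEq, ae_restrict_iff' (isOpen_cube τ (k + 1)).measurableSet]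
    filter_upwards [hkey] with x hx hm using (hx hm).2

theorem memDiagSobolev_of_diagRep [CompleteSpace F] (hτ : 0 < τ) {f g : (Fin (k + 1) → ℝ) → F}
    {u : Fin (k + 1) → (Fin k → ℝ) → F} (hg : MemLp g 2 (volume.restrict (cube τ (k + 1))))
    (hu : ∀ l, MemLp (u l) 2 (volume.restrict (cube τ k))) (h : ∀ l, DiagRep τ l f g (u l)) :
    MemDiagSobolev (cube τ (k + 1)) f := by
  obtain ⟨f', g', h1, h2, -⟩ := exists_extension_of_diagRep hτ hg hu h
  exact ⟨f', g', h1, h2⟩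

/-- By uniqueness the derivative and traces picked by choice are a.e. those of the representation.
-/
theorem diagNormSq_of_diagRep [CompleteSpace F] (hτ : 0 < τ) {f g : (Fin (k + 1) → ℝ) → F}
    {u : Fin (k + 1) → (Fin k → ℝ) → F} (hg : MemLp g 2 (volume.restrict (cube τ (k + 1))))
    (hu : ∀ l, MemLp (u l) 2 (volume.restrict (cube τ k))) (h : ∀ l, DiagRep τ l f g (u l)) :
    diagNormSq τ f = eLpNorm f 2 (volume.restrict (cube τ (k + 1))) ^ 2
      + eLpNorm g 2 (volume.restrict (cube τ (k + 1))) ^ 2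
      + ∑ l, eLpNorm (u l) 2 (volume.restrict (cube τ k)) ^ 2 := by
  obtain ⟨f', g', h1, h2, h3⟩ := exists_extension_of_diagRep hτ hg hu h
  have hd : HasDiagDeriv (cube τ (k + 1)) f g := h1.restrict (isOpen_cube τ (k + 1)) h2 h3
  have hex : ∃ g, HasDiagDeriv (cube τ (k + 1)) f g := ⟨g, hd⟩
  have e1 : diagDeriv (cube τ (k + 1)) f =ᵐ[volume.restrict (cube τ (k + 1))] g := by
    rw [diagDeriv, dif_pos hex]
    exact hex.choose_spec.ae_eq (isOpen_cube τ (k + 1)) hd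
  have e2 : ∀ l, faceTrace τ l f =ᵐ[volume.restrict (cube τ k)] u l := fun l => by
    have hex : ∃ u, HasFaceTrace τ l f u := ⟨u l, (h l).hasFaceTrace hg⟩
    rw [faceTrace, dif_pos hex]
    exact hex.choose_spec.ae_eq hτ ((h l).hasFaceTrace hg)
  rw [diagNormSq, eLpNorm_congr_ae e1]
  exact congrArg _ (Finset.sum_congr rfl fun l _ => by rw [eLpNorm_congr_ae (e2 l)])

end CubeExtension

/-! ### The representation for restrictions to faces -/

section FaceRepresentation

variable {m n k : ℕ} {τ : ℝ}

theorem faceEmbed_facePoint_apply (j : Fin (k + 1) ↪o Fin m) (l : Fin (k + 1)) (θ : Fin k → ℝ)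
    (t : ℝ) (a : Fin m) : faceEmbed j (facePoint l (θ, t)) a
      = faceEmbed j (facePoint l (θ, 0)) a + if a ∈ faceSet j then t else 0 := by
  by_cases h : ∃ i, j i = a
  · rw [if_pos ((mem_faceSet j a).2 h)]
    obtain ⟨i, rfl⟩ := h
    rw [faceEmbed_apply, faceEmbed_apply]
    simp [facePoint, diagShift]
  · rw [if_neg fun h' => h ((mem_faceSet j a).1 h'), faceEmbed_of_notMem j _ h,
      faceEmbed_of_notMem j _ h, add_zero]

/-- Along the diagonal of a face exactly the free coordinates move, with unit speed, so the chain
rule yields the sum of the partial derivatives in the directions of the face. -/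
theorem hasDerivAt_sumTensor_facePoint {ι : Type*} [Fintype ι] (c : ι → ℝ)
    {ψ ψ' : ι → Fin m → ℝ → Vec n} (hψ : ∀ r a t, HasDerivAt (ψ r a) (ψ' r a t) t)
    (j : Fin (k + 1) ↪o Fin m) (l : Fin (k + 1)) (θ : Fin k → ℝ) (t : ℝ) :
    HasDerivAt (fun t => sumTensor c ψ (faceEmbed j (facePoint l (θ, t))))
      (∑ a ∈ faceSet j, sumTensor c (fun r => Function.update (ψ r) a (ψ' r a))
        (faceEmbed j (facePoint l (θ, t)))) t := by
  have hκ : ∀ κ : Fin m → Fin n, HasDerivAt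
      (fun t => sumTensor c ψ (faceEmbed j (facePoint l (θ, t))) κ)
      ((∑ a ∈ faceSet j, sumTensor c (fun r => Function.update (ψ r) a (ψ' r a))
        (faceEmbed j (facePoint l (θ, t)))) κ) t := by
    intro κ
    set p := fun t => faceEmbed j (facePoint l (θ, t)) with hp
    have hpd : ∀ a, HasDerivAt (fun t => p t a) (if a ∈ faceSet j then 1 else 0) t := by
      intro a
      have e : (fun t => p t a) = fun t => faceEmbed j (facePoint l (θ, 0)) a
          + if a ∈ faceSet j then t else 0 := funext fun t => faceEmbed_facePoint_apply j l θ t a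
      rw [e]
      refine HasDerivAt.const_add _ ?_
      split_ifs
      · exact hasDerivAt_id t
      · exact hasDerivAt_const t 0
    have hc : ∀ r a, HasDerivAt (fun t => ψ r a (p t a) (κ a))
        ((if a ∈ faceSet j then 1 else 0) * ψ' r a (p t a) (κ a)) t := by
      intro r a
      have h1 := (hψ r a (p t a)).scomp t (hpd a)
      have h2 := (EuclideanSpace.proj (𝕜 := ℝ) (κ a)).hasFDerivAt.comp_hasDerivAt t h1
      exact h2.congr_deriv (by split_ifs <;> simp)
    have hs : HasDerivAt (fun t => ∑ r, c r * ∏ a, ψ r a (p t a) (κ a))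
        (∑ r, c r * ∑ a, (∏ b ∈ Finset.univ.erase a, ψ r b (p t b) (κ b)) •
          ((if a ∈ faceSet j then 1 else 0) * ψ' r a (p t a) (κ a))) t :=
      HasDerivAt.fun_sum fun r _ => (HasDerivAt.fun_finsetProd fun a _ => hc r a).const_mul _
    have e1 : (fun t => sumTensor c ψ (p t) κ) = fun t => ∑ r, c r * ∏ a, ψ r a (p t a) (κ a) :=
      funext fun t => sumTensor_apply c ψ (p t) κ
    change HasDerivAt (fun t => sumTensor c ψ (p t) κ) _ t
    rw [e1]
    convert hs using 1
    rw [WithLp.ofLp_sum, Finset.sum_apply]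
    simp only [sumTensor_update_apply]
    rw [Finset.sum_comm]
    refine Finset.sum_congr rfl fun r _ => ?_
    rw [Finset.mul_sum, ← Finset.sum_subset (Finset.subset_univ (faceSet j))]
    · refine Finset.sum_congr rfl fun a ha => ?_
      rw [if_pos ha, smul_eq_mul]
      ring
    · intro a _ ha
      rw [if_neg ha]
      simp
  exact (PiLp.continuousLinearEquiv 2 ℝ (fun _ : Fin m → Fin n => ℝ)).symm.hasFDerivAt.comp_hasDerivAt
    t (hasDerivAt_pi.2 hκ)

theorem diagRep_of_hasDerivAt {F : Type*} [NormedAddCommGroup F] [NormedSpace ℝ F] [CompleteSpace F]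
    {l : Fin (k + 1)} {f g : (Fin (k + 1) → ℝ) → F} (hg : Continuous g)
    (h : ∀ θ t, HasDerivAt (fun t => f (facePoint l (θ, t))) (g (facePoint l (θ, t))) t) :
    DiagRep τ l f g fun θ => f (facePoint l (θ, 0)) := by
  refine Eventually.of_forall fun ⟨θ, t⟩ hq => ?_
  have hc : Continuous fun t => g (facePoint l (θ, t)) :=
    hg.comp ((continuous_facePoint l).comp (by fun_prop))
  have h1 := intervalIntegral.integral_eq_sub_of_hasDerivAt (fun r _ => h θ r)
    (hc.intervalIntegrable 0 t)
  -- The segment between a point of the slab and the face lies in the slab apart from its end point,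
  -- so `faceLift` equals `g` a.e. along it.
  have h2 : ∫ r in (0 : ℝ)..t, faceLift τ l g (θ, r) = ∫ r in (0 : ℝ)..t, g (facePoint l (θ, r)) := by
    obtain ⟨ht, hθt⟩ := (facePoint_mem_cube l (θ, t)).1 hq.2
    refine intervalIntegral.integral_congr_ae ?_
    filter_upwards [Measure.ae_ne volume (0 : ℝ)] with r hr0 hr
    rw [uIoc_of_ge ht.2.le] at hr
    refine indicator_of_mem (show (θ, r) ∈ faceSlab τ l from ⟨hq.1, ?_⟩) _
    have hr' : r < 0 := lt_of_le_of_ne hr.2 hr0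
    refine (facePoint_mem_cube l (θ, r)).2 ⟨⟨ht.1.trans hr.1, hr'⟩, fun i => ⟨?_, ?_⟩⟩
    · have := (hθt i).1
      have := hr.1
      simp only at *
      linarith
    · have := (mem_cube.1 hq.1 i).2
      simp only at *
      linarith
  change f (facePoint l (θ, t)) = f (facePoint l (θ, 0)) + _
  rw [h2, h1]
  abel

theorem facePoint_zero (l : Fin (k + 1)) (θ : Fin k → ℝ) :
    facePoint l (θ, 0) = l.insertNth (α := fun _ => ℝ) 0 θ := by
  funext i
  simp [facePoint, diagShift]

/-- The measure of each face is dominated by the product measure. Convergence of `Φ` alone therefore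
gives convergence of its restrictions to all faces, and in particular of both a restriction and its
trace. -/
theorem eLpNorm_sub_faceRestriction_le (j : Fin k ↪o Fin m) (Φ : TensorSpace m n τ)
    {f : (Fin m → ℝ) → TensorVec m n} (hf : Continuous f) :
    eLpNorm (faceRestriction j Φ - fun θ => f (faceEmbed j θ)) 2 (volume.restrict (cube τ k))
      ≤ eLpNorm (⇑Φ - f) 2 (Measure.pi fun _ : Fin m => delayMeasure τ) := by
  have h1 : AEStronglyMeasurable (⇑Φ - f) (faceMeasure τ (faceSet j)) :=
    ((Lp.aestronglyMeasurable Φ).sub hf.aestronglyMeasurable).mono_measure (faceMeasure_le τ _)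
  exact (eLpNorm_comp_measurePreserving h1 (measurePreserving_faceEmbed τ j)).trans_le
    (eLpNorm_mono_measure _ (faceMeasure_le τ _))

theorem memLp_faceRestriction (j : Fin k ↪o Fin m) (Φ : TensorSpace m n τ) :
    MemLp (faceRestriction j Φ) 2 (volume.restrict (cube τ k)) :=
  ((Lp.memLp Φ).mono_measure (faceMeasure_le τ _)).comp_measurePreserving
    (measurePreserving_faceEmbed τ j)

/-- The restrictions of a limit of smooth triples to the faces are primitives along the diagonal lines
of the diagonal derivatives in the triple. -/
theorem diagRep_of_mem_closure (hτ : 0 ≤ τ) {Atilde : C(Icc (-τ) (0 : ℝ), Vec n) →L[ℝ] Vec n}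
    {x : (TensorSpace m n τ × TensorSpace m n τ) × FaceFamily m n τ}
    (hx : x ∈ closure (coreTriples m Atilde : Set
      ((TensorSpace m n τ × TensorSpace m n τ) × FaceFamily m n τ)))
    (j : Fin (k + 1) ↪o Fin m) (l : Fin (k + 1)) :
    DiagRep τ l (faceRestriction j x.1.1) (fun θ => x.2 (faceSet j) (faceEmbed j θ))
      (faceRestriction (l.succAboveOrderEmb.trans j) x.1.1) := by
  obtain ⟨y, hy, hlim⟩ := mem_closure_iff_seq_limit.1 hx
  choose N c ψ ψ' hψ hψ' hΦ _ hg using fun i => exists_rep_of_mem_coreTriples (hy i)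
  set f := fun i => sumTensor (c i) (fun r a => (ψ i r a : ℝ → Vec n)) with hf
  set g := fun i θ => ∑ a ∈ faceSet j, sumTensor (c i)
    (fun r => Function.update (fun a => (ψ i r a : ℝ → Vec n)) a (ψ' i r a)) θ with hgd
  have hψc : ∀ i r a, Continuous (ψ i r a : ℝ → Vec n) := fun i r a => (ψ i r a).continuous
  have hfc : ∀ i, Continuous (f i) := fun i => continuous_sumTensor _ (hψc i)
  have hgc : ∀ i, Continuous (g i) := fun i => continuous_finsetSum _ fun a _ =>
    continuous_sumTensor _ (continuous_update_fun (hψc i) a fun r => hψ' i r a)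
  have hmem : ∀ {k' : ℕ} (j' : Fin k' ↪o Fin m) {w : (Fin m → ℝ) → TensorVec m n}, Continuous w →
      MemLp (fun θ => w (faceEmbed j' θ)) 2 (volume.restrict (cube τ k')) := fun j' _ hw =>
    (memLp_faceMeasure hτ (faceSet j') hw).comp_measurePreserving (measurePreserving_faceEmbed τ j')
  have hlim1 : Tendsto (fun i => eLpNorm (⇑x.1.1 - f i) 2
      (Measure.pi fun _ : Fin m => delayMeasure τ)) atTop (𝓝 0) := by
    have h1 : Tendsto (fun i => (y i).1.1) atTop (𝓝 x.1.1) :=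
      ((continuous_fst.comp continuous_fst).tendsto x).comp hlim
    refine ((Lp.tendsto_Lp_iff_tendsto_eLpNorm' _ _).1 h1).congr fun i => ?_
    rw [eLpNorm_sub_comm]
    exact eLpNorm_congr_ae ((ae_eq_refl _).sub (hΦ i))
  have hlim2 : Tendsto (fun i => eLpNorm (⇑(x.2 (faceSet j)) - g i) 2
      (faceMeasure τ (faceSet j))) atTop (𝓝 0) := by
    have h1 : Tendsto (fun i => (y i).2 (faceSet j)) atTop (𝓝 (x.2 (faceSet j))) :=
      (((continuous_apply (faceSet j)).comp continuous_snd).tendsto x).comp hlim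
    refine ((Lp.tendsto_Lp_iff_tendsto_eLpNorm' _ _).1 h1).congr fun i => ?_
    rw [eLpNorm_sub_comm]
    exact eLpNorm_congr_ae ((ae_eq_refl _).sub (hg i (faceSet j)))
  refine DiagRep.of_tendsto (f' := fun i θ => f i (faceEmbed j θ))
    (g' := fun i θ => g i (faceEmbed j θ))
    (u' := fun i θ => f i (faceEmbed (l.succAboveOrderEmb.trans j) θ))
    (memLp_faceRestriction j _)
    ((Lp.memLp (x.2 (faceSet j))).comp_measurePreserving (measurePreserving_faceEmbed τ j))
    (memLp_faceRestriction _ _) (fun i => hmem j (hfc i)) (fun i => hmem j (hgc i))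
    (fun i => hmem _ (hfc i)) (fun i => ?_)
    (tendsto_of_tendsto_of_tendsto_of_le_of_le tendsto_const_nhds hlim1 (fun _ => zero_le)
      fun i => eLpNorm_sub_faceRestriction_le j _ (hfc i)) ?_
    (tendsto_of_tendsto_of_tendsto_of_le_of_le tendsto_const_nhds hlim1 (fun _ => zero_le)
      fun i => eLpNorm_sub_faceRestriction_le _ _ (hfc i))
  -- The values on `θ_l = 0` are those on the smaller face, by `faceEmbed_insertNth`.
  · have h1 := diagRep_of_hasDerivAt (τ := τ) (l := l) (f := fun θ => f i (faceEmbed j θ))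
      (g := fun θ => g i (faceEmbed j θ)) ((hgc i).comp (continuous_faceEmbed j))
      fun θ t => hasDerivAt_sumTensor_facePoint (c i) (hψ i) j l θ t
    simpa only [facePoint_zero, faceEmbed_insertNth] using h1
  · refine hlim2.congr fun i => ?_
    exact (eLpNorm_comp_measurePreserving ((Lp.aestronglyMeasurable _).sub
      (hgc i).aestronglyMeasurable) (measurePreserving_faceEmbed τ j)).symm

end FaceRepresentation

/-! ### Equivalence of the norms -/

section NormEquivalence

variable {m n k : ℕ} {τ : ℝ}

theorem eLpNorm_two_sq_eq_integral {α F : Type*} [MeasurableSpace α] {μ : Measure α}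
    [NormedAddCommGroup F] [InnerProductSpace ℝ F] {f : α → F} (hf : MemLp f 2 μ) :
    eLpNorm f 2 μ ^ 2 = ENNReal.ofReal (∫ x, ‖f x‖ ^ 2 ∂μ) := by
  have h1 := lp_norm_sq_eq_integral hf.toLp
  have h2 : ∫ x, ‖hf.toLp f x‖ ^ 2 ∂μ = ∫ x, ‖f x‖ ^ 2 ∂μ := by
    refine integral_congr_ae ?_
    filter_upwards [hf.coeFn_toLp] with x hx
    rw [hx]
  rw [← h2, ← h1, Lp.norm_toLp, ENNReal.ofReal_pow ENNReal.toReal_nonneg,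
    ENNReal.ofReal_toReal hf.2.ne]

theorem eLpNorm_faceRestriction_sq (j : Fin k ↪o Fin m) (Φ : TensorSpace m n τ) :
    eLpNorm (faceRestriction j Φ) 2 (volume.restrict (cube τ k)) ^ 2
      = ENNReal.ofReal (∫ θ, ‖Φ θ‖ ^ 2 ∂faceMeasure τ (faceSet j)) := by
  have h := (Lp.memLp Φ).mono_measure (faceMeasure_le τ (faceSet j))
  rw [← eLpNorm_two_sq_eq_integral h]
  exact congrArg (· ^ 2) (eLpNorm_comp_measurePreserving h.1 (measurePreserving_faceEmbed τ j))

/-- The square of the diagonal Sobolev norm of a restriction to a face, expressed by the restrictions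
of the function and its diagonal derivative. -/
noncomputable def faceNormSq (Φ : TensorSpace m n τ) (g : FaceFamily m n τ)
    (j : Fin (k + 1) ↪o Fin m) : ℝ :=
  ∫ θ, ‖Φ θ‖ ^ 2 ∂faceMeasure τ (faceSet j) + ‖g (faceSet j)‖ ^ 2
    + ∑ l, ∫ θ, ‖Φ θ‖ ^ 2 ∂faceMeasure τ ((faceSet j).erase (j l))

theorem integral_norm_sq_nonneg (Φ : TensorSpace m n τ) (S : Finset (Fin m)) :
    0 ≤ ∫ θ, ‖Φ θ‖ ^ 2 ∂faceMeasure τ S := integral_nonneg fun _ => sq_nonneg _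

theorem faceNormSq_nonneg (Φ : TensorSpace m n τ) (g : FaceFamily m n τ)
    (j : Fin (k + 1) ↪o Fin m) : 0 ≤ faceNormSq Φ g j :=
  add_nonneg (add_nonneg (integral_norm_sq_nonneg Φ _) (sq_nonneg _))
    (Finset.sum_nonneg fun _ _ => integral_norm_sq_nonneg Φ _)

theorem memLp_faceFamily_comp (g : FaceFamily m n τ) (j : Fin k ↪o Fin m) :
    MemLp (fun θ => g (faceSet j) (faceEmbed j θ)) 2 (volume.restrict (cube τ k)) :=
  (Lp.memLp (g (faceSet j))).comp_measurePreserving (measurePreserving_faceEmbed τ j)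

theorem diagNormSq_eq_of_mem_closure (hτ : 0 < τ)
    {Atilde : C(Icc (-τ) (0 : ℝ), Vec n) →L[ℝ] Vec n}
    {x : (TensorSpace m n τ × TensorSpace m n τ) × FaceFamily m n τ}
    (hx : x ∈ closure (coreTriples m Atilde : Set
      ((TensorSpace m n τ × TensorSpace m n τ) × FaceFamily m n τ)))
    (j : Fin (k + 1) ↪o Fin m) :
    diagNormSq τ (faceRestriction j x.1.1) = ENNReal.ofReal (faceNormSq x.1.1 x.2 j) := by
  rw [diagNormSq_of_diagRep hτ (memLp_faceFamily_comp x.2 j)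
    (fun l => memLp_faceRestriction (l.succAboveOrderEmb.trans j) x.1.1)
    (diagRep_of_mem_closure hτ.le hx j)]
  have h1 : eLpNorm (fun θ => x.2 (faceSet j) (faceEmbed j θ)) 2 (volume.restrict (cube τ (k + 1))) ^ 2
      = ENNReal.ofReal (‖x.2 (faceSet j)‖ ^ 2) := by
    rw [lp_norm_sq_eq_integral, ← eLpNorm_two_sq_eq_integral (Lp.memLp _)]
    exact congrArg (· ^ 2) (eLpNorm_comp_measurePreserving (Lp.aestronglyMeasurable _)
      (measurePreserving_faceEmbed τ j))
  simp only [eLpNorm_faceRestriction_sq, h1, faceSet_erase]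
  rw [faceNormSq, ENNReal.ofReal_add (add_nonneg (integral_norm_sq_nonneg _ _) (sq_nonneg _))
    (Finset.sum_nonneg fun _ _ => integral_norm_sq_nonneg _ _),
    ENNReal.ofReal_add (integral_norm_sq_nonneg _ _) (sq_nonneg _),
    ENNReal.ofReal_sum_of_nonneg fun _ _ => integral_norm_sq_nonneg _ _]

/-- The square of the diagonal Sobolev norm on the domain. -/
noncomputable def totalNormSq (Φ : TensorSpace m n τ) (g : FaceFamily m n τ) : ℝ :=
  ∑ k ∈ Finset.range m, ∑ j : Fin (k + 1) ↪o Fin m, faceNormSq Φ g j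

theorem domainNorm_eq_of_mem_closure (hτ : 0 < τ)
    {Atilde : C(Icc (-τ) (0 : ℝ), Vec n) →L[ℝ] Vec n}
    {x : (TensorSpace m n τ × TensorSpace m n τ) × FaceFamily m n τ}
    (hx : x ∈ closure (coreTriples m Atilde : Set
      ((TensorSpace m n τ × TensorSpace m n τ) × FaceFamily m n τ))) :
    domainNorm x.1.1 = ENNReal.ofReal √(totalNormSq x.1.1 x.2) := by
  have h0 : ∀ k ∈ Finset.range m,
      0 ≤ ∑ j : Fin (k + 1) ↪o Fin m, faceNormSq x.1.1 x.2 j := fun k _ =>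
    Finset.sum_nonneg fun j _ => faceNormSq_nonneg _ _ j
  rw [domainNorm, totalNormSq, Real.sqrt_eq_rpow, ← ENNReal.ofReal_rpow_of_nonneg (Finset.sum_nonneg h0)
    (by norm_num), ENNReal.ofReal_sum_of_nonneg h0]
  congr 1
  refine Finset.sum_congr rfl fun k _ => ?_
  rw [ENNReal.ofReal_sum_of_nonneg fun j _ => faceNormSq_nonneg _ _ j]
  exact Finset.sum_congr rfl fun j _ => diagNormSq_eq_of_mem_closure hτ hx j

theorem faceNormSq_le_totalNormSq (Φ : TensorSpace m n τ) (g : FaceFamily m n τ) (hk : k < m)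
    (j : Fin (k + 1) ↪o Fin m) : faceNormSq Φ g j ≤ totalNormSq Φ g := by
  refine le_trans ?_ (Finset.single_le_sum (f := fun k => ∑ j : Fin (k + 1) ↪o Fin m,
    faceNormSq Φ g j) (fun k _ => Finset.sum_nonneg fun j _ => faceNormSq_nonneg _ _ j)
    (Finset.mem_range.2 hk))
  exact Finset.single_le_sum (f := fun j : Fin (k + 1) ↪o Fin m => faceNormSq Φ g j)
    (fun j _ => faceNormSq_nonneg _ _ j) (Finset.mem_univ j)

/-- Faces of positive dimension occur in the sum themselves. The value at the origin occurs only as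
a trace on an edge, which exists because `0 < m`. -/
theorem integral_norm_sq_le_totalNormSq (hm : 0 < m) (Φ : TensorSpace m n τ)
    (g : FaceFamily m n τ) (S : Finset (Fin m)) :
    ∫ θ, ‖Φ θ‖ ^ 2 ∂faceMeasure τ S ≤ totalNormSq Φ g := by
  rcases S.eq_empty_or_nonempty with rfl | hS
  · obtain ⟨k, hk, j, hj⟩ := exists_faceSet_eq (Finset.singleton_nonempty (⟨0, hm⟩ : Fin m))
    refine le_trans ?_ (faceNormSq_le_totalNormSq Φ g hk j)
    have h0 : (faceSet j).erase (j 0) = ∅ := by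
      have : j 0 ∈ faceSet j := (mem_faceSet j _).2 ⟨0, rfl⟩
      rw [hj] at this ⊢
      rw [Finset.mem_singleton.1 this, Finset.erase_singleton]
    have h1 := Finset.single_le_sum (f := fun l => ∫ θ, ‖Φ θ‖ ^ 2
      ∂faceMeasure τ ((faceSet j).erase (j l))) (fun l _ => integral_norm_sq_nonneg Φ _)
      (Finset.mem_univ 0)
    simp only [h0] at h1
    have h2 := integral_norm_sq_nonneg Φ (faceSet j)
    have h3 := sq_nonneg ‖g (faceSet j)‖
    rw [faceNormSq]
    linarith
  · obtain ⟨k, hk, j, rfl⟩ := exists_faceSet_eq hS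
    refine le_trans ?_ (faceNormSq_le_totalNormSq Φ g hk j)
    have h1 : 0 ≤ ∑ l, ∫ θ, ‖Φ θ‖ ^ 2 ∂faceMeasure τ ((faceSet j).erase (j l)) :=
      Finset.sum_nonneg fun l _ => integral_norm_sq_nonneg Φ _
    have h3 := sq_nonneg ‖g (faceSet j)‖
    rw [faceNormSq]
    linarith

/-- Only faces of positive dimension contribute diagonal derivatives to the total, so that on the
empty set of directions has to vanish. -/
theorem norm_sq_le_totalNormSq (Φ : TensorSpace m n τ) {g : FaceFamily m n τ} (h0 : g ∅ = 0)
    (S : Finset (Fin m)) : ‖g S‖ ^ 2 ≤ totalNormSq Φ g := by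
  rcases S.eq_empty_or_nonempty with rfl | hS
  · rw [h0, norm_zero, zero_pow two_ne_zero]
    exact Finset.sum_nonneg fun k _ => Finset.sum_nonneg fun j _ => faceNormSq_nonneg _ _ j
  · obtain ⟨k, hk, j, rfl⟩ := exists_faceSet_eq hS
    refine le_trans ?_ (faceNormSq_le_totalNormSq Φ g hk j)
    have h1 : 0 ≤ ∑ l, ∫ θ, ‖Φ θ‖ ^ 2 ∂faceMeasure τ ((faceSet j).erase (j l)) :=
      Finset.sum_nonneg fun l _ => integral_norm_sq_nonneg Φ _
    have h3 := integral_norm_sq_nonneg Φ (faceSet j)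
    rw [faceNormSq]
    linarith

theorem exists_totalNormSq_le (m n : ℕ) (τ : ℝ) : ∃ N : ℝ, 0 ≤ N ∧
    ∀ (Φ : TensorSpace m n τ) (g : FaceFamily m n τ) (B D : ℝ), ‖Φ‖ ^ 2 ≤ B →
      (∀ S, ‖g S‖ ^ 2 ≤ D) → totalNormSq Φ g ≤ N * (B + D + m * B) := by
  -- The number of faces of positive dimension; each has at most `m` traces.
  refine ⟨((∑ k ∈ Finset.range m, Fintype.card (Fin (k + 1) ↪o Fin m) : ℕ) : ℝ),
    Nat.cast_nonneg _, fun Φ g B D hB hD => ?_⟩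
  have hQ : ∀ S, ∫ θ, ‖Φ θ‖ ^ 2 ∂faceMeasure τ S ≤ B := fun S => by
    refine le_trans ?_ hB
    rw [norm_sq_eq_sum_faces Φ]
    exact Finset.single_le_sum (f := fun S => ∫ θ, ‖Φ θ‖ ^ 2 ∂faceMeasure τ S)
      (fun S _ => integral_norm_sq_nonneg Φ S) (Finset.mem_univ S)
  have hB0 : 0 ≤ B := (sq_nonneg _).trans hB
  rw [totalNormSq, Nat.cast_sum, Finset.sum_mul]
  refine Finset.sum_le_sum fun k hk => ?_
  have h1 : ∀ j ∈ (Finset.univ : Finset (Fin (k + 1) ↪o Fin m)),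
      faceNormSq Φ g j ≤ B + D + m * B := by
    intro j _
    refine add_le_add (add_le_add (hQ _) (hD _)) ((Finset.sum_le_sum fun l _ => hQ _).trans ?_)
    rw [Finset.sum_const, Finset.card_univ, Fintype.card_fin, nsmul_eq_mul]
    have : ((k + 1 : ℕ) : ℝ) ≤ m := by exact_mod_cast Finset.mem_range.1 hk
    exact mul_le_mul_of_nonneg_right this hB0
  refine (Finset.sum_le_sum h1).trans (le_of_eq ?_)
  rw [Finset.sum_const, Finset.card_univ, nsmul_eq_mul]

/-- The graph norm and the diagonal Sobolev norm of the limits of smooth triples bound each other. -/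
theorem exists_totalNormSq_bounds (hm : 0 < m) (hτ : 0 ≤ τ)
    (Atilde : C(Icc (-τ) (0 : ℝ), Vec n) →L[ℝ] Vec n) :
    ∃ c C : ℝ, 0 < c ∧ 0 < C ∧ ∀ x ∈ closure (coreTriples m Atilde : Set
      ((TensorSpace m n τ × TensorSpace m n τ) × FaceFamily m n τ)),
      ‖x.1.1‖ ^ 2 + ‖x.1.2‖ ^ 2 ≤ c * totalNormSq x.1.1 x.2 ∧
      totalNormSq x.1.1 x.2 ≤ C * (‖x.1.1‖ ^ 2 + ‖x.1.2‖ ^ 2) := by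
  obtain ⟨K, hK, h⟩ := exists_bounds_closure_coreTriples hτ m Atilde
  obtain ⟨N, hN0, hN⟩ := exists_totalNormSq_le m n τ
  -- The sums over faces of `Φ` and of the derivatives are each at most `2 ^ m` times the total, and
  -- `K` bounds the compound by both. The final `+ 1` only ensures positivity.
  refine ⟨2 ^ m * (1 + 2 * K), N * (1 + K + m) + 1, by positivity, by positivity, fun x hx => ?_⟩
  obtain ⟨h1, h2, h3⟩ := h x hx
  have hcard : (Finset.univ : Finset (Finset (Fin m))).card = 2 ^ m := by simp
  have hΦT : ‖x.1.1‖ ^ 2 ≤ 2 ^ m * totalNormSq x.1.1 x.2 := by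
    rw [norm_sq_eq_sum_faces x.1.1]
    refine (Finset.sum_le_sum fun S _ => integral_norm_sq_le_totalNormSq hm x.1.1 x.2 S).trans
      (le_of_eq ?_)
    rw [Finset.sum_const, hcard, nsmul_eq_mul, Nat.cast_pow, Nat.cast_two]
  have hgT : ∑ S, ‖x.2 S‖ ^ 2 ≤ 2 ^ m * totalNormSq x.1.1 x.2 := by
    refine (Finset.sum_le_sum fun S _ => norm_sq_le_totalNormSq x.1.1 h3 S).trans (le_of_eq ?_)
    rw [Finset.sum_const, hcard, nsmul_eq_mul, Nat.cast_pow, Nat.cast_two]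
  have hE : ‖x.1.1‖ ^ 2 ≤ ‖x.1.1‖ ^ 2 + ‖x.1.2‖ ^ 2 := le_add_of_nonneg_right (sq_nonneg _)
  have h5 := hN x.1.1 x.2 _ _ hE h1
  have hE0 : 0 ≤ ‖x.1.1‖ ^ 2 + ‖x.1.2‖ ^ 2 := add_nonneg (sq_nonneg _) (sq_nonneg _)
  have h4 := mul_le_mul_of_nonneg_left (add_le_add hΦT hgT) hK
  generalize totalNormSq x.1.1 x.2 = T at *
  generalize ‖x.1.1‖ ^ 2 = a at *
  generalize ‖x.1.2‖ ^ 2 = b at *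
  constructor <;> linarith

/-- The equivalence of the graph norm and the diagonal Sobolev norm. -/
theorem exists_norm_equivalence (hm : 0 < m) (hτ : 0 < τ)
    (Atilde : C(Icc (-τ) (0 : ℝ), Vec n) →L[ℝ] Vec n) :
    ∃ c C : ℝ, 0 < c ∧ 0 < C ∧ ∀ Φ Ψ : TensorSpace m n τ, (Φ, Ψ) ∈ additiveCompound m Atilde →
      ENNReal.ofReal (c * √(‖Φ‖ ^ 2 + ‖Ψ‖ ^ 2)) ≤ domainNorm Φ ∧
      domainNorm Φ ≤ ENNReal.ofReal (C * √(‖Φ‖ ^ 2 + ‖Ψ‖ ^ 2)) := by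
  obtain ⟨c, C, hc, hC, h⟩ := exists_totalNormSq_bounds hm hτ.le Atilde
  refine ⟨√c⁻¹, √C, Real.sqrt_pos.2 (inv_pos.2 hc), Real.sqrt_pos.2 hC, fun Φ Ψ hΦ => ?_⟩
  obtain ⟨g, hg⟩ := exists_mem_closure_coreTriples hm hτ Atilde hΦ
  obtain ⟨h1, h2⟩ := h _ hg
  have h3 := domainNorm_eq_of_mem_closure (x := ((Φ, Ψ), g)) hτ hg
  simp only at h1 h2 h3
  rw [h3, ← Real.sqrt_mul (inv_nonneg.2 hc.le), ← Real.sqrt_mul hC.le]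
  exact ⟨ENNReal.ofReal_le_ofReal (Real.sqrt_le_sqrt ((inv_mul_le_iff₀ hc).2 h1)),
    ENNReal.ofReal_le_ofReal (Real.sqrt_le_sqrt h2)⟩

end NormEquivalence

end DelayCompound
-- The theorem
theorem mainTheorem6 (n m : ℕ) (hm : 0 < m) (τ : ℝ) (hτ : 0 < τ)
    (Atilde : C(Icc (-τ) (0 : ℝ), DelayCompound.Vec n) →L[ℝ] DelayCompound.Vec n) :
    (∀ Φ ∈ DelayCompound.additiveCompoundDomain m Atilde,
      ∀ (k : ℕ) (j : Fin (k + 1) ↪o Fin m),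
        DelayCompound.MemDiagSobolev (DelayCompound.cube τ (k + 1))
          (DelayCompound.faceRestriction j Φ) ∧
        ∀ l : Fin (k + 1),
          DelayCompound.HasFaceTrace τ l (DelayCompound.faceRestriction j Φ)
            (DelayCompound.faceRestriction (l.succAboveOrderEmb.trans j) Φ)) ∧
    ∃ c C : ℝ, 0 < c ∧ 0 < C ∧
      ∀ Φ Ψ : DelayCompound.TensorSpace m n τ,
        (Φ, Ψ) ∈ DelayCompound.additiveCompound m Atilde →
          ENNReal.ofReal (c * Real.sqrt (‖Φ‖ ^ 2 + ‖Ψ‖ ^ 2)) ≤ DelayCompound.domainNorm Φ ∧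
          DelayCompound.domainNorm Φ ≤ ENNReal.ofReal (C * Real.sqrt (‖Φ‖ ^ 2 + ‖Ψ‖ ^ 2)) := by
  refine ⟨?_, DelayCompound.exists_norm_equivalence hm hτ Atilde⟩
  rintro Φ ⟨Ψ, hΦ⟩ k j
  obtain ⟨g, hg⟩ := DelayCompound.exists_mem_closure_coreTriples hm hτ Atilde hΦ
  -- The representations for all `l` share one derivative, which gives the Sobolev extension and the
  -- traces at once.
  have hrep := DelayCompound.diagRep_of_mem_closure hτ.le hg j
  have hgj := DelayCompound.memLp_faceFamily_comp g j
  exact ⟨DelayCompound.memDiagSobolev_of_diagRep hτ hgj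
    (fun l => DelayCompound.memLp_faceRestriction (l.succAboveOrderEmb.trans j) Φ) hrep,
    fun l => (hrep l).hasFaceTrace hgj⟩
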